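/- All complexes are finite abstract simplicial complexes; faces are nonempty. For a vertex $v$ of $C$, $\mathrm{del}(v,C)$ consists of the faces not containing $v$, and $\mathrm{link}(v,C)$ of the faces $s\not\ni v$ with $s\cup\{v\}\in C$. The barycentric subdivision $\mathrm{sd}\,C$ has the faces of $C$ as vertices and the nonempty chains of faces (under inclusion) as faces. A $d$-complex is a complex of dimension $d$; it is pure if all its inclusion-maximal faces have dimension $d$. A simplex is the complex of all nonempty subsets of a nonempty finite set. A pure $d$-complex $C$ is constructible if it is a simplex, or $d=0$, or $d\ge 1$ and $C=C_1\cup C_2$ with $C_1,C_2$ constructible $d$-complexes and $C_1\cap C_2$ a constructible $(d-1)$-complex. It is shellable if it is a simplex, or $d=0$, or $d\ge1$ and $C=C_1\cup C_2$ with $C_1$ a shellable $d$-complex, $C_2$ a $d$-simplex and $C_1\cap C_2$ a shellable $(d-1)$-complex. It is vertex-decomposable if it is a simplex, or $d=0$, or $d\ge1$ and for some vertex $v$ both $\mathrm{del}(v,C)$ and $\mathrm{link}(v,C)$ are vertex-decomposable and $\mathrm{del}(v,C)$ is pure of dimension $d$. A (not necessarily pure) $d$-complex is non-evasive if it is a simplex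 (in particular, a single point), or $d\ge1$ and for some vertex $v$ both $\mathrm{del}(v,C)$ and $\mathrm{link}(v,C)$ are non-evasive; otherwise it is evasive. An elementary collapse removes from a complex two faces $\sigma\subsetneq\Sigma$, where $\Sigma$ is the only face properly containing $\sigma$; a complex collapses onto a subcomplex if it can be reduced to it by finitely many elementary collapses. The boundary $\partial C$ of a pure $d$-complex is generated by its $(d-1)$-faces that lie in exactly one $d$-face. A simplicial $3$-ball is LC (locally constructible) if it collapses onto its boundary minus one triangle. Let $B_{9,18}$ be the complex with the $18$ facets (vertices $0,\dots,8$) \[ 0\,1\,2\,3,\ 0\,1\,2\,4,\ 0\,1\,4\,5,\ 0\,1\,5\,7,\ 0\,1\,6\,8,\ 0\,1\,7\,8,\ 0\,2\,3\,4,\ 0\,6\,7\,8,\ 1\,2\,3\,6,\ 1\,2\,4\,5,\ 1\,2\,5\,8,\ 1\,2\,6\,8,\ 1\,5\,7\,8,\ 2\,3\,4\,7,\ 2\,3\,6\,7,\ 2\,4\,6\,7,\ 2\,4\,6\,8,\ 4\,6\,7\,8, \] let $B_{12,38}$ be the complex with the $38$ facets (vertices $2,\dots,13$) \[ 2\,3\,4\,7,\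 2\,3\,4\,10,\ 2\,3\,7\,10,\ 2\,4\,5\,7,\ 2\,4\,5\,10,\ 2\,5\,7\,13,\ 2\,5\,8\,10,\ 2\,5\,8\,13,\ 2\,6\,9\,11,\ 2\,6\,11\,13,\ 2\,6\,12\,13,\ 2\,7\,8\,10,\ 2\,7\,8\,11,\ 2\,7\,11\,13,\ 2\,8\,9\,11,\ 2\,8\,9\,12,\ 2\,8\,12\,13,\ 3\,4\,6\,7,\ 3\,4\,6\,10,\ 3\,5\,8\,13,\ 3\,5\,9\,11,\ 3\,5\,9\,13,\ 3\,6\,7\,12,\ 3\,6\,10\,13,\ 3\,6\,12\,13,\ 3\,7\,10\,12,\ 3\,8\,9\,11,\ 3\,8\,9\,12,\ 3\,8\,12\,13,\ 3\,9\,10\,12,\ 3\,9\,10\,13,\ 4\,5\,6\,7,\ 4\,5\,6\,10,\ 5\,6\,7\,9,\ 5\,6\,9\,11,\ 5\,6\,10\,11,\ 5\,7\,9\,13,\ 6\,10\,11\,13, \] and let $S_{13,56}=\partial(v*B_{12,38})$, where $v*B_{12,38}$ is the cone with a new apex $v=1$. (As is known, $B_{9,18}$ and $B_{12,38}$ triangulate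 the $3$-ball and $S_{13,56}$ triangulates the $3$-sphere; this is background and not part of the assertion.) Then: (i) $B_{9,18}$ is not shellable, but $\mathrm{sd}\,B_{9,18}$ is vertex-decomposable. (ii) $S_{13,56}$ is not constructible, but $\mathrm{sd}\,S_{13,56}$ is vertex-decomposable. (iii) $B_{12,38}$ is evasive and not LC (it does not collapse onto its boundary minus any triangle), but $\mathrm{sd}\,B_{12,38}$ is LC (it collapses onto its boundary minus some triangle) and non-evasive. -/

import Mathlib

namespace PreAbstractSimplicialComplex

variable {α : Type*}

/-- The simplicial complex generated by a list of finite sets: its faces are the nonempty subsets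
of the members of the list. -/
def ofFacets (L : List (Finset α)) : PreAbstractSimplicialComplex α where
  faces := {s | s.Nonempty ∧ ∃ F ∈ L, s ⊆ F}
  isRelLowerSet_faces := by
    rintro s ⟨hs, F, hF, hsF⟩
    exact ⟨hs, fun t hts ht => ⟨ht, F, hF, hts.trans hsF⟩⟩

/-- `K` is a pure `d`-dimensional complex: it is nonempty and every face lies in a face with
`d + 1` vertices (so no face has more than `d + 1` vertices). -/
def IsPure (d : ℕ) (K : PreAbstractSimplicialComplex α) : Prop :=
  K.faces.Nonempty ∧ ∀ s ∈ K.faces, ∃ F ∈ K.faces, s ⊆ F ∧ F.card = d + 1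

/-- `K` is a simplex (of any dimension `≥ 0`): the complex of all nonempty subsets of a nonempty
finite set. -/
def IsSimplex (K : PreAbstractSimplicialComplex α) : Prop :=
  ∃ F : Finset α, F.Nonempty ∧ K.faces = {s | s.Nonempty ∧ s ⊆ F}

/-- The deletion of the vertex `v`: all faces that do not contain `v`. -/
def deletion (v : α) (K : PreAbstractSimplicialComplex α) : PreAbstractSimplicialComplex α where
  faces := {s | s ∈ K.faces ∧ v ∉ s}
  isRelLowerSet_faces := by
    rintro s ⟨hs, hv⟩
    exact ⟨(K.isRelLowerSet_faces hs).1,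
      fun t hts ht => ⟨(K.isRelLowerSet_faces hs).2 hts ht, fun h => hv (hts h)⟩⟩

/-- The link of the vertex `v`: all (nonempty) faces `s` with `v ∉ s` and `s ∪ {v}` a face. -/
def link [DecidableEq α] (v : α) (K : PreAbstractSimplicialComplex α) :
    PreAbstractSimplicialComplex α where
  faces := {s | s.Nonempty ∧ v ∉ s ∧ insert v s ∈ K.faces}
  isRelLowerSet_faces := by
    rintro s ⟨hs, hv, hi⟩
    exact ⟨hs, fun t hts ht => ⟨ht, fun h => hv (hts h),
      (K.isRelLowerSet_faces hi).2 (Finset.insert_subset_insert v hts)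
        (Finset.insert_nonempty v t)⟩⟩

/-- The cone `v * K` with apex `v` (meant for `v` not a vertex of `K`). -/
def cone [DecidableEq α] (v : α) (K : PreAbstractSimplicialComplex α) :
    PreAbstractSimplicialComplex α where
  faces := {s | s.Nonempty ∧ (s.erase v = ∅ ∨ s.erase v ∈ K.faces)}
  isRelLowerSet_faces := by
    rintro s ⟨hs, h⟩
    refine ⟨hs, fun t hts ht => ⟨ht, ?_⟩⟩
    have hsub : t.erase v ⊆ s.erase v := Finset.erase_subset_erase v hts
    rcases (t.erase v).eq_empty_or_nonempty with h0 | h0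
    · exact Or.inl h0
    · rcases h with h | h
      · rw [h] at hsub
        exact Or.inl (Finset.subset_empty.mp hsub)
      · exact Or.inr ((K.isRelLowerSet_faces h).2 hsub h0)

/-- The boundary of a pure `d`-complex (`d ≥ 1`): the complex generated by the `(d-1)`-faces, with
`d` vertices, that lie in exactly one `d`-face. -/
def boundary (d : ℕ) (K : PreAbstractSimplicialComplex α) : PreAbstractSimplicialComplex α where
  faces := {s | s.Nonempty ∧ ∃ t ∈ K.faces, s ⊆ t ∧ t.card = d ∧
    ∃! F : Finset α, F ∈ K.faces ∧ F.card = d + 1 ∧ t ⊆ F}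
  isRelLowerSet_faces := by
    rintro s ⟨hs, t, ht, hst, h⟩
    exact ⟨hs, fun u hus hu => ⟨hu, t, ht, hus.trans hst, h⟩⟩

/-- The barycentric subdivision: its vertices are the faces of `K`, its faces are the nonempty
finite chains of faces of `K` under inclusion. -/
def sd (K : PreAbstractSimplicialComplex α) : PreAbstractSimplicialComplex (Finset α) where
  faces := {c | c.Nonempty ∧ (∀ s ∈ c, s ∈ K.faces) ∧ IsChain (· ⊆ ·) (c : Set (Finset α))}
  isRelLowerSet_faces := by
    rintro c ⟨hc, hK, hch⟩
    exact ⟨hc, fun b hbc hb => ⟨hb, fun s hs => hK s (hbc hs),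
      hch.mono (Finset.coe_subset.mpr hbc)⟩⟩

/-- Constructible complexes. -/
inductive IsConstructible : PreAbstractSimplicialComplex α → Prop
  | simplex {K : PreAbstractSimplicialComplex α} (hK : K.IsSimplex) : IsConstructible K
  | points {K : PreAbstractSimplicialComplex α} (hK : K.IsPure 0) : IsConstructible K
  | union {d : ℕ} {C₁ C₂ : PreAbstractSimplicialComplex α}
      (hp₁ : C₁.IsPure (d + 1)) (hp₂ : C₂.IsPure (d + 1)) (hp : (C₁ ⊓ C₂).IsPure d)
      (h₁ : IsConstructible C₁) (h₂ : IsConstructible C₂) (h : IsConstructible (C₁ ⊓ C₂)) :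
      IsConstructible (C₁ ⊔ C₂)

/-- Shellable complexes. -/
inductive IsShellable : PreAbstractSimplicialComplex α → Prop
  | simplex {K : PreAbstractSimplicialComplex α} (hK : K.IsSimplex) : IsShellable K
  | points {K : PreAbstractSimplicialComplex α} (hK : K.IsPure 0) : IsShellable K
  | union {d : ℕ} {C₁ C₂ : PreAbstractSimplicialComplex α}
      (hp₁ : C₁.IsPure (d + 1)) (hp₂ : C₂.IsPure (d + 1)) (hp : (C₁ ⊓ C₂).IsPure d)
      (h₁ : IsShellable C₁) (h₂ : C₂.IsSimplex) (h : IsShellable (C₁ ⊓ C₂)) :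
      IsShellable (C₁ ⊔ C₂)

/-- Vertex-decomposable (pure) complexes. -/
inductive IsVertexDecomposable [DecidableEq α] : PreAbstractSimplicialComplex α → Prop
  | simplex {K : PreAbstractSimplicialComplex α} (hK : K.IsSimplex) : IsVertexDecomposable K
  | points {K : PreAbstractSimplicialComplex α} (hK : K.IsPure 0) : IsVertexDecomposable K
  | shed {d : ℕ} {K : PreAbstractSimplicialComplex α} {v : α} (hK : K.IsPure (d + 1))
      (hv : {v} ∈ K.faces) (hp : (K.deletion v).IsPure (d + 1))
      (hdel : IsVertexDecomposable (K.deletion v))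
      (hlink : IsVertexDecomposable (K.link v)) : IsVertexDecomposable K

/-- Non-evasive (not necessarily pure) complexes; a single point is a `0`-simplex. The hypothesis
`hdim` of the recursive case says that `K` has dimension at least one. -/
inductive IsNonevasive [DecidableEq α] : PreAbstractSimplicialComplex α → Prop
  | simplex {K : PreAbstractSimplicialComplex α} (hK : K.IsSimplex) : IsNonevasive K
  | step {K : PreAbstractSimplicialComplex α} {v : α} (hdim : ∃ s ∈ K.faces, 2 ≤ s.card)
      (hv : {v} ∈ K.faces) (hdel : IsNonevasive (K.deletion v))
      (hlink : IsNonevasive (K.link v)) : IsNonevasive K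

/-- Evasive means not non-evasive. -/
def IsEvasive [DecidableEq α] (K : PreAbstractSimplicialComplex α) : Prop :=
  ¬ K.IsNonevasive

/-- `L` arises from `K` by an elementary collapse: a pair of faces `σ ⊂ τ` is removed, where `τ`
is the only face of `K` that properly contains `σ`. -/
def ElementaryCollapse (K L : PreAbstractSimplicialComplex α) : Prop :=
  ∃ σ ∈ K.faces, ∃ τ ∈ K.faces, σ ⊂ τ ∧ (∀ ρ ∈ K.faces, σ ⊂ ρ → ρ = τ) ∧
    L.faces = K.faces \ {σ, τ}

/-- `K` collapses onto `L` by finitely many elementary collapses. -/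
def CollapsesOnto (K L : PreAbstractSimplicialComplex α) : Prop :=
  Relation.ReflTransGen ElementaryCollapse K L

/-- A simplicial `3`-ball is locally constructible (LC) if it collapses onto its boundary minus
a triangle. -/
def IsLCBall (K : PreAbstractSimplicialComplex α) : Prop :=
  ∃ t ∈ (K.boundary 3).faces, t.card = 3 ∧
    ∃ D : PreAbstractSimplicialComplex α,
      D.faces = (K.boundary 3).faces \ {t} ∧ K.CollapsesOnto D

end PreAbstractSimplicialComplex

/-- The triangulated `3`-ball `B_{9,18}`, with vertices `0, …, 8` and `18` tetrahedra. -/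
def ballB_9_18 : PreAbstractSimplicialComplex ℕ :=
  PreAbstractSimplicialComplex.ofFacets
   [{0, 1, 2, 3}, {0, 1, 2, 4}, {0, 1, 4, 5}, {0, 1, 5, 7}, {0, 1, 6, 8},
    {0, 1, 7, 8}, {0, 2, 3, 4}, {0, 6, 7, 8}, {1, 2, 3, 6}, {1, 2, 4, 5},
    {1, 2, 5, 8}, {1, 2, 6, 8}, {1, 5, 7, 8}, {2, 3, 4, 7}, {2, 3, 6, 7},
    {2, 4, 6, 7}, {2, 4, 6, 8}, {4, 6, 7, 8}]

/-- The triangulated `3`-ball `B_{12,38}`, with vertices `2, …, 13` and `38` tetrahedra. -/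
def ballB_12_38 : PreAbstractSimplicialComplex ℕ :=
  PreAbstractSimplicialComplex.ofFacets
   [{2, 3, 4, 7}, {2, 3, 4, 10}, {2, 3, 7, 10}, {2, 4, 5, 7}, {2, 4, 5, 10},
    {2, 5, 7, 13}, {2, 5, 8, 10}, {2, 5, 8, 13}, {2, 6, 9, 11}, {2, 6, 11, 13},
    {2, 6, 12, 13}, {2, 7, 8, 10}, {2, 7, 8, 11}, {2, 7, 11, 13}, {2, 8, 9, 11},
    {2, 8, 9, 12}, {2, 8, 12, 13}, {3, 4, 6, 7}, {3, 4, 6, 10}, {3, 5, 8, 13},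
    {3, 5, 9, 11}, {3, 5, 9, 13}, {3, 6, 7, 12}, {3, 6, 10, 13}, {3, 6, 12, 13},
    {3, 7, 10, 12}, {3, 8, 9, 11}, {3, 8, 9, 12}, {3, 8, 12, 13}, {3, 9, 10, 12},
    {3, 9, 10, 13}, {4, 5, 6, 7}, {4, 5, 6, 10}, {5, 6, 7, 9}, {5, 6, 9, 11},
    {5, 6, 10, 11}, {5, 7, 9, 13}, {6, 10, 11, 13}]

/-- The triangulated `3`-sphere `S_{13,56} = ∂(v * B_{12,38})`, where the new vertex `v` is
labelled `1`: the boundary of `B_{12,38}` is coned off. -/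
def sphereS_13_56 : PreAbstractSimplicialComplex ℕ :=
  (ballB_12_38.cone 1).boundary 4

set_option linter.unusedSectionVars false

/-! The positive assertions rest on certificates, the negative ones on two kinds of obstruction:
Euler characteristics and a branched covering.

A barycentric subdivision is the clique complex of the comparability relation on the faces
(`sd_eq_cliq`). Vertex links and deletions in a clique complex are clique complexes on sublists of
vertices (`link_cliq`, `deletion_cliq`). With faces coded by binary numbers, decompositions become
computations with lists of numbers that the kernel evaluates. For vertex decompositions only the
purity of deletions needs an argument: every maximal chain through the removed face must allow that
face to be exchanged (`IsPure.of_shedCheck`). For the LC property, a face with collapsible link can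
be collapsed away with its open star (`collapsesOnto_removeStar`), and nonevasive complexes are
collapsible. After a boundary triangle of the subdivision has been opened, vertices and edges with
nonevasive links are removed until the boundary without that triangle is left.

For nonshellability, alternating sums over the faces containing a given face have a prescribed sign
in a shellable complex (`IsShellable.eulerAt_nonneg`). Removing any facet from the ball with 18
facets violates this sign at the empty face or at a vertex, so no facet can be the last one of a
shelling. For evasiveness, a vertex can be used only if its link has vanishing reduced Euler
characteristic. A family of vertex sets is closed under all deletions that pass this test, and none
of its members spans a simplex (`not_faces_eq_inducedFaces`).

Nonconstructibility and the failure of LC come from a knotted triangle 1, 2, 3 in the sphere, of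
which only the edge 2, 3 lies in the ball. Its knottedness is witnessed by a three-sheeted covering
branched along it, written as affine transports modulo 3 between neighbouring tetrahedra, whose
holonomy along some closed walk is a translation without fixed point. Hence there is no global
parallel section, even over the ball.

In a constructible complex such a section would exist (`BranchedCover.exists_isGood`). Sections over
two parts are glued along their strongly connected intersection. If one part avoids the branching
edges, its section can be adjusted at will. If both parts contain branching edges, these edges share
a vertex, near which both sections take the same fixed values.

In an LC ball such a section would exist as well (`BranchedCover.not_isLCBall`). Along the collapse,
an assignment is kept that is parallel across the triangles already removed. It can be prescribed at
one tetrahedron until the single branching edge is removed, and that freedom is spent exactly then.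
-/

namespace PreAbstractSimplicialComplex

/-! ### Elementary facts on faces, links and purity. -/

section Basics

variable {α : Type*}

theorem mem_of_subset {K : PreAbstractSimplicialComplex α} {s t : Finset α} (hs : s ∈ K.faces)
    (hts : t ⊆ s) (ht : t.Nonempty) : t ∈ K.faces :=
  (K.isRelLowerSet_faces hs).2 hts ht

theorem nonempty_of_mem {K : PreAbstractSimplicialComplex α} {s : Finset α} (hs : s ∈ K.faces) :
    s.Nonempty :=
  (K.isRelLowerSet_faces hs).1

variable [DecidableEq α]

theorem IsNonevasive.faces_nonempty {K : PreAbstractSimplicialComplex α} (h : K.IsNonevasive) :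
    K.faces.Nonempty := by
  cases h with
  | simplex hK =>
    obtain ⟨F, hF, h⟩ := hK
    exact ⟨F, by rw [h]; exact ⟨hF, subset_rfl⟩⟩
  | step hdim hv hdel hlink => exact ⟨_, hv⟩

/-- A nonevasive link has a face, which together with `v` has at least two vertices, so the
dimension condition is automatic. -/
theorem IsNonevasive.of_link {K : PreAbstractSimplicialComplex α} {v : α}
    (hdel : (K.deletion v).IsNonevasive) (hlink : (K.link v).IsNonevasive) : K.IsNonevasive := by
  obtain ⟨s, hs, hvs, hins⟩ := hlink.faces_nonempty
  refine .step ⟨_, hins, ?_⟩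
    (mem_of_subset hins (by simp) (Finset.singleton_nonempty v)) hdel hlink
  rw [Finset.card_insert_of_notMem hvs]
  have := hs.card_pos
  omega

theorem IsPure.link {K : PreAbstractSimplicialComplex α} {d : ℕ} (hK : K.IsPure (d + 1)) {v : α}
    (hv : {v} ∈ K.faces) : (K.link v).IsPure d := by
  -- Admitting `s = ∅` also yields that the link is nonempty.
  have key : ∀ s, v ∉ s → insert v s ∈ K.faces → ∃ F ∈ (K.link v).faces,
      s ⊆ F ∧ F.card = d + 1 := by
    intro s hvs hs
    obtain ⟨F, hF, hsF, hc⟩ := hK.2 _ hs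
    have hvF : v ∈ F := hsF (Finset.mem_insert_self v s)
    have hc' : (F.erase v).card = d + 1 := by rw [Finset.card_erase_of_mem hvF]; omega
    refine ⟨F.erase v, ⟨Finset.card_pos.1 (by omega), Finset.notMem_erase v F, ?_⟩, ?_, hc'⟩
    · rwa [Finset.insert_erase hvF]
    · exact fun x hx => Finset.mem_erase.2
        ⟨fun h => hvs (h ▸ hx), hsF (Finset.mem_insert_of_mem hx)⟩
  obtain ⟨F, hF, -, -⟩ := key ∅ (by simp) (by simpa using hv)
  exact ⟨⟨F, hF⟩, fun s hs => key s hs.2.1 hs.2.2⟩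

end Basics

/-! ### Clique complexes on coded vertices. -/

section CliqueComplex

variable {α : Type*}

/-- The clique complex of the relation `r` on the vertices whose code belongs to `l`. -/
def cliq (e : α ≃ ℕ) (r : ℕ → ℕ → Bool) (l : List ℕ) : PreAbstractSimplicialComplex α where
  faces := {c | c.Nonempty ∧ (∀ s ∈ c, e s ∈ l) ∧ ∀ s ∈ c, ∀ t ∈ c, s ≠ t → r (e s) (e t) = true}
  isRelLowerSet_faces := by
    rintro c ⟨hc, hl, hr⟩
    exact ⟨hc, fun b hbc hb => ⟨hb, fun s hs => hl s (hbc hs),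
      fun s hs t ht => hr s (hbc hs) t (hbc ht)⟩⟩

variable {e : α ≃ ℕ} {r : ℕ → ℕ → Bool} {l l' : List ℕ} {p : ℕ}

theorem singleton_mem_cliq (hp : p ∈ l) : {e.symm p} ∈ (cliq e r l).faces := by
  refine ⟨Finset.singleton_nonempty _, by simpa using hp, ?_⟩
  intro s hs t ht hst
  rw [Finset.mem_singleton] at hs ht
  exact absurd (hs.trans ht.symm) hst

theorem deletion_cliq (hl : ∀ q, q ∈ l' ↔ q ∈ l ∧ q ≠ p) :
    (cliq e r l).deletion (e.symm p) = cliq e r l' := by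
  apply PreAbstractSimplicialComplex.ext
  ext c
  simp only [cliq, deletion, Set.mem_ofPred_eq, hl]
  constructor
  · rintro ⟨⟨h1, h2, h3⟩, h4⟩
    refine ⟨h1, fun s hs => ⟨h2 s hs, fun h => h4 ?_⟩, h3⟩
    rwa [← h, e.symm_apply_apply]
  · rintro ⟨h1, h2, h3⟩
    exact ⟨⟨h1, fun s hs => (h2 s hs).1, h3⟩, fun h => (h2 _ h).2 (e.apply_symm_apply p)⟩

theorem insert_mem_cliq [DecidableEq α] (hsymm : ∀ a b, r a b = r b a) {v : α} {c : Finset α}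
    (hc : c.Nonempty) (hvc : v ∉ c) :
    insert v c ∈ (cliq e r l).faces ↔
      e v ∈ l ∧ c ∈ (cliq e r l).faces ∧ ∀ s ∈ c, r (e v) (e s) = true := by
  constructor
  · rintro ⟨-, h2, h3⟩
    refine ⟨h2 v (Finset.mem_insert_self v c), ⟨hc, fun s hs => h2 s (Finset.mem_insert_of_mem hs),
      fun s hs t ht => h3 s (Finset.mem_insert_of_mem hs) t (Finset.mem_insert_of_mem ht)⟩,
      fun s hs => h3 v (Finset.mem_insert_self v c) s (Finset.mem_insert_of_mem hs) ?_⟩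
    rintro rfl
    exact hvc hs
  · rintro ⟨h1, ⟨-, h2, h3⟩, h4⟩
    refine ⟨Finset.insert_nonempty v c, ?_, ?_⟩
    · intro s hs
      rcases Finset.mem_insert.1 hs with rfl | hs
      exacts [h1, h2 s hs]
    · intro s hs t ht hst
      rcases Finset.mem_insert.1 hs with hs' | hs' <;>
        rcases Finset.mem_insert.1 ht with ht' | ht'
      · exact absurd (hs'.trans ht'.symm) hst
      · rw [hs']; exact h4 t ht'
      · rw [ht', hsymm]; exact h4 s hs'
      · exact h3 s hs' t ht' hst

/-- Cliques are tested pairwise, so the link of a vertex is spanned by its neighbours. Irreflexivity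
keeps the vertex itself out. -/
theorem link_cliq [DecidableEq α] (hsymm : ∀ a b, r a b = r b a) (hirr : ∀ a, r a a = false)
    (hp : p ∈ l) (hl : ∀ q, q ∈ l' ↔ q ∈ l ∧ r p q = true) :
    (cliq e r l).link (e.symm p) = cliq e r l' := by
  apply PreAbstractSimplicialComplex.ext
  ext c
  constructor
  · rintro ⟨hc, hvc, hi⟩
    obtain ⟨-, ⟨-, h2, h3⟩, h4⟩ := (insert_mem_cliq hsymm hc hvc).1 hi
    exact ⟨hc, fun s hs => (hl _).2 ⟨h2 s hs, by simpa using h4 s hs⟩, h3⟩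
  · rintro ⟨hc, h2, h3⟩
    have hvc : e.symm p ∉ c := fun h => by
      have := ((hl _).1 (h2 _ h)).2
      rw [e.apply_symm_apply, hirr] at this
      exact absurd this (by simp)
    refine ⟨hc, hvc, (insert_mem_cliq hsymm hc hvc).2 ⟨by simpa using hp,
      ⟨hc, fun s hs => ((hl _).1 (h2 s hs)).1, h3⟩, fun s hs => ?_⟩⟩
    simpa using ((hl _).1 (h2 s hs)).2

end CliqueComplex

/-! Continuation-passing list operations, which force the kernel to evaluate intermediate lists. -/

/-- `filterK p l k` is `k (l.filter p)`. -/
def filterK (p : ℕ → Bool) : List ℕ → (List ℕ → Bool) → Bool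
  | [], k => k []
  | a :: t, k => bif p a then filterK p t (fun s => k (a :: s)) else filterK p t k

theorem filterK_eq (p : ℕ → Bool) (l : List ℕ) (k : List ℕ → Bool) :
    filterK p l k = k (l.filter p) := by
  induction l generalizing k with
  | nil => rfl
  | cons a t ih =>
    rw [filterK, ih, ih]
    cases h : p a <;> simp [h]

/-- `findK p l k` applies `k` to the first member of `l` that satisfies `p`. -/
def findK (p : ℕ → Bool) : List ℕ → (ℕ → Bool) → Bool
  | [], _ => false
  | a :: t, k => bif p a then k a else findK p t k

theorem exists_of_findK {p : ℕ → Bool} {l : List ℕ} {k : ℕ → Bool} (h : findK p l k = true) :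
    ∃ a ∈ l, p a = true ∧ k a = true := by
  induction l with
  | nil => simp [findK] at h
  | cons a t ih =>
    rw [findK] at h
    cases hp : p a
    · rw [hp, cond_false] at h
      obtain ⟨b, hb, h⟩ := ih h
      exact ⟨b, List.mem_cons_of_mem _ hb, h⟩
    · rw [hp, cond_true] at h
      exact ⟨a, List.mem_cons_self, hp, h⟩

/-- `nthK l i k` applies `k` to the member of `l` at position `i`. -/
def nthK : List ℕ → ℕ → (ℕ → Bool) → Bool
  | [], _, _ => false
  | a :: _, 0, k => k a
  | _ :: t, i + 1, k => nthK t i k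

theorem exists_of_nthK {l : List ℕ} {i : ℕ} {k : ℕ → Bool} (h : nthK l i k = true) :
    ∃ a ∈ l, k a = true := by
  induction l generalizing i with
  | nil => simp [nthK] at h
  | cons a t ih =>
    cases i with
    | zero => exact ⟨a, List.mem_cons_self, h⟩
    | succ i =>
      obtain ⟨b, hb, h⟩ := ih h
      exact ⟨b, List.mem_cons_of_mem _ hb, h⟩

/-! ### Nonevasive clique complexes. -/

section Nonevasive

variable {α : Type*} [DecidableEq α] {e : α ≃ ℕ} {r : ℕ → ℕ → Bool} {l l' : List ℕ} {p : ℕ}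

/-- Some member of the list is related to all other members. -/
def coneCheck (r : ℕ → ℕ → Bool) (l : List ℕ) : Bool :=
  l.any fun p => l.all fun q => Nat.beq q p || r p q

/-- A greedy test for nonevasiveness of a clique complex. -/
def nonevasiveCheck (r : ℕ → ℕ → Bool) : ℕ → List ℕ → Bool
  | 0, _ => false
  | n + 1, l => coneCheck r l ||
      findK (fun p => filterK (r p) l (nonevasiveCheck r n)) l
        fun p => filterK (fun q => !Nat.beq q p) l (nonevasiveCheck r n)

/-- Any vertex other than the apex `p` can be removed first: its link and its deletion are again
cones with apex `p`, on shorter lists. The recursion stops when only the apex is left. -/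
theorem isNonevasive_of_cone (hsymm : ∀ a b, r a b = r b a) (hirr : ∀ a, r a a = false)
    (n : ℕ) : ∀ l : List ℕ, l.length ≤ n → ∀ p ∈ l, (∀ q ∈ l, q = p ∨ r p q = true) →
      (cliq e r l).IsNonevasive := by
  induction n with
  | zero =>
    intro l hl p hp
    rw [List.length_eq_zero_iff.1 (Nat.le_zero.1 hl)] at hp
    simp at hp
  | succ n ih =>
    intro l hl p hp hc
    by_cases h : ∃ q ∈ l, q ≠ p
    · obtain ⟨q, hq, hqp⟩ := h
      have hpq : r p q = true := (hc q hq).resolve_left hqp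
      have hlen : ∀ f : ℕ → Bool, f q = false → (l.filter f).length ≤ n := by
        intro f hf
        have : (l.filter f).length < l.length := by
          refine lt_of_le_of_ne (List.length_filter_le f l) fun h => ?_
          rw [List.length_filter_eq_length_iff] at h
          simpa [hf] using h q hq
        omega
      refine IsNonevasive.of_link (v := e.symm q) ?_ ?_
      · rw [deletion_cliq (l' := l.filter fun x => x != q) (by simp)]
        refine ih _ (hlen _ (by simp)) p (by simp [hp, Ne.symm hqp]) fun x hx => ?_
        exact hc x (List.mem_filter.1 hx).1
      · rw [link_cliq hsymm hirr hq (l' := l.filter (r q)) (by simp)]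
        refine ih _ (hlen _ (hirr q)) p (by simp [hp, hsymm q p, hpq]) fun x hx => ?_
        exact hc x (List.mem_filter.1 hx).1
    · push Not at h
      refine .simplex ⟨{e.symm p}, Finset.singleton_nonempty _, ?_⟩
      ext c
      constructor
      · rintro ⟨h1, h2, -⟩
        refine ⟨h1, fun s hs => ?_⟩
        rw [Finset.mem_singleton, ← h _ (h2 s hs), e.symm_apply_apply]
      · rintro ⟨h1, h2⟩
        exact mem_of_subset (singleton_mem_cliq hp) h2 h1

/-- The greedy choice of a vertex matters only for the success of the search; every positive answer
is a proof. The number `n` bounds the depth of recursion. -/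
theorem isNonevasive_of_check (hsymm : ∀ a b, r a b = r b a) (hirr : ∀ a, r a a = false) (n : ℕ) :
    ∀ l : List ℕ, nonevasiveCheck r n l = true → (cliq e r l).IsNonevasive := by
  induction n with
  | zero => intro l h; simp [nonevasiveCheck] at h
  | succ n ih =>
    intro l h
    rw [nonevasiveCheck, Bool.or_eq_true] at h
    rcases h with h | h
    · simp only [coneCheck, List.any_eq_true, List.all_eq_true, Bool.or_eq_true, Nat.beq_eq] at h
      obtain ⟨p, hp, h⟩ := h
      exact isNonevasive_of_cone hsymm hirr _ l le_rfl p hp h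
    · obtain ⟨p, hp, h1, h2⟩ := exists_of_findK h
      rw [filterK_eq] at h1 h2
      refine IsNonevasive.of_link (v := e.symm p) ?_ ?_
      · rw [deletion_cliq (l' := l.filter fun x => !Nat.beq x p)]
        · exact ih _ h2
        · simp [← Bool.not_eq_true, Nat.beq_eq]
      · rw [link_cliq hsymm hirr hp (l' := l.filter (r p)) (by simp)]
        exact ih _ h1

/-- Tests whether successive removal of the members of the list shows nonevasiveness. -/
def nonevasiveOrderCheck (r : ℕ → ℕ → Bool) (n : ℕ) : List ℕ → Bool
  | [] => false
  | p :: l => coneCheck r (p :: l) || (l.all (fun q => !Nat.beq q p) &&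
      filterK (r p) l (nonevasiveCheck r n) && nonevasiveOrderCheck r n l)

theorem isNonevasive_of_orderCheck (hsymm : ∀ a b, r a b = r b a) (hirr : ∀ a, r a a = false)
    (n : ℕ) : ∀ l : List ℕ, nonevasiveOrderCheck r n l = true → (cliq e r l).IsNonevasive := by
  intro l
  induction l with
  | nil => intro h; simp [nonevasiveOrderCheck] at h
  | cons p l ih =>
    intro h
    rw [nonevasiveOrderCheck, Bool.or_eq_true] at h
    rcases h with h | h
    · simp only [coneCheck, List.any_eq_true, List.all_eq_true, Bool.or_eq_true, Nat.beq_eq] at h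
      obtain ⟨q, hq, h⟩ := h
      exact isNonevasive_of_cone hsymm hirr _ _ le_rfl q hq h
    · simp only [Bool.and_eq_true, List.all_eq_true, Bool.not_eq_true', ← Bool.not_eq_true,
        Nat.beq_eq, filterK_eq] at h
      obtain ⟨⟨h1, h2⟩, h3⟩ := h
      refine IsNonevasive.of_link (v := e.symm p) ?_ ?_
      · rw [deletion_cliq (l' := l)]
        · exact ih h3
        · intro q
          have := h1 q
          grind
      · rw [link_cliq hsymm hirr List.mem_cons_self (l' := l.filter (r p))]
        · exact isNonevasive_of_check hsymm hirr n _ h2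
        · intro q
          have := hirr p
          grind

end Nonevasive

/-! ### Binary codes of finite sets and subdivisions as clique complexes. -/

section Code

/-- A finite set of natural numbers coded by a natural number through its binary digits. -/
def code : Finset ℕ ≃ ℕ := Finset.equivBitIndices.symm

theorem code_apply (s : Finset ℕ) : code s = ∑ i ∈ s, 2 ^ i := rfl

/-- Inclusion of the coded sets. -/
def subB (a b : ℕ) : Bool := Nat.beq (Nat.land a b) a

/-- Comparability of different coded sets. -/
def cmpB (a b : ℕ) : Bool := !Nat.beq a b && (subB a b || subB b a)

theorem mem_iff_testBit_code {s : Finset ℕ} {i : ℕ} : i ∈ s ↔ (code s).testBit i = true := by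
  conv_lhs => rw [← Finset.equivBitIndices.apply_symm_apply s]
  change _ ∈ Finset.equivBitIndices (code s) ↔ _
  rw [Finset.equivBitIndices_apply, List.mem_toFinset, Nat.mem_bitIndices]

theorem subB_code {s t : Finset ℕ} : subB (code s) (code t) = true ↔ s ⊆ t := by
  rw [subB, Nat.beq_eq]
  change code s &&& code t = code s ↔ _
  constructor
  · intro h i hi
    rw [mem_iff_testBit_code] at hi ⊢
    rw [← h, Nat.testBit_land, Bool.and_eq_true] at hi
    exact hi.2
  · intro h
    apply Nat.eq_of_testBit_eq
    intro i
    rw [Nat.testBit_land]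
    have := @h i
    rw [mem_iff_testBit_code, mem_iff_testBit_code] at this
    cases hs : (code s).testBit i
    · simp
    · simp [this hs]

theorem subB_eq_true {a b : ℕ} : subB a b = true ↔ code.symm a ⊆ code.symm b := by
  rw [← subB_code, code.apply_symm_apply, code.apply_symm_apply]

theorem cmpB_code {s t : Finset ℕ} : cmpB (code s) (code t) = true ↔ s ≠ t ∧ (s ⊆ t ∨ t ⊆ s) := by
  simp only [cmpB, Bool.and_eq_true, Bool.or_eq_true, subB_code, Bool.not_eq_true',
    ← Bool.not_eq_true, Nat.beq_eq, code.injective.eq_iff, ne_eq]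

theorem cmpB_comm (a b : ℕ) : cmpB a b = cmpB b a := by
  rw [Bool.eq_iff_iff, ← code.apply_symm_apply a, ← code.apply_symm_apply b, cmpB_code, cmpB_code]
  tauto

theorem cmpB_self (a : ℕ) : cmpB a a = false := by
  rw [← Bool.not_eq_true, ← code.apply_symm_apply a, cmpB_code]
  simp

/-- Being a chain is a condition on pairs, so the order complex of the face poset is determined by
its comparability graph. -/
theorem sd_eq_cliq {K : PreAbstractSimplicialComplex ℕ} {l : List ℕ}
    (h : ∀ s, s ∈ K.faces ↔ code s ∈ l) : K.sd = cliq code cmpB l := by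
  apply PreAbstractSimplicialComplex.ext
  ext c
  simp only [sd, cliq, Set.mem_ofPred_eq, h, cmpB_code]
  refine and_congr_right fun _ => and_congr_right fun _ => ?_
  constructor
  · exact fun hc s hs t ht hst => ⟨hst, hc hs ht hst⟩
  · exact fun hc s hs t ht hst => (hc s hs t ht hst).2

theorem mem_cliq_cmpB {l : List ℕ} {c : Finset (Finset ℕ)} :
    c ∈ (cliq code cmpB l).faces ↔
      c.Nonempty ∧ (∀ s ∈ c, code s ∈ l) ∧ ∀ s ∈ c, ∀ t ∈ c, s ⊆ t ∨ t ⊆ s := by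
  refine and_congr_right fun _ => and_congr_right fun _ => ?_
  constructor
  · intro h s hs t ht
    by_cases hst : s = t
    · exact Or.inl hst.subset
    · exact (cmpB_code.1 (h s hs t ht hst)).2
  · exact fun h s hs t ht hst => cmpB_code.2 ⟨hst, h s hs t ht⟩

end Code

/-! ### Vertex decompositions of order complexes. -/

section VertexDecomposable

theorem beq_false_iff {a b : ℕ} : Nat.beq a b = false ↔ a ≠ b := by
  rw [← Bool.not_eq_true, Nat.beq_eq]

/-- Tests that in every maximal chain through `p` the set `p` can be exchanged for a member
of `l`. -/
def shedCheck (p : ℕ) (l : List ℕ) : Bool :=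
  filterK (fun q => subB q p) l fun lo => filterK (fun q => subB p q) l fun hi =>
    (0 :: lo).all fun g => filterK (fun w => !Nat.beq w g && subB g w) l fun ws =>
      !ws.isEmpty && hi.all fun h => ws.any fun w => !Nat.beq w h && subB w h

/-- Here `lo` and `hi` are meant as the neighbours of the coded set `p` in a chain, with `none`
where `p` is an end of the chain. The set `w` can then take the place of `p`. -/
theorem exists_of_shedCheck {p : ℕ} {l : List ℕ} (h : shedCheck p l = true)
    (lo hi : Option (Finset ℕ)) (hlo : ∀ a ∈ lo, code a ∈ l ∧ a ⊆ code.symm p)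
    (hhi : ∀ b ∈ hi, code b ∈ l ∧ code.symm p ⊆ b) :
    ∃ w, code w ∈ l ∧ (∀ a ∈ lo, a ⊂ w) ∧ ∀ b ∈ hi, w ⊂ b := by
  simp only [shedCheck, filterK_eq, List.all_eq_true, List.any_eq_true, Bool.and_eq_true,
    List.mem_filter, Bool.not_eq_true', List.isEmpty_eq_false_iff_exists_mem, beq_false_iff,
    List.mem_cons] at h
  -- The code `0` of the empty set replaces a missing lower neighbour, since every member of the
  -- complex should contain it properly.
  have key : ∀ g : ℕ, (∀ a ∈ lo, g = code a) → (g = 0 ∨ g ∈ l ∧ subB g p = true) →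
      ∃ w, code w ∈ l ∧ (∀ a ∈ lo, a ⊂ w) ∧ ∀ b ∈ hi, w ⊂ b := by
    intro g hg hg'
    obtain ⟨⟨w, hw, hw1⟩, hw2⟩ := h g hg'
    have aux : ∀ w : ℕ, ¬ w = g → subB g w = true → ∀ a ∈ lo, a ⊂ code.symm w := by
      intro w h1 h2 a ha
      rw [hg a ha] at h1 h2
      rw [subB_eq_true, code.symm_apply_apply] at h2
      exact h2.ssubset_of_ne fun h => h1 (by rw [h, code.apply_symm_apply])
    rcases hi with _ | b
    · refine ⟨code.symm w, by simpa using hw, aux w (by simpa using hw1.1) hw1.2, by simp⟩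
    · obtain ⟨hb1, hb2⟩ := hhi b rfl
      obtain ⟨w, ⟨hw, hw1⟩, hw3⟩ := hw2 (code b) ⟨hb1, by
        rw [subB_eq_true, code.symm_apply_apply]; exact hb2⟩
      refine ⟨code.symm w, by simpa using hw, aux w (by simpa using hw1.1) hw1.2, ?_⟩
      intro b' hb'
      cases hb'
      have h2 := hw3.2
      rw [subB_eq_true, code.symm_apply_apply] at h2
      exact h2.ssubset_of_ne fun h => hw3.1 (by rw [← h, code.apply_symm_apply])
  rcases lo with _ | a
  · exact key 0 (by simp) (Or.inl rfl)
  · refine key (code a) (by simp) (Or.inr ⟨(hlo a rfl).1, ?_⟩)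
    rw [subB_eq_true, code.symm_apply_apply]
    exact (hlo a rfl).2

/-- A maximal chain through `p` is repaired after the loss of `p` by a set strictly between the two
neighbours of `p` in the chain. The repaired chain has the same length, so the deletion stays pure
of the same dimension. -/
theorem IsPure.of_shedCheck {d p : ℕ} {l l' : List ℕ} (hK : (cliq code cmpB l).IsPure d)
    (hl : ∀ q, q ∈ l' ↔ q ∈ l ∧ q ≠ p) (h : shedCheck p l' = true) :
    (cliq code cmpB l').IsPure d := by
  have key : ∀ F ∈ (cliq code cmpB l).faces, ∃ F' ∈ (cliq code cmpB l').faces,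
      F.erase (code.symm p) ⊆ F' ∧ F'.card = F.card := by
    intro F hF
    rw [mem_cliq_cmpB] at hF
    obtain ⟨hne, hFl, hch⟩ := hF
    have hmem : ∀ s ∈ F, s ≠ code.symm p → code s ∈ l' := fun s hs hsp =>
      (hl _).2 ⟨hFl s hs, fun h => hsp (by rw [← h, code.symm_apply_apply])⟩
    by_cases hp : code.symm p ∈ F
    swap
    · refine ⟨F, mem_cliq_cmpB.2 ⟨hne, fun s hs => hmem s hs fun h => hp (h ▸ hs), hch⟩,
        Finset.erase_subset _ _, rfl⟩
    -- The largest member of the chain below `p`: a set that properly contains it properly contains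
    -- all members below `p`.
    obtain ⟨lo, hlo1, hlo2⟩ : ∃ lo : Option (Finset ℕ),
        (∀ a ∈ lo, code a ∈ l' ∧ a ⊆ code.symm p) ∧
        ∀ s ∈ F, s ⊂ code.symm p → ∃ a ∈ lo, s ⊆ a := by
      rcases (F.filter (· ⊂ code.symm p)).eq_empty_or_nonempty with h0 | h0
      · refine ⟨none, by simp, fun s hs hsp => ?_⟩
        exact absurd (Finset.mem_filter.2 ⟨hs, hsp⟩) (h0 ▸ Finset.notMem_empty s)
      · obtain ⟨a, ha, hmax⟩ := Finset.exists_max_image _ Finset.card h0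
        rw [Finset.mem_filter] at ha
        refine ⟨some a, ?_, fun s hs hsp => ⟨a, rfl, ?_⟩⟩
        · intro a' ha'
          cases ha'
          exact ⟨hmem a ha.1 ha.2.ne, ha.2.subset⟩
        · rcases hch s hs a ha.1 with h | h
          · exact h
          · exact (Finset.eq_of_subset_of_card_le h
              (hmax s (Finset.mem_filter.2 ⟨hs, hsp⟩))).symm.subset
    obtain ⟨hi, hhi1, hhi2⟩ : ∃ hi : Option (Finset ℕ),
        (∀ a ∈ hi, code a ∈ l' ∧ code.symm p ⊆ a) ∧
        ∀ s ∈ F, code.symm p ⊂ s → ∃ a ∈ hi, a ⊆ s := by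
      rcases (F.filter (code.symm p ⊂ ·)).eq_empty_or_nonempty with h0 | h0
      · refine ⟨none, by simp, fun s hs hsp => ?_⟩
        exact absurd (Finset.mem_filter.2 ⟨hs, hsp⟩) (h0 ▸ Finset.notMem_empty s)
      · obtain ⟨a, ha, hmin⟩ := Finset.exists_min_image _ Finset.card h0
        rw [Finset.mem_filter] at ha
        refine ⟨some a, ?_, fun s hs hsp => ⟨a, rfl, ?_⟩⟩
        · intro a' ha'
          cases ha'
          exact ⟨hmem a ha.1 ha.2.ne', ha.2.subset⟩
        · rcases hch a ha.1 s hs with h | h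
          · exact h
          · exact (Finset.eq_of_subset_of_card_le h
              (hmin s (Finset.mem_filter.2 ⟨hs, hsp⟩))).symm.subset
    obtain ⟨w, hw, hwlo, hwhi⟩ := exists_of_shedCheck h lo hi hlo1 hhi1
    have hcomp : ∀ s ∈ F, s ≠ code.symm p → s ⊂ w ∨ w ⊂ s := by
      intro s hs hsp
      rcases hch s hs _ hp with h | h
      · obtain ⟨a, ha, hsa⟩ := hlo2 s hs (h.ssubset_of_ne hsp)
        exact Or.inl (hsa.trans_ssubset (hwlo a ha))
      · obtain ⟨a, ha, hsa⟩ := hhi2 s hs (h.ssubset_of_ne hsp.symm)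
        exact Or.inr ((hwhi a ha).trans_subset hsa)
    have hwF : w ∉ F.erase (code.symm p) := by
      intro hw'
      rw [Finset.mem_erase] at hw'
      rcases hcomp w hw'.2 hw'.1 with h | h <;> exact h.ne rfl
    refine ⟨insert w (F.erase (code.symm p)), mem_cliq_cmpB.2
      ⟨Finset.insert_nonempty _ _, ?_, ?_⟩, Finset.subset_insert _ _, ?_⟩
    · intro s hs
      rcases Finset.mem_insert.1 hs with rfl | hs
      · exact hw
      · rw [Finset.mem_erase] at hs
        exact hmem s hs.2 hs.1
    · intro s hs t ht
      simp only [Finset.mem_insert, Finset.mem_erase] at hs ht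
      rcases hs with hs | hs <;> rcases ht with ht | ht
      · exact Or.inl (hs.trans ht.symm).subset
      · rw [hs]
        exact (hcomp t ht.2 ht.1).symm.imp (·.subset) (·.subset)
      · rw [ht]
        exact (hcomp s hs.2 hs.1).imp (·.subset) (·.subset)
      · exact hch s hs.2 t ht.2
    · rw [Finset.card_insert_of_notMem hwF, Finset.card_erase_of_mem hp]
      have := Finset.card_pos.2 hne
      omega
  refine ⟨?_, fun s hs => ?_⟩
  · obtain ⟨F, hF⟩ := hK.1
    obtain ⟨F', hF', -⟩ := key F hF
    exact ⟨F', hF'⟩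
  · obtain ⟨F, hF, hsF, hc⟩ := hK.2 s ⟨hs.1, fun t ht => ((hl _).1 (hs.2.1 t ht)).1, hs.2.2⟩
    obtain ⟨F', hF', hFF, hc'⟩ := key F hF
    refine ⟨F', hF', fun x hx => hFF (Finset.mem_erase.2 ⟨?_, hsF hx⟩), hc'.trans hc⟩
    rintro rfl
    exact ((hl _).1 (hs.2.1 _ hx)).2 (code.apply_symm_apply p)

/-- A facet has `d + 1` vertices and hence uses all vertices of the list, so the complex is a
simplex. -/
theorem isVertexDecomposable_of_length {d : ℕ} {l : List ℕ} (hK : (cliq code cmpB l).IsPure d)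
    (hl : l.length = d + 1) : (cliq code cmpB l).IsVertexDecomposable := by
  obtain ⟨s, hs⟩ := hK.1
  obtain ⟨F, hF, -, hc⟩ := hK.2 s hs
  have hmem : ∀ t, code t ∈ l → t ∈ F := by
    have h1 : F ⊆ l.toFinset.map code.symm.toEmbedding := fun t ht => by
      simpa using hF.2.1 t ht
    have h2 : (l.toFinset.map code.symm.toEmbedding).card ≤ F.card := by
      rw [Finset.card_map, hc, ← hl]
      exact List.toFinset_card_le l
    intro t ht
    rw [Finset.eq_of_subset_of_card_le h1 h2]
    simpa using ht
  refine .simplex ⟨F, hF.1, ?_⟩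
  ext c
  exact ⟨fun hc => ⟨hc.1, fun t ht => hmem t (hc.2.1 t ht)⟩,
    fun hc => mem_of_subset hF hc.2 hc.1⟩

theorem isVertexDecomposable_of_shedCheck {d p : ℕ} {l l' : List ℕ}
    (hK : (cliq code cmpB l).IsPure (d + 1)) (hp : p ∈ l)
    (hl : ∀ q, q ∈ l' ↔ q ∈ l ∧ q ≠ p) (h : shedCheck p l' = true)
    (hdel : (cliq code cmpB l').IsPure (d + 1) → (cliq code cmpB l').IsVertexDecomposable)
    (hlink : (cliq code cmpB (l'.filter (cmpB p))).IsPure d →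
      (cliq code cmpB (l'.filter (cmpB p))).IsVertexDecomposable) :
    (cliq code cmpB l).IsVertexDecomposable := by
  -- The link may be computed in the list without `p`, because `p` is not related to itself.
  have hmem : ∀ q, q ∈ l'.filter (cmpB p) ↔ q ∈ l ∧ cmpB p q = true := by
    intro q
    rw [List.mem_filter, hl]
    have := cmpB_self p
    grind
  have hlk := link_cliq (e := code) cmpB_comm cmpB_self hp hmem
  have hdl := deletion_cliq (e := code) (r := cmpB) hl
  have hv := singleton_mem_cliq (e := code) (r := cmpB) hp
  have hpure := hK.of_shedCheck hl h
  refine .shed hK hv (hdl ▸ hpure) (hdl ▸ hdel hpure) (hlk ▸ hlink ?_)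
  rw [← hlk]
  exact hK.link hv

/-- A greedy vertex decomposition of a graph; vertices of degree one are removed first. -/
def graphCheck : ℕ → List ℕ → Bool
  | 0, _ => false
  | n + 1, l => Nat.beq l.length 2 ||
      findK (fun p => filterK (cmpB p) l fun s => Nat.beq s.length 1) l
        (fun p => filterK (fun q => !Nat.beq q p) l
          fun l' => shedCheck p l' && graphCheck n l') ||
      nthK l 0 (fun p => filterK (fun q => !Nat.beq q p) l
          fun l' => shedCheck p l' && graphCheck n l')

/-- Vertex decomposition of a `2`-complex; the base-`64` digits of `c` are the positions in the
remaining list of the vertices that are removed. -/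
def surfaceCheck : ℕ → ℕ → List ℕ → Bool
  | 0, _, _ => false
  | n + 1, c, l => Nat.beq l.length 3 ||
      nthK l (Nat.mod c 64) fun p => filterK (fun q => !Nat.beq q p) l fun l' =>
        shedCheck p l' && filterK (cmpB p) l' (graphCheck n) && surfaceCheck n (Nat.div c 64) l'

/-- Vertex decomposition of a `3`-complex in the order of the list; the vertex decompositions
of the links are given by `cs`. -/
def solidCheck (n : ℕ) : List ℕ → List ℕ → Bool
  | _, [] => false
  | [], l => Nat.beq l.length 4
  | c :: cs, p :: l => l.all (fun q => !Nat.beq q p) && shedCheck p l &&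
      filterK (cmpB p) l (surfaceCheck n c) && solidCheck n cs l

theorem mem_filter_not_beq {l : List ℕ} {p q : ℕ} :
    q ∈ l.filter (fun q => !Nat.beq q p) ↔ q ∈ l ∧ q ≠ p := by
  rw [List.mem_filter, Bool.not_eq_true', beq_false_iff]

theorem isVertexDecomposable_of_graphCheck (n : ℕ) : ∀ l : List ℕ, graphCheck n l = true →
    (cliq code cmpB l).IsPure 1 → (cliq code cmpB l).IsVertexDecomposable := by
  induction n with
  | zero => intro l h; simp [graphCheck] at h
  | succ n ih =>
    intro l h hK
    have step : ∀ p ∈ l, (filterK (fun q => !Nat.beq q p) l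
        fun l' => shedCheck p l' && graphCheck n l') = true →
        (cliq code cmpB l).IsVertexDecomposable := by
      intro p hp h
      rw [filterK_eq, Bool.and_eq_true] at h
      -- Links in a pure 1-complex are pure of dimension 0 and need no test.
      exact isVertexDecomposable_of_shedCheck hK hp (fun q => mem_filter_not_beq) h.1
        (ih _ h.2) .points
    rw [graphCheck, Bool.or_eq_true, Bool.or_eq_true, Nat.beq_eq] at h
    rcases h with (h | h) | h
    · exact isVertexDecomposable_of_length hK h
    · obtain ⟨p, hp, -, h⟩ := exists_of_findK h
      exact step p hp h
    · obtain ⟨p, hp, h⟩ := exists_of_nthK h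
      exact step p hp h

theorem isVertexDecomposable_of_surfaceCheck (n : ℕ) : ∀ (c : ℕ) (l : List ℕ),
    surfaceCheck n c l = true → (cliq code cmpB l).IsPure 2 →
      (cliq code cmpB l).IsVertexDecomposable := by
  induction n with
  | zero => intro c l h; simp [surfaceCheck] at h
  | succ n ih =>
    intro c l h hK
    rw [surfaceCheck, Bool.or_eq_true, Nat.beq_eq] at h
    rcases h with h | h
    · exact isVertexDecomposable_of_length hK h
    · obtain ⟨p, hp, h⟩ := exists_of_nthK h
      rw [filterK_eq, Bool.and_eq_true, Bool.and_eq_true, filterK_eq] at h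
      exact isVertexDecomposable_of_shedCheck hK hp (fun q => mem_filter_not_beq) h.1.1
        (ih _ _ h.2) (isVertexDecomposable_of_graphCheck n _ h.1.2)

theorem isVertexDecomposable_of_solidCheck (n : ℕ) : ∀ cs l : List ℕ,
    solidCheck n cs l = true → (cliq code cmpB l).IsPure 3 →
      (cliq code cmpB l).IsVertexDecomposable := by
  intro cs
  induction cs with
  | nil =>
    intro l h hK
    cases l with
    | nil => simp [solidCheck] at h
    | cons p l =>
      rw [solidCheck, Nat.beq_eq] at h
      · exact isVertexDecomposable_of_length hK h
      · simp
  | cons c cs ih =>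
    intro l h hK
    cases l with
    | nil => simp [solidCheck] at h
    | cons p l =>
      rw [solidCheck, filterK_eq] at h
      simp only [Bool.and_eq_true, List.all_eq_true, Bool.not_eq_true', beq_false_iff] at h
      refine isVertexDecomposable_of_shedCheck hK List.mem_cons_self (l' := l) (fun q => ?_)
        h.1.1.2 (ih _ h.2) (isVertexDecomposable_of_surfaceCheck n _ _ h.1.2)
      have := h.1.1.1 q
      grind

end VertexDecomposable

/-! ### Collapses that remove the open star of a face. -/

section Collapse

variable {α : Type*}

theorem ElementaryCollapse.le {K L : PreAbstractSimplicialComplex α}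
    (h : ElementaryCollapse K L) : L ≤ K := by
  obtain ⟨σ, -, τ, -, -, -, h⟩ := h
  intro s hs
  change s ∈ L.faces at hs
  rw [h] at hs
  exact hs.1

theorem CollapsesOnto.le {K L : PreAbstractSimplicialComplex α}
    (h : CollapsesOnto K L) : L ≤ K := by
  induction h with
  | refl => exact le_rfl
  | tail _ h ih => exact h.le.trans ih

variable [DecidableEq α]

/-- The link of the face `σ`. -/
def faceLink (σ : Finset α) (K : PreAbstractSimplicialComplex α) :
    PreAbstractSimplicialComplex α where
  faces := {c | c.Nonempty ∧ Disjoint σ c ∧ σ ∪ c ∈ K.faces}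
  isRelLowerSet_faces := by
    rintro c ⟨hc, hd, hK⟩
    exact ⟨hc, fun b hbc hb => ⟨hb, hd.mono_right hbc,
      mem_of_subset hK (Finset.union_subset_union_right hbc)
        (hb.mono Finset.subset_union_right)⟩⟩

/-- The complex without the open star of the face `σ`. -/
def removeStar (σ : Finset α) (K : PreAbstractSimplicialComplex α) :
    PreAbstractSimplicialComplex α where
  faces := {c | c ∈ K.faces ∧ ¬ σ ⊆ c}
  isRelLowerSet_faces := by
    rintro c ⟨hc, hσ⟩
    exact ⟨nonempty_of_mem hc, fun b hbc hb => ⟨mem_of_subset hc hbc hb,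
      fun h => hσ (h.trans hbc)⟩⟩

/-- The complex in which the link of the face `σ` is reduced to `L`. -/
def reduceStar (σ : Finset α) (K L : PreAbstractSimplicialComplex α) :
    PreAbstractSimplicialComplex α where
  faces := {c | c ∈ K.faces ∧ (σ ⊆ c → c = σ ∨ c \ σ ∈ L.faces)}
  isRelLowerSet_faces := by
    rintro c ⟨hc, hσ⟩
    refine ⟨nonempty_of_mem hc, fun b hbc hb => ⟨mem_of_subset hc hbc hb, fun h => ?_⟩⟩
    rcases (b \ σ).eq_empty_or_nonempty with h0 | h0
    · exact Or.inl ((Finset.sdiff_eq_empty_iff_subset.1 h0).antisymm h)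
    · have hsub := Finset.sdiff_subset_sdiff hbc (le_refl σ)
      rcases hσ (h.trans hbc) with rfl | h1
      · rw [Finset.sdiff_self, Finset.subset_empty] at hsub
        exact absurd hsub h0.ne_empty
      · exact Or.inr (mem_of_subset h1 hsub h0)

theorem reduceStar_faceLink (σ : Finset α) (K : PreAbstractSimplicialComplex α) :
    reduceStar σ K (faceLink σ K) = K := by
  apply PreAbstractSimplicialComplex.ext
  ext c
  refine ⟨fun h => h.1, fun h => ⟨h, fun hσ => ?_⟩⟩
  rcases (c \ σ).eq_empty_or_nonempty with h0 | h0
  · exact Or.inl ((Finset.sdiff_eq_empty_iff_subset.1 h0).antisymm hσ)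
  · exact Or.inr ⟨h0, Finset.disjoint_sdiff, by rwa [Finset.union_sdiff_of_subset hσ]⟩

/-- Joining with `σ` identifies the faces of `L` with the remaining faces properly containing `σ`,
so a free pair `a ⊂ b` of `L` becomes the free pair `σ ∪ a ⊂ σ ∪ b`. -/
theorem ElementaryCollapse.reduceStar {σ : Finset α} {K L L' : PreAbstractSimplicialComplex α}
    (hL : L ≤ faceLink σ K) (h : ElementaryCollapse L L') :
    ElementaryCollapse (reduceStar σ K L) (reduceStar σ K L') := by
  obtain ⟨a, ha, b, hb, hab, huniq, hfaces⟩ := h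
  have hmem : ∀ c ∈ L.faces, σ ∪ c ∈ (PreAbstractSimplicialComplex.reduceStar σ K L).faces ∧
      (σ ∪ c) \ σ = c := by
    intro c hc
    have h1 : (σ ∪ c) \ σ = c := by
      rw [Finset.union_sdiff_left, Finset.sdiff_eq_self_of_disjoint (hL hc).2.1.symm]
    exact ⟨⟨(hL hc).2.2, fun _ => Or.inr (by rwa [h1])⟩, h1⟩
  have hne : ∀ c ∈ L.faces, σ ∪ c ≠ σ := by
    intro c hc h
    have := (hmem c hc).2
    rw [h, Finset.sdiff_self] at this
    exact (nonempty_of_mem hc).ne_empty this.symm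
  refine ⟨σ ∪ a, (hmem a ha).1, σ ∪ b, (hmem b hb).1, ?_, ?_, ?_⟩
  · refine (Finset.union_subset_union_right hab.subset).ssubset_of_ne fun h => hab.ne ?_
    rw [← (hmem a ha).2, h, (hmem b hb).2]
  · rintro ρ ⟨hρ, hρ'⟩ hσρ
    have hσ : σ ⊆ ρ := Finset.subset_union_left.trans hσρ.subset
    have haρ : a ⊆ ρ \ σ := by
      rw [← (hmem a ha).2]
      exact Finset.sdiff_subset_sdiff hσρ.subset (le_refl σ)
    have hρL : ρ \ σ ∈ L.faces := by
      rcases hρ' hσ with rfl | h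
      · rw [Finset.sdiff_self, Finset.subset_empty] at haρ
        exact absurd haρ (nonempty_of_mem ha).ne_empty
      · exact h
    have := huniq _ hρL (haρ.ssubset_of_ne fun h => hσρ.ne (by
      rw [h, Finset.union_sdiff_of_subset hσ]))
    rw [← this, Finset.union_sdiff_of_subset hσ]
  · ext c
    simp only [PreAbstractSimplicialComplex.reduceStar, Set.mem_ofPred_eq, hfaces, Set.mem_sdiff,
      Set.mem_insert_iff, Set.mem_singleton_iff]
    constructor
    · rintro ⟨h1, h2⟩
      refine ⟨⟨h1, fun h => (h2 h).imp_right And.left⟩, ?_⟩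
      rintro (rfl | rfl)
      · rcases h2 Finset.subset_union_left with h | h
        · exact hne a ha h
        · exact h.2 (Or.inl (hmem a ha).2)
      · rcases h2 Finset.subset_union_left with h | h
        · exact hne b hb h
        · exact h.2 (Or.inr (hmem b hb).2)
    · rintro ⟨⟨h1, h2⟩, h3⟩
      refine ⟨h1, fun h => (h2 h).imp_right fun h4 => ⟨h4, ?_⟩⟩
      rintro (h5 | h5)
      · exact h3 (Or.inl (by rw [← h5, Finset.union_sdiff_of_subset h]))
      · exact h3 (Or.inr (by rw [← h5, Finset.union_sdiff_of_subset h]))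

theorem CollapsesOnto.reduceStar {σ : Finset α} {K L L' : PreAbstractSimplicialComplex α}
    (hL : L ≤ faceLink σ K) (h : CollapsesOnto L L') :
    CollapsesOnto (reduceStar σ K L) (reduceStar σ K L') := by
  induction h with
  | refl => exact .refl
  | tail h1 h2 ih => exact ih.tail (h2.reduceStar ((CollapsesOnto.le h1).trans hL))

/-- The complex collapses onto a vertex. -/
def IsCollapsible (K : PreAbstractSimplicialComplex α) : Prop :=
  ∃ (L : PreAbstractSimplicialComplex α) (u : α), L.faces = {{u}} ∧ K.CollapsesOnto L

/-- A collapse of the link to a point `u` lifts to the star and leaves only `σ` and `σ ∪ {u}` there.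
These two form a free pair, whose removal finishes the job. -/
theorem collapsesOnto_removeStar {σ : Finset α} {K : PreAbstractSimplicialComplex α}
    (hσ : σ.Nonempty) (h : (faceLink σ K).IsCollapsible) : K.CollapsesOnto (removeStar σ K) := by
  obtain ⟨L, u, hL, hcol⟩ := h
  have hu : {u} ∈ (faceLink σ K).faces := hcol.le (show {u} ∈ L.faces by rw [hL]; rfl)
  have huσ : u ∉ σ := fun h => Finset.disjoint_left.1 hu.2.1 h (Finset.mem_singleton_self u)
  have h1 := hcol.reduceStar le_rfl
  rw [reduceStar_faceLink] at h1
  refine h1.tail ⟨σ, ⟨mem_of_subset hu.2.2 Finset.subset_union_left hσ, fun _ => Or.inl rfl⟩,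
    σ ∪ {u}, ⟨hu.2.2, fun _ => Or.inr ?_⟩, ?_, ?_, ?_⟩
  · rw [Finset.union_sdiff_left, Finset.sdiff_eq_self_of_disjoint hu.2.1.symm, hL]
    rfl
  · refine Finset.subset_union_left.ssubset_of_ne fun h => huσ ?_
    rw [h]
    simp
  · rintro ρ ⟨-, hρ⟩ hσρ
    rcases hρ hσρ.subset with h | h
    · exact absurd h hσρ.ne'
    · rw [hL, Set.mem_singleton_iff] at h
      rw [← h, Finset.union_sdiff_of_subset hσρ.subset]
  · ext c
    simp only [removeStar, PreAbstractSimplicialComplex.reduceStar, Set.mem_ofPred_eq, hL,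
      Set.mem_sdiff, Set.mem_insert_iff, Set.mem_singleton_iff]
    constructor
    · rintro ⟨h1, h2⟩
      refine ⟨⟨h1, fun h => absurd h h2⟩, ?_⟩
      rintro (rfl | rfl)
      · exact h2 subset_rfl
      · exact h2 Finset.subset_union_left
    · rintro ⟨⟨h1, h2⟩, h3⟩
      refine ⟨h1, fun h => ?_⟩
      rcases h2 h with h4 | h4
      · exact h3 (Or.inl h4)
      · exact h3 (Or.inr (by rw [← h4, Finset.union_sdiff_of_subset h]))

theorem faceLink_singleton (v : α) (K : PreAbstractSimplicialComplex α) :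
    faceLink {v} K = K.link v := by
  apply PreAbstractSimplicialComplex.ext
  ext c
  simp only [faceLink, link, Set.mem_ofPred_eq, Finset.disjoint_singleton_left,
    Finset.insert_eq]

theorem removeStar_singleton (v : α) (K : PreAbstractSimplicialComplex α) :
    removeStar {v} K = K.deletion v := by
  apply PreAbstractSimplicialComplex.ext
  ext c
  simp only [removeStar, deletion, Set.mem_ofPred_eq, Finset.singleton_subset_iff]

theorem IsCollapsible.of_link {K : PreAbstractSimplicialComplex α} {v : α}
    (hlink : (K.link v).IsCollapsible) (hdel : (K.deletion v).IsCollapsible) :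
    K.IsCollapsible := by
  rw [← faceLink_singleton] at hlink
  have := collapsesOnto_removeStar (Finset.singleton_nonempty v) hlink
  rw [removeStar_singleton] at this
  obtain ⟨L, u, hL, h⟩ := hdel
  exact ⟨L, u, hL, this.trans h⟩

/-- In a simplex, the link and the deletion of a vertex are both the opposite face. -/
theorem isCollapsible_of_isSimplex (n : ℕ) : ∀ (K : PreAbstractSimplicialComplex α) (F : Finset α),
    F.card = n + 1 → K.faces = {s | s.Nonempty ∧ s ⊆ F} → K.IsCollapsible := by
  induction n with
  | zero =>
    intro K F hF hK
    obtain ⟨u, rfl⟩ := Finset.card_eq_one.1 hF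
    refine ⟨K, u, ?_, .refl⟩
    rw [hK]
    ext s
    simp only [Set.mem_ofPred_eq, Set.mem_singleton_iff, Finset.subset_singleton_iff]
    constructor
    · rintro ⟨h1, h2⟩
      exact h2.resolve_left h1.ne_empty
    · rintro rfl
      exact ⟨Finset.singleton_nonempty u, Or.inr rfl⟩
  | succ n ih =>
    intro K F hF hK
    obtain ⟨v, hv⟩ : F.Nonempty := Finset.card_pos.1 (by omega)
    have hF' : (F.erase v).card = n + 1 := by rw [Finset.card_erase_of_mem hv]; omega
    refine .of_link (v := v) (ih _ _ hF' ?_) (ih _ _ hF' ?_)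
    · ext s
      simp only [link, hK, Set.mem_ofPred_eq, Finset.insert_subset_iff, Finset.subset_erase]
      have := Finset.insert_nonempty v s
      tauto
    · ext s
      simp only [deletion, hK, Set.mem_ofPred_eq, Finset.subset_erase]
      tauto

/-- By induction the link of the chosen vertex is collapsible, so the complex collapses onto the
deletion, which is collapsible too. -/
theorem IsNonevasive.isCollapsible {K : PreAbstractSimplicialComplex α} (h : K.IsNonevasive) :
    K.IsCollapsible := by
  induction h with
  | simplex hK =>
    obtain ⟨F, hF, hK⟩ := hK
    exact isCollapsible_of_isSimplex (F.card - 1) _ F (by have := hF.card_pos; omega) hK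
  | step _ _ _ _ h1 h2 => exact .of_link h2 h1

end Collapse

/-! ### Removing vertices and edges from clique complexes that lack one face. -/

section Moves

variable {α : Type*} [DecidableEq α] {e : α ≃ ℕ} {r : ℕ → ℕ → Bool} {l b : List ℕ}
  {t : Finset α}

/-- The relation `r` without the pairs in `R`. -/
def dropPairs (r : ℕ → ℕ → Bool) (R : List (ℕ × ℕ)) (x y : ℕ) : Bool :=
  r x y && R.all fun z => !(Nat.beq x z.1 && Nat.beq y z.2) && !(Nat.beq x z.2 && Nat.beq y z.1)

theorem dropPairs_eq_true {R : List (ℕ × ℕ)} {x y : ℕ} : dropPairs r R x y = true ↔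
    r x y = true ∧ ∀ z ∈ R, ¬ (x = z.1 ∧ y = z.2) ∧ ¬ (x = z.2 ∧ y = z.1) := by
  simp only [dropPairs, Bool.and_eq_true, List.all_eq_true, Bool.not_eq_true', ← Bool.not_eq_true,
    Nat.beq_eq]

theorem dropPairs_comm (hsymm : ∀ a b, r a b = r b a) (R : List (ℕ × ℕ)) (x y : ℕ) :
    dropPairs r R x y = dropPairs r R y x := by
  rw [Bool.eq_iff_iff, dropPairs_eq_true, dropPairs_eq_true, hsymm]
  refine and_congr_right fun _ => forall₂_congr fun z _ => ?_
  tauto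

theorem dropPairs_self (hirr : ∀ a, r a a = false) (R : List (ℕ × ℕ)) (x : ℕ) :
    dropPairs r R x x = false := by
  rw [← Bool.not_eq_true, dropPairs_eq_true, hirr]
  simp

/-- Dropping a pair from the relation removes the open star of an edge. Pairs with equal entries
have no effect, as cliques are tested on different vertices only. -/
theorem mem_cliq_dropPairs {R : List (ℕ × ℕ)} {c : Finset α} :
    c ∈ (cliq e (dropPairs r R) l).faces ↔ c ∈ (cliq e r l).faces ∧
      ∀ z ∈ R, z.1 ≠ z.2 → ¬ (e.symm z.1 ∈ c ∧ e.symm z.2 ∈ c) := by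
  constructor
  · rintro ⟨h1, h2, h3⟩
    refine ⟨⟨h1, h2, fun s hs t ht hst => (dropPairs_eq_true.1 (h3 s hs t ht hst)).1⟩, ?_⟩
    rintro z hz hne ⟨hz1, hz2⟩
    have := (dropPairs_eq_true.1 (h3 _ hz1 _ hz2 fun h => hne (e.symm.injective h))).2 z hz
    simp at this
  · rintro ⟨⟨h1, h2, h3⟩, h4⟩
    refine ⟨h1, h2, fun s hs t ht hst => dropPairs_eq_true.2 ⟨h3 s hs t ht hst, fun z hz => ?_⟩⟩
    have h5 := h4 z hz
    constructor
    · rintro ⟨rfl', rfl''⟩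
      refine h5 ?_ ?_
      · rw [← rfl', ← rfl'']
        exact fun h => hst (e.injective h)
      · rw [← rfl', ← rfl'', e.symm_apply_apply, e.symm_apply_apply]
        exact ⟨hs, ht⟩
    · rintro ⟨rfl', rfl''⟩
      refine h5 ?_ ?_
      · rw [← rfl', ← rfl'']
        exact fun h => hst (e.injective h).symm
      · rw [← rfl', ← rfl'', e.symm_apply_apply, e.symm_apply_apply]
        exact ⟨ht, hs⟩

theorem mem_cliq_dropPairs_cons {z : ℕ × ℕ} {R : List (ℕ × ℕ)} {c : Finset α}
    (hz : z.1 ≠ z.2) : c ∈ (cliq e (dropPairs r (z :: R)) l).faces ↔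
      c ∈ (cliq e (dropPairs r R) l).faces ∧ ¬ (e.symm z.1 ∈ c ∧ e.symm z.2 ∈ c) := by
  rw [mem_cliq_dropPairs, mem_cliq_dropPairs, List.forall_mem_cons, and_assoc]
  have : (z.1 ≠ z.2 → ¬ (e.symm z.1 ∈ c ∧ e.symm z.2 ∈ c)) ↔
    ¬ (e.symm z.1 ∈ c ∧ e.symm z.2 ∈ c) := ⟨fun h => h hz, fun h _ => h⟩
  rw [this, and_comm (a := ¬ _)]

/-- Removal of a vertex with nonevasive link from a clique complex without the face `t`. -/
theorem exists_collapse_vertex (hsymm : ∀ a b, r a b = r b a) (hirr : ∀ a, r a a = false)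
    {K : PreAbstractSimplicialComplex α} {p : ℕ}
    (hK : K.faces = (cliq e r (p :: l)).faces \ {t}) (hpl : p ∉ l) (hpt : e.symm p ∉ t)
    (h : (cliq e r (l.filter (r p))).IsNonevasive) :
    ∃ K' : PreAbstractSimplicialComplex α, K.CollapsesOnto K' ∧
      K'.faces = (cliq e r l).faces \ {t} := by
  have hdl := congrArg faces (deletion_cliq (e := e) (r := r) (l := p :: l) (l' := l) (p := p)
    (by grind))
  have hlk := congrArg faces (link_cliq (e := e) hsymm hirr (l := p :: l)
    (l' := l.filter (r p)) (p := p) List.mem_cons_self (by have := hirr p; grind))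
  refine ⟨K.deletion (e.symm p), ?_, ?_⟩
  · rw [← removeStar_singleton]
    refine collapsesOnto_removeStar (Finset.singleton_nonempty _) ?_
    rw [faceLink_singleton]
    convert h.isCollapsible
    apply PreAbstractSimplicialComplex.ext
    rw [← hlk]
    ext c
    -- The absent face `t` does not contain the removed vertex, so it plays no role in the link.
    simp only [link, Set.mem_ofPred_eq, hK, Set.mem_sdiff, Set.mem_singleton_iff]
    refine and_congr_right fun _ => and_congr_right fun _ => and_iff_left ?_
    rintro rfl
    exact hpt (Finset.mem_insert_self _ _)
  · rw [← hdl]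
    ext c
    simp only [deletion, Set.mem_ofPred_eq, hK, Set.mem_sdiff, Set.mem_singleton_iff]
    tauto

theorem mem_faceLink_pair (hsymm : ∀ a b, r a b = r b a) {p q : ℕ} (hp : p ∈ l) (hq : q ∈ l)
    (hpq : r p q = true) (hne : p ≠ q) {c : Finset α} :
    c ∈ (faceLink {e.symm p, e.symm q} (cliq e r l)).faces ↔
      e.symm p ∉ c ∧ e.symm q ∉ c ∧ c ∈ (cliq e r l).faces ∧
        ∀ s ∈ c, r p (e s) = true ∧ r q (e s) = true := by
  have hunion : {e.symm p, e.symm q} ∪ c = insert (e.symm p) (insert (e.symm q) c) := by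
    rw [Finset.insert_union, Finset.singleton_union]
  have hne' : e.symm p ≠ e.symm q := fun h => hne (e.symm.injective h)
  constructor
  · rintro ⟨h1, h2, h3⟩
    rw [Finset.disjoint_insert_left, Finset.disjoint_singleton_left] at h2
    rw [hunion, insert_mem_cliq hsymm (Finset.insert_nonempty _ _)
      (by simp only [Finset.mem_insert]; tauto), insert_mem_cliq hsymm h1 h2.2] at h3
    simp only [e.apply_symm_apply] at h3
    exact ⟨h2.1, h2.2, h3.2.1.2.1, fun s hs =>
      ⟨h3.2.2 s (Finset.mem_insert_of_mem hs), h3.2.1.2.2 s hs⟩⟩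
  · rintro ⟨h1, h2, h3, h4⟩
    refine ⟨h3.1, ?_, ?_⟩
    · rw [Finset.disjoint_insert_left, Finset.disjoint_singleton_left]
      exact ⟨h1, h2⟩
    · rw [hunion, insert_mem_cliq hsymm (Finset.insert_nonempty _ _)
        (by simp only [Finset.mem_insert]; tauto), insert_mem_cliq hsymm h3.1 h2]
      simp only [e.apply_symm_apply]
      refine ⟨hp, ⟨hq, h3, fun s hs => (h4 s hs).2⟩, fun s hs => ?_⟩
      rcases Finset.mem_insert.1 hs with rfl | hs
      · simpa using hpq
      · exact (h4 s hs).1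

theorem mem_faceLink_pair' (hsymm : ∀ a b, r a b = r b a) (hirr : ∀ a, r a a = false) {p q : ℕ}
    (hp : p ∈ l) (hq : q ∈ l) (hpq : r p q = true) {c : Finset α} :
    c ∈ (faceLink {e.symm p, e.symm q} (cliq e r l)).faces ↔
      c ∈ (cliq e r (l.filter fun x => r p x && r q x)).faces := by
  have hne : p ≠ q := by
    rintro rfl
    rw [hirr] at hpq
    exact absurd hpq (by simp)
  rw [mem_faceLink_pair hsymm hp hq hpq hne]
  constructor
  · rintro ⟨-, -, ⟨h1, h2, h3⟩, h4⟩
    exact ⟨h1, fun s hs => List.mem_filter.2 ⟨h2 s hs, by simp [h4 s hs]⟩, h3⟩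
  · rintro ⟨h1, h2, h3⟩
    simp only [List.mem_filter, Bool.and_eq_true] at h2
    refine ⟨fun h => ?_, fun h => ?_, ⟨h1, fun s hs => (h2 s hs).1, h3⟩, fun s hs => (h2 s hs).2⟩
    · have := (h2 _ h).2.1
      rw [e.apply_symm_apply, hirr] at this
      exact absurd this (by simp)
    · have := (h2 _ h).2.2
      rw [e.apply_symm_apply, hirr] at this
      exact absurd this (by simp)

/-- Removal of an edge with nonevasive link from a clique complex without the face `t`. -/
theorem exists_collapse_edge (hsymm : ∀ a b, r a b = r b a) (hirr : ∀ a, r a a = false)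
    {R : List (ℕ × ℕ)} {K : PreAbstractSimplicialComplex α} {p q : ℕ}
    (hK : K.faces = (cliq e (dropPairs r R) l).faces \ {t}) (hp : p ∈ l) (hq : q ∈ l)
    (hpq : dropPairs r R p q = true) (hpt : e.symm p ∉ t)
    (h : (cliq e (dropPairs r R)
      (l.filter fun x => dropPairs r R p x && dropPairs r R q x)).IsNonevasive) :
    ∃ K' : PreAbstractSimplicialComplex α, K.CollapsesOnto K' ∧
      K'.faces = (cliq e (dropPairs r ((p, q) :: R)) l).faces \ {t} := by
  have hne : p ≠ q := by
    rintro rfl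
    rw [dropPairs_self hirr] at hpq
    exact absurd hpq (by simp)
  refine ⟨removeStar {e.symm p, e.symm q} K, ?_, ?_⟩
  · refine collapsesOnto_removeStar (Finset.insert_nonempty _ _) ?_
    convert h.isCollapsible
    apply PreAbstractSimplicialComplex.ext
    ext c
    rw [← mem_faceLink_pair' (dropPairs_comm hsymm R) (dropPairs_self hirr R) hp hq hpq]
    simp only [faceLink, Set.mem_ofPred_eq, hK, Set.mem_sdiff, Set.mem_singleton_iff]
    refine and_congr_right fun _ => and_congr_right fun _ => and_iff_left ?_
    rintro rfl
    exact hpt (by simp)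
  · ext c
    rw [Set.mem_sdiff, mem_cliq_dropPairs_cons hne]
    simp only [removeStar, Set.mem_ofPred_eq, hK, Set.mem_sdiff, Set.mem_singleton_iff,
      Finset.insert_subset_iff, Finset.singleton_subset_iff]
    tauto

/-- Tests a sequence of moves that leads to the vertices in `b`. The move `(0, 0)` removes the
first vertex of the list, a move `(p, q)` with `p ≠ 0` removes the edge between `p` and `q`. -/
def movesCheck (r : ℕ → ℕ → Bool) (n : ℕ) (b : List ℕ) :
    List (ℕ × ℕ) → List (ℕ × ℕ) → List ℕ → Bool
  | [], _, l => l == b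
  | _ :: _, _, [] => false
  | (0, _) :: ms, R, p :: l => b.all (fun q => !Nat.beq q p) && l.all (fun q => !Nat.beq q p) &&
      filterK (dropPairs r R p) l (nonevasiveCheck (dropPairs r R) n) && movesCheck r n b ms R l
  | (p + 1, q) :: ms, R, x :: l => b.all (fun q => !Nat.beq q (p + 1)) &&
      (x :: l).any (Nat.beq (p + 1)) && (x :: l).any (Nat.beq q) && dropPairs r R (p + 1) q &&
      filterK (fun y => dropPairs r R (p + 1) y && dropPairs r R q y) (x :: l)
        (nonevasiveCheck (dropPairs r R) n) &&
      movesCheck r n b ms ((p + 1, q) :: R) (x :: l)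

/-- The moves are carried out one after the other. Every dropped edge has an end outside `b`, so the
final complex on `b` is the one for the original relation, without `t`. -/
theorem exists_collapse_of_movesCheck (hsymm : ∀ a b, r a b = r b a) (hirr : ∀ a, r a a = false)
    (ht : ∀ s ∈ t, e s ∈ b) (n : ℕ) : ∀ (ms R : List (ℕ × ℕ)) (l : List ℕ),
      movesCheck r n b ms R l = true → (∀ z ∈ R, z.1 ∉ b) →
      ∀ K : PreAbstractSimplicialComplex α, K.faces = (cliq e (dropPairs r R) l).faces \ {t} →
        ∃ K' : PreAbstractSimplicialComplex α, K.CollapsesOnto K' ∧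
          K'.faces = (cliq e r b).faces \ {t} := by
  intro ms
  have htp : ∀ p, p ∉ b → e.symm p ∉ t := fun p hp h => hp (by simpa using ht _ h)
  induction ms with
  | nil =>
    intro R l h hR K hK
    rw [movesCheck, beq_iff_eq] at h
    subst h
    refine ⟨K, .refl, ?_⟩
    rw [hK]
    congr 1
    ext c
    rw [mem_cliq_dropPairs]
    refine and_iff_left_of_imp fun hc z hz _ h => hR z hz ?_
    simpa using hc.2.1 _ h.1
  | cons m ms ih =>
    intro R l h hR K hK
    rcases l with _ | ⟨x, l⟩
    · simp [movesCheck] at h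
    rcases m with ⟨_ | p, q⟩
    · simp only [movesCheck, Bool.and_eq_true, List.all_eq_true, Bool.not_eq_true', beq_false_iff,
        filterK_eq] at h
      obtain ⟨⟨⟨h1, h2⟩, h3⟩, h4⟩ := h
      obtain ⟨K', hKK, hK'⟩ := exists_collapse_vertex (dropPairs_comm hsymm R)
        (dropPairs_self hirr R) hK (fun h => h2 x h rfl) (htp x fun h => h1 x h rfl)
        (isNonevasive_of_check (dropPairs_comm hsymm R) (dropPairs_self hirr R) n _ h3)
      obtain ⟨K'', h5, h6⟩ := ih R l h4 hR K' hK'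
      exact ⟨K'', hKK.trans h5, h6⟩
    · simp only [movesCheck, Bool.and_eq_true, List.all_eq_true, Bool.not_eq_true', beq_false_iff,
        filterK_eq, List.any_eq_true, Nat.beq_eq] at h
      obtain ⟨⟨⟨⟨⟨h1, ⟨_, h2, rfl⟩⟩, ⟨_, h3, rfl⟩⟩, h4⟩, h5⟩, h6⟩ := h
      have hpb : p + 1 ∉ b := fun h => h1 _ h rfl
      obtain ⟨K', hKK, hK'⟩ := exists_collapse_edge hsymm hirr hK h2 h3 h4 (htp _ hpb)
        (isNonevasive_of_check (dropPairs_comm hsymm R) (dropPairs_self hirr R) n _ h5)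
      obtain ⟨K'', h7, h8⟩ := ih _ _ h6 (List.forall_mem_cons.2 ⟨hpb, hR⟩) K' hK'
      exact ⟨K'', hKK.trans h7, h8⟩

/-- A clique complex collapses so that a free triangle `t` and the edge `{h, b}` of the only
tetrahedron containing it disappear. -/
theorem exists_collapse_free_triangle (hsymm : ∀ a b, r a b = r b a) (hirr : ∀ a, r a a = false)
    {x y z w : ℕ} (hmem : x ∈ l ∧ y ∈ l ∧ z ∈ l ∧ w ∈ l)
    (hadj : r x y = true ∧ r x z = true ∧ r y z = true ∧ r x w = true ∧ r y w = true ∧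
      r z w = true)
    (hfree : ∀ q ∈ l, r x q = true → r y q = true → r z q = true → q = w)
    (h : (cliq e (dropPairs r [(x, z)]) (l.filter fun q => r w q && r y q)).IsNonevasive) :
    ∃ K' : PreAbstractSimplicialComplex α, (cliq e r l).CollapsesOnto K' ∧
      K'.faces = (cliq e (dropPairs r [(w, y)]) l).faces \ {{e.symm x, e.symm y, e.symm z}} := by
  have hne : ∀ {a b : ℕ}, r a b = true → a ≠ b := by
    rintro a b h rfl
    rw [hirr] at h
    exact absurd h (by simp)
  have hne' : ∀ {a b : ℕ}, r a b = true → e.symm a ≠ e.symm b := fun h h' =>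
    hne h (e.symm.injective h')
  obtain ⟨hx, hy, hz, hw⟩ := hmem
  obtain ⟨hxy, hxz, hyz, hxw, hyw, hzw⟩ := hadj
  have hwy : r w y = true := by rw [hsymm, hyw]
  set X := e.symm x with hX
  set Y := e.symm y with hY
  set Z := e.symm z with hZ
  set W := e.symm w with hW
  have hWt : W ∉ ({X, Y, Z} : Finset α) := by
    simp only [Finset.mem_insert, Finset.mem_singleton, not_or]
    exact ⟨(hne' hxw).symm, (hne' hyw).symm, (hne' hzw).symm⟩
  have htK : {X, Y, Z} ∈ (cliq e r l).faces := by
    refine ⟨Finset.insert_nonempty _ _, ?_, ?_⟩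
    · simp [hX, hY, hZ, hx, hy, hz]
    · simp [hX, hY, hZ, hxy, hxz, hyz, hsymm z x, hsymm z y, hsymm y x]
  have hWK : insert W {X, Y, Z} ∈ (cliq e r l).faces := by
    rw [insert_mem_cliq hsymm (Finset.insert_nonempty _ _) hWt]
    refine ⟨by simpa [hW] using hw, htK, ?_⟩
    simp [hX, hY, hZ, hW, hsymm w x, hsymm w y, hsymm w z, hxw, hyw, hzw]
  -- By `hfree` the triangle extends by `W` only, so it and the tetrahedron are the only faces above
  -- it.
  have key : ∀ c ∈ (cliq e r l).faces, {X, Y, Z} ⊆ c → c = {X, Y, Z} ∨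
      c = insert W {X, Y, Z} := by
    intro c hc htc
    have hcW : ∀ s ∈ c, s ∉ ({X, Y, Z} : Finset α) → s = W := by
      intro s hs hst
      have hr : ∀ a ∈ ({X, Y, Z} : Finset α), r (e a) (e s) = true := fun a ha =>
        hc.2.2 a (htc ha) s hs (fun h => hst (h ▸ ha))
      simp only [Finset.mem_insert, Finset.mem_singleton, forall_eq_or_imp, forall_eq, hX, hY, hZ,
        e.apply_symm_apply] at hr
      rw [hW, ← hfree _ (hc.2.1 s hs) hr.1 hr.2.1 hr.2.2, e.symm_apply_apply]
    by_cases hWc : W ∈ c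
    · right
      refine Finset.Subset.antisymm (fun s hs => ?_) (Finset.insert_subset hWc htc)
      rw [Finset.mem_insert]
      by_contra h
      push Not at h
      exact h.1 (hcW s hs h.2)
    · left
      refine Finset.Subset.antisymm (fun s hs => ?_) htc
      by_contra h
      exact hWc (hcW s hs h ▸ hs)
  let K₁ : PreAbstractSimplicialComplex α :=
    { faces := (cliq e r l).faces \ {{X, Y, Z}, insert W {X, Y, Z}}
      isRelLowerSet_faces := by
        rintro c ⟨hc, hct⟩
        refine ⟨nonempty_of_mem hc, fun b hbc hb => ⟨mem_of_subset hc hbc hb, fun h => hct ?_⟩⟩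
        have : {X, Y, Z} ⊆ b := by
          rcases h with rfl | h
          · exact subset_rfl
          · rw [Set.mem_singleton_iff] at h
            rw [h]
            exact Finset.subset_insert _ _
        exact key c hc (this.trans hbc) }
  have h1 : ElementaryCollapse (cliq e r l) K₁ := by
    refine ⟨_, htK, _, hWK, Finset.ssubset_insert hWt, fun ρ hρ htρ => ?_, rfl⟩
    exact (key ρ hρ htρ.subset).resolve_left htρ.ne'
  -- The link of the edge `{W, Y}` in `K₁` has lost exactly the faces containing `X` and `Z`, since
  -- these would complete the removed tetrahedron. This is the clique complex in `h`.
  have h2 : K₁.CollapsesOnto (removeStar {W, Y} K₁) := by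
    refine collapsesOnto_removeStar (Finset.insert_nonempty _ _) ?_
    convert h.isCollapsible
    apply PreAbstractSimplicialComplex.ext
    ext c
    rw [mem_cliq_dropPairs, ← mem_faceLink_pair' hsymm hirr hw hy hwy]
    have hsub : ∀ {c : Finset α}, X ∈ c → Z ∈ c → {X, Y, Z} ⊆ {W, Y} ∪ c := by
      intro c h1 h2 s hs
      simp only [Finset.mem_insert, Finset.mem_singleton] at hs
      rcases hs with rfl | rfl | rfl <;> simp [h1, h2]
    constructor
    · rintro ⟨h1, h2, h3, h4⟩
      refine ⟨⟨h1, h2, h3⟩, ?_⟩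
      simp only [List.mem_singleton, forall_eq]
      rintro - ⟨h5, h6⟩
      exact h4 (key _ h3 (hsub h5 h6))
    · rintro ⟨⟨h1, h2, h3⟩, h4⟩
      refine ⟨h1, h2, h3, ?_⟩
      rw [Finset.disjoint_insert_left, Finset.disjoint_singleton_left] at h2
      simp only [List.mem_singleton, forall_eq] at h4
      rintro (h5 | h5)
      · exact hWt (h5 ▸ by simp)
      · rw [Set.mem_singleton_iff] at h5
        refine h4 (hne hxz) ⟨?_, ?_⟩
        · have : X ∈ {W, Y} ∪ c := by rw [h5]; simp
          simpa [hne' hxy, hne' hxw, hX, hY, hW] using this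
        · have : Z ∈ {W, Y} ∪ c := by rw [h5]; simp
          simpa [(hne' hyz).symm, hne' hzw, hZ, hY, hW] using this
  refine ⟨_, (Relation.ReflTransGen.single h1).trans h2, ?_⟩
  ext c
  rw [Set.mem_sdiff, mem_cliq_dropPairs]
  simp only [List.mem_singleton, forall_eq, removeStar, K₁, Set.mem_ofPred_eq, Set.mem_sdiff,
    Set.mem_insert_iff, Set.mem_singleton_iff, Finset.insert_subset_iff,
    Finset.singleton_subset_iff]
  -- Once the edge `{W, Y}` is gone, the tetrahedron is no longer a clique, and only the triangle
  -- has to be excluded by hand.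
  have hWY : c = insert W {X, Y, Z} → W ∈ c ∧ Y ∈ c := by
    rintro rfl
    simp
  have := hne hwy
  tauto

end Moves

/-! ### Maximal chains, purity of subdivisions and coded face lists. -/

section Flags

/-- Induction on the size of `F`: the members of the chain other than `F` miss a common point `x`,
so they can be extended to a full flag inside `F` without `x`, to which `F` is added. -/
theorem exists_flag {α : Type*} [DecidableEq α] (n : ℕ) : ∀ (F : Finset α) (c : Finset (Finset α)),
    F.card = n → (∀ s ∈ c, s.Nonempty ∧ s ⊆ F) → (∀ s ∈ c, ∀ t ∈ c, s ⊆ t ∨ t ⊆ s) →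
      ∃ c', c ⊆ c' ∧ c'.card = n ∧ (∀ s ∈ c', s.Nonempty ∧ s ⊆ F) ∧
        ∀ s ∈ c', ∀ t ∈ c', s ⊆ t ∨ t ⊆ s := by
  induction n with
  | zero =>
    intro F c hF hc hch
    refine ⟨c, subset_rfl, ?_, hc, hch⟩
    rw [Finset.card_eq_zero] at hF ⊢
    refine Finset.eq_empty_of_forall_notMem fun s hs => ?_
    have := hc s hs
    rw [hF, Finset.subset_empty] at this
    exact this.1.ne_empty this.2
  | succ n ih =>
    intro F c hF hc hch
    obtain ⟨x, hx, hxc⟩ : ∃ x ∈ F, ∀ s ∈ c, s ≠ F → x ∉ s := by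
      rcases (c.erase F).eq_empty_or_nonempty with h0 | h0
      · obtain ⟨x, hx⟩ : F.Nonempty := Finset.card_pos.1 (by omega)
        refine ⟨x, hx, fun s hs hsF => ?_⟩
        exact absurd (Finset.mem_erase.2 ⟨hsF, hs⟩) (h0 ▸ Finset.notMem_empty s)
      · obtain ⟨m, hm, hmax⟩ := Finset.exists_max_image _ Finset.card h0
        rw [Finset.mem_erase] at hm
        obtain ⟨x, hx, hxm⟩ := Finset.exists_of_ssubset ((hc m hm.2).2.ssubset_of_ne hm.1)
        refine ⟨x, hx, fun s hs hsF hxs => hxm ?_⟩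
        rcases hch s hs m hm.2 with h | h
        · exact h hxs
        · rwa [Finset.eq_of_subset_of_card_le h (hmax s (Finset.mem_erase.2 ⟨hsF, hs⟩))]
    obtain ⟨c', h1, h2, h3, h4⟩ := ih (F.erase x) (c.erase F)
      (by rw [Finset.card_erase_of_mem hx]; omega)
      (fun s hs => by
        rw [Finset.mem_erase] at hs
        exact ⟨(hc s hs.2).1, Finset.subset_erase.2 ⟨(hc s hs.2).2, hxc s hs.2 hs.1⟩⟩)
      (fun s hs t ht => hch s (Finset.mem_of_mem_erase hs) t (Finset.mem_of_mem_erase ht))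
    have hsub : ∀ s ∈ c', s ⊆ F := fun s hs => (h3 s hs).2.trans (Finset.erase_subset x F)
    have hFc : F ∉ c' := fun h => Finset.notMem_erase x F ((h3 F h).2 hx)
    refine ⟨insert F c', fun s hs => ?_, by rw [Finset.card_insert_of_notMem hFc, h2], ?_, ?_⟩
    · rw [Finset.mem_insert]
      exact or_iff_not_imp_left.2 fun h => h1 (Finset.mem_erase.2 ⟨h, hs⟩)
    · intro s hs
      rcases Finset.mem_insert.1 hs with rfl | hs
      · exact ⟨Finset.card_pos.1 (by omega), subset_rfl⟩
      · exact ⟨(h3 s hs).1, hsub s hs⟩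
    · intro s hs t ht
      rcases Finset.mem_insert.1 hs with hs' | hs' <;> rcases Finset.mem_insert.1 ht with ht' | ht'
      · exact Or.inl (hs'.trans ht'.symm).subset
      · exact Or.inr (hs' ▸ hsub t ht')
      · exact Or.inl (ht' ▸ hsub s hs')
      · exact h4 s hs' t ht'

theorem IsPure.sd {K : PreAbstractSimplicialComplex ℕ} {d : ℕ} (hK : K.IsPure d) :
    K.sd.IsPure d := by
  have hch : ∀ c : Finset (Finset ℕ), IsChain (· ⊆ ·) (c : Set (Finset ℕ)) ↔
      ∀ s ∈ c, ∀ t ∈ c, s ⊆ t ∨ t ⊆ s := fun c =>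
    ⟨fun h s hs t ht => h.total hs ht, fun h s hs t ht _ => h s hs t ht⟩
  have key : ∀ F ∈ K.faces, F.card = d + 1 → ∀ c : Finset (Finset ℕ),
      (∀ s ∈ c, s.Nonempty ∧ s ⊆ F) → (∀ s ∈ c, ∀ t ∈ c, s ⊆ t ∨ t ⊆ s) →
        ∃ c' ∈ K.sd.faces, c ⊆ c' ∧ c'.card = d + 1 := by
    intro F hF hcard c h1 h2
    obtain ⟨c', h3, h4, h5, h6⟩ := exists_flag (d + 1) F c hcard h1 h2
    exact ⟨c', ⟨Finset.card_pos.1 (by omega), fun s hs => mem_of_subset hF (h5 s hs).2 (h5 s hs).1,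
      (hch c').2 h6⟩, h3, h4⟩
  constructor
  · obtain ⟨s, hs⟩ := hK.1
    obtain ⟨F, hF, -, hcard⟩ := hK.2 s hs
    obtain ⟨c', hc', -⟩ := key F hF hcard ∅ (by simp) (by simp)
    exact ⟨c', hc'⟩
  · rintro c ⟨hc, hcK, hchain⟩
    obtain ⟨m, hm, hmax⟩ := Finset.exists_max_image _ Finset.card hc
    rw [hch] at hchain
    obtain ⟨F, hF, hmF, hcard⟩ := hK.2 m (hcK m hm)
    refine key F hF hcard c (fun s hs => ⟨nonempty_of_mem (hcK s hs), ?_⟩) hchain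
    rcases hchain s hs m hm with h | h
    · exact h.trans hmF
    · rwa [← Finset.eq_of_subset_of_card_le h (hmax s hs)]

theorem isPure_ofFacets {α : Type*} {L : List (Finset α)} {d : ℕ} (h0 : L ≠ [])
    (h : ∀ F ∈ L, F.card = d + 1) : (ofFacets L).IsPure d := by
  have hmem : ∀ F ∈ L, F ∈ (ofFacets L).faces := fun F hF =>
    ⟨Finset.card_pos.1 (by rw [h F hF]; omega), F, hF, subset_rfl⟩
  obtain ⟨F, hF⟩ := List.exists_mem_of_ne_nil L h0
  exact ⟨⟨F, hmem F hF⟩, fun s ⟨_, F, hF, hsF⟩ => ⟨F, hmem F hF, hsF, h F hF⟩⟩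

/-- Tests that `l` consists of the nonempty subsets of the members of `M`, all in coded form. -/
def facesCheck (n : ℕ) (M l : List ℕ) : Bool :=
  (l.all fun m => !Nat.beq m 0 && Nat.ble m (2 ^ n - 1) && M.any (subB m) &&
    (List.range n).all fun i => !Nat.testBit m i || Nat.beq m (2 ^ i) ||
      l.any (Nat.beq (Nat.sub m (2 ^ i)))) &&
  M.all fun F => l.any (Nat.beq F)

/-- Every face arises from a facet by removing elements one at a time. On codes this is subtraction
of powers of two, so closure of `l` under single steps suffices; the induction is on the number of
elements removed. -/
theorem mem_ofFacets_iff_code (n : ℕ) {L : List (Finset ℕ)} {M l : List ℕ}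
    (hM : L.map code = M) (h : facesCheck n M l = true) (s : Finset ℕ) :
    s ∈ (ofFacets L).faces ↔ code s ∈ l := by
  simp only [facesCheck, Bool.and_eq_true, List.all_eq_true, Bool.not_eq_true', beq_false_iff,
    List.any_eq_true, Bool.or_eq_true, Nat.beq_eq, List.mem_range, Nat.ble_eq, ← hM] at h
  obtain ⟨h1, h2⟩ := h
  constructor
  · rintro ⟨hs, F, hF, hsF⟩
    obtain ⟨k, hk⟩ : ∃ k, (F \ s).card = k := ⟨_, rfl⟩
    induction k generalizing s with
    | zero =>
      rw [Finset.card_eq_zero, Finset.sdiff_eq_empty_iff_subset] at hk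
      obtain ⟨_, h3, h4⟩ := h2 (code F) (List.mem_map_of_mem hF)
      rwa [hsF.antisymm hk, h4]
    | succ k ih =>
      obtain ⟨i, hi⟩ : (F \ s).Nonempty := Finset.card_pos.1 (by omega)
      rw [Finset.mem_sdiff] at hi
      have h3 := ih (insert i s) (Finset.insert_nonempty i s) (Finset.insert_subset hi.1 hsF) (by
        rw [Finset.sdiff_insert, Finset.card_erase_of_mem (Finset.mem_sdiff.2 hi)]
        omega)
      have hsum : code (insert i s) = 2 ^ i + code s := by
        rw [code_apply, code_apply, Finset.sum_insert hi.2]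
      -- The bound on the codes ensures that `i` is among the tested positions.
      have hin : i < n := by
        have h5 := (h1 _ h3).1.1.2
        have h6 : 2 ^ i < 2 ^ n := by
          have := Nat.two_pow_pos n
          omega
        exact (Nat.pow_lt_pow_iff_right (by norm_num)).1 h6
      have hpos : code s ≠ 0 := by
        obtain ⟨j, hj⟩ := hs
        intro h0
        rw [mem_iff_testBit_code, h0, Nat.zero_testBit] at hj
        exact absurd hj (by simp)
      rcases (h1 _ h3).2 i hin with (h5 | h5) | ⟨_, h5, h6⟩
      · rw [← Bool.not_eq_true, ← mem_iff_testBit_code] at h5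
        exact absurd (Finset.mem_insert_self i s) h5
      -- A code equal to `2 ^ i` would leave the empty set after removal of `i`.
      · omega
      · change code (insert i s) - 2 ^ i = _ at h6
        rw [hsum, Nat.add_sub_cancel_left] at h6
        rwa [h6]
  · intro hs
    obtain ⟨⟨⟨h3, -⟩, ⟨_, hF', h4⟩⟩, -⟩ := h1 _ hs
    obtain ⟨F, hF, rfl⟩ := List.mem_map.1 hF'
    refine ⟨Finset.nonempty_iff_ne_empty.2 ?_, F, hF, subB_code.1 h4⟩
    rintro rfl
    exact h3 (by simp [code_apply])

end Flags

/-! ### Boundaries of clique complexes, of cones and of complexes given by facets. -/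

section Boundary

/-- The triangles of the clique complex on `l` that have exactly one extension have their vertices
in `b`, and all triangles of the clique complex on `b` have exactly one extension. -/
def boundaryCheck (l b : List ℕ) : Bool :=
  (l.all fun x => filterK (cmpB x) l fun lx => lx.all fun y => filterK (cmpB y) lx fun ly =>
    ly.all fun z => filterK (cmpB z) ly fun lz => !Nat.beq lz.length 1 ||
      (b.any (Nat.beq x) && b.any (Nat.beq y) && b.any (Nat.beq z))) &&
  (b.all fun x => filterK (cmpB x) l fun lx => filterK (cmpB x) b fun bx => bx.all fun y =>
    filterK (cmpB y) lx fun ly => filterK (cmpB y) bx fun bxy => bxy.all fun z =>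
      filterK (cmpB z) ly fun lz => Nat.beq lz.length 1)

/-- Filtering the vertex list successively by the three vertices of a triangle lists the vertices
that extend it to a tetrahedron. As the list has no repetitions, lying in exactly one tetrahedron
means that one vertex is left. -/
theorem boundary_cliq {l b : List ℕ} (hl : l.Nodup) (hbl : ∀ q ∈ b, q ∈ l)
    (hb : (cliq code cmpB b).IsPure 2) (h : boundaryCheck l b = true) :
    (cliq code cmpB l).boundary 3 = cliq code cmpB b := by
  have hext : ∀ x y z : ℕ, ∀ F : Finset (Finset ℕ),
      F = {code.symm x, code.symm y, code.symm z} → F.card = 3 → F ∈ (cliq code cmpB l).faces →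
      ((∃! G, G ∈ (cliq code cmpB l).faces ∧ G.card = 3 + 1 ∧ F ⊆ G) ↔
        (((l.filter (cmpB x)).filter (cmpB y)).filter (cmpB z)).length = 1) := by
    intro x y z F hF hcard hFK
    have hmem : ∀ s, s ∉ F → (insert s F ∈ (cliq code cmpB l).faces ↔
        code s ∈ ((l.filter (cmpB x)).filter (cmpB y)).filter (cmpB z)) := by
      intro s hs
      rw [insert_mem_cliq cmpB_comm (Finset.card_pos.1 (by omega)) hs, eq_true hFK, true_and]
      simp only [hF, Finset.mem_insert, Finset.mem_singleton, forall_eq_or_imp,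
        forall_eq, code.apply_symm_apply, List.mem_filter, cmpB_comm (code s)]
      tauto
    have hnot : ∀ q ∈ ((l.filter (cmpB x)).filter (cmpB y)).filter (cmpB z),
        code.symm q ∉ F := by
      intro q hq hqF
      simp only [List.mem_filter] at hq
      have hx := cmpB_self x
      have hy := cmpB_self y
      have hz := cmpB_self z
      simp only [hF, Finset.mem_insert, Finset.mem_singleton, code.symm.injective.eq_iff] at hqF
      rcases hqF with rfl | rfl | rfl <;> simp_all
    have hnd : (((l.filter (cmpB x)).filter (cmpB y)).filter (cmpB z)).Nodup :=
      ((hl.filter _).filter _).filter _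
    have hins : ∀ G : Finset (Finset ℕ), G.card = 3 + 1 → F ⊆ G → ∃ s ∉ F, insert s F = G := by
      intro G hGc hFG
      have : (G \ F).card = 1 := by
        rw [Finset.card_sdiff_of_subset hFG]
        omega
      obtain ⟨s, hs⟩ := Finset.card_eq_one.1 this
      have hsG : s ∈ G \ F := hs ▸ Finset.mem_singleton_self s
      refine ⟨s, (Finset.mem_sdiff.1 hsG).2, ?_⟩
      rw [Finset.insert_eq, ← hs, Finset.sdiff_union_of_subset hFG]
    constructor
    · rintro ⟨G, ⟨hG, hGc, hFG⟩, huniq⟩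
      obtain ⟨s, hsF, hs⟩ := hins G hGc hFG
      have hmemS : code s ∈ ((l.filter (cmpB x)).filter (cmpB y)).filter (cmpB z) :=
        (hmem s hsF).1 (hs ▸ hG)
      rw [List.length_eq_one_iff]
      refine ⟨code s, ?_⟩
      rw [← List.perm_singleton, List.perm_ext_iff_of_nodup hnd (List.nodup_singleton _)]
      intro q
      rw [List.mem_singleton]
      refine ⟨fun hq => ?_, fun hq => hq ▸ hmemS⟩
      have hqF := hnot q hq
      have h5 := huniq (insert (code.symm q) F) ⟨(hmem _ hqF).2 (by simpa using hq),
        by rw [Finset.card_insert_of_notMem hqF, hcard], Finset.subset_insert _ _⟩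
      rw [← hs] at h5
      have h6 : code.symm q ∈ insert s F := h5 ▸ Finset.mem_insert_self _ _
      rw [← (Finset.mem_insert.1 h6).resolve_right hqF, code.apply_symm_apply]
    · intro hlen
      obtain ⟨q, hq⟩ := List.length_eq_one_iff.1 hlen
      have hqm := hq ▸ List.mem_singleton_self q
      have hqF := hnot q hqm
      refine ⟨insert (code.symm q) F, ⟨(hmem _ hqF).2 (by rwa [code.apply_symm_apply]),
        by rw [Finset.card_insert_of_notMem hqF, hcard], Finset.subset_insert _ _⟩, ?_⟩
      rintro G ⟨hG, hGc, hFG⟩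
      obtain ⟨s, hsF, hs⟩ := hins G hGc hFG
      have hmemS := (hmem s hsF).1 (hs ▸ hG)
      rw [hq, List.mem_singleton] at hmemS
      rw [← hs, ← hmemS, code.symm_apply_apply]
  have htri : ∀ {l' : List ℕ} {F : Finset (Finset ℕ)}, F ∈ (cliq code cmpB l').faces →
      F.card = 3 → ∃ x y z, F = {code.symm x, code.symm y, code.symm z} ∧ x ∈ l' ∧
        y ∈ l'.filter (cmpB x) ∧ z ∈ (l'.filter (cmpB x)).filter (cmpB y) := by
    intro l' F hF hcard
    obtain ⟨x, y, z, hxy, hxz, hyz, rfl⟩ := Finset.card_eq_three.1 hcard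
    refine ⟨code x, code y, code z, by simp, hF.2.1 x (by simp), ?_, ?_⟩
    · exact List.mem_filter.2 ⟨hF.2.1 y (by simp), hF.2.2 x (by simp) y (by simp) hxy⟩
    · refine List.mem_filter.2 ⟨List.mem_filter.2 ⟨hF.2.1 z (by simp), ?_⟩, ?_⟩
      · exact hF.2.2 x (by simp) z (by simp) hxz
      · exact hF.2.2 y (by simp) z (by simp) hyz
  simp only [boundaryCheck, filterK_eq, Bool.and_eq_true, List.all_eq_true, Bool.or_eq_true,
    Bool.not_eq_true', beq_false_iff, Nat.beq_eq, List.any_eq_true] at h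
  obtain ⟨h1, h2⟩ := h
  have hle : ∀ c ∈ (cliq code cmpB b).faces, c ∈ (cliq code cmpB l).faces := fun c hc =>
    ⟨hc.1, fun s hs => hbl _ (hc.2.1 s hs), hc.2.2⟩
  apply PreAbstractSimplicialComplex.ext
  ext c
  constructor
  · rintro ⟨hc, F, hF, hcF, hcard, huniq⟩
    obtain ⟨x, y, z, hFe, hx, hy, hz⟩ := htri hF hcard
    rw [hext x y z F hFe hcard hF] at huniq
    obtain ⟨⟨⟨_, hx', rfl⟩, ⟨_, hy', rfl⟩⟩, ⟨_, hz', rfl⟩⟩ :=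
      (h1 x hx y hy z hz).resolve_left fun h => h huniq
    refine ⟨hc, fun s hs => ?_, fun s hs t ht => hF.2.2 s (hcF hs) t (hcF ht)⟩
    have := hcF hs
    rw [hFe] at this
    simp only [Finset.mem_insert, Finset.mem_singleton] at this
    rcases this with rfl | rfl | rfl <;> simpa
  · intro hc
    obtain ⟨F, hF, hcF, hcard⟩ := hb.2 c hc
    obtain ⟨x, y, z, hFe, hx, hy, hz⟩ := htri hF hcard
    exact ⟨hc.1, F, hle F hF, hcF, hcard,
      (hext x y z F hFe hcard (hle F hF)).2 (h2 x hx y hy z hz)⟩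

/-- A cone over a complex given by facets is given by the cones over the facets. -/
theorem cone_ofFacets {α : Type*} [DecidableEq α] {L : List (Finset α)} (h0 : L ≠ [])
    (v : α) : (ofFacets L).cone v = ofFacets (L.map (insert v)) := by
  apply PreAbstractSimplicialComplex.ext
  ext s
  simp only [cone, ofFacets, Set.mem_ofPred_eq, List.mem_map, exists_exists_and_eq_and,
    Finset.subset_insert_iff]
  refine and_congr_right fun _ => ?_
  constructor
  · rintro (h | ⟨-, h⟩)
    · obtain ⟨F, hF⟩ := List.exists_mem_of_ne_nil L h0
      exact ⟨F, hF, by simp [h]⟩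
    · exact h
  · intro h
    rcases (s.erase v).eq_empty_or_nonempty with h1 | h1
    exacts [Or.inl h1, Or.inr ⟨h1, h⟩]

/-- The boundary of a pure complex given by its facets. -/
theorem boundary_ofFacets {α : Type*} [DecidableEq α] {d : ℕ} (hd : 0 < d)
    {L M : List (Finset α)} (hL : ∀ F ∈ L, F.card = d + 1)
    (h1 : ∀ F ∈ L, ∀ t ∈ F.powersetCard d, t ∈ M ∨ ∃ G ∈ L, G ≠ F ∧ t ⊆ G)
    (h2 : ∀ t ∈ M, t.card = d ∧ ∃ F ∈ L, t ⊆ F ∧ ∀ G ∈ L, t ⊆ G → G = F) :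
    (ofFacets L).boundary d = ofFacets M := by
  have hfac : ∀ F, F ∈ (ofFacets L).faces → F.card = d + 1 → F ∈ L := by
    rintro F ⟨-, G, hG, hFG⟩ hF
    rwa [Finset.eq_of_subset_of_card_le hFG (by rw [hL G hG, hF])]
  have hfac' : ∀ F ∈ L, F ∈ (ofFacets L).faces := fun F hF =>
    ⟨Finset.card_pos.1 (by rw [hL F hF]; omega), F, hF, subset_rfl⟩
  apply PreAbstractSimplicialComplex.ext
  ext s
  constructor
  · rintro ⟨hs, t, -, hst, ht, F, ⟨hF, hFc, htF⟩, huniq⟩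
    refine ⟨hs, t, ?_, hst⟩
    rcases h1 F (hfac F hF hFc) t (Finset.mem_powersetCard.2 ⟨htF, ht⟩) with h | ⟨G, hG, hGF, htG⟩
    · exact h
    · exact absurd (huniq G ⟨hfac' G hG, hL G hG, htG⟩) hGF
  · rintro ⟨hs, t, ht, hst⟩
    obtain ⟨htc, F, hF, htF, huniq⟩ := h2 t ht
    refine ⟨hs, t, mem_of_subset (hfac' F hF) htF (Finset.card_pos.1 (by omega)), hst, htc, F,
      ⟨hfac' F hF, hL F hF, htF⟩, ?_⟩
    rintro G ⟨hG, hGc, htG⟩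
    exact huniq G (hfac G hG hGc) htG

end Boundary

/-! ### Face lists and certificates. -/

section Data

/-- The faces of `ballB_9_18` in the order of a vertex decomposition of the subdivision. -/
def ballB9Faces : List ℕ :=
  [49, 64, 160, 416, 288, 72, 11, 192, 292, 36, 24, 161, 33, 67, 8, 52, 66, 74, 10, 193, 25, 32,
   9, 129, 17, 200, 136, 128, 400, 464, 48, 65, 80, 1, 152, 208, 384, 3, 51, 144, 336, 131, 35,
   448, 19, 50, 385, 449, 54, 320, 16, 321, 323, 38, 322, 34, 18, 22, 272, 23, 20, 84, 156, 21,
   7, 163, 28, 68, 5, 29, 276, 162, 340, 148, 257, 130, 324, 260, 256, 212, 13, 196, 15, 259,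
   387, 386, 132, 418, 140, 290, 204, 294, 76, 258, 2, 12, 262, 14, 326, 4, 6, 70, 78]

/-- Codes of vertex decompositions of the links met in the subdivision of `ballB_9_18`. -/
def ballB9LinkOrders : List ℕ :=
  [266240, 1449902417986677274140940013257019775206563904, 262144, 1, 4096, 4161, 0,
   69810798592, 4097, 0, 262144, 4097, 64, 0, 1073741824, 4096, 262144, 0, 0, 1, 64,
   285941742698496, 1, 532672, 262144, 0, 65, 14543063095474999296322, 4161, 69810000002, 0, 1,
   8192, 81743049715982419113188544837, 0, 0, 262208, 4466817388996, 266240, 1, 0, 0, 0, 0, 0,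
   65, 0, 0, 1090519104, 0, 1189522258175983616, 0, 0, 64, 0, 0, 0, 65, 0, 266240, 1090789570,
   1, 0, 0, 64, 0, 0, 0, 0, 0, 2, 0, 2, 0, 0, 0, 1, 0, 0, 0, 0, 0, 0, 0, 0, 0, 0, 0, 0, 0, 0, 0,
   0, 0, 0, 0, 0, 0, 0]

/-- The faces of `sphereS_13_56` in the order of a vertex decomposition of the subdivision. -/
def sphereFaces : List ℕ :=
  [224, 96, 2144, 608, 112, 1120, 1136, 1104, 1072, 48, 80, 240, 208, 176, 52, 88, 144, 1040,
   216, 152, 200, 1112, 1048, 24, 1096, 16, 20, 148, 28, 1044, 1052, 1076, 156, 12, 140, 1036,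
   1060, 180, 164, 160, 8352, 1028, 136, 4232, 1284, 1088, 72, 1164, 1156, 1160, 36, 8356, 8228,
   8324, 132, 1316, 292, 1312, 1280, 1282, 1412, 388, 1408, 1152, 1056, 384, 3168, 3104, 3136,
   3072, 1410, 386, 1154, 5256, 5248, 5128, 5120, 4224, 1032, 4296, 4168, 4288, 5250, 5122,
   4226, 192, 736, 672, 704, 640, 8864, 8832, 8736, 8320, 8224, 544, 8484, 8480, 8452, 8448,
   288, 1314, 1058, 290, 258, 34, 3106, 2082, 3074, 1026, 2656, 2592, 2080, 2624, 576, 2112, 32,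
   4290, 194, 4162, 4160, 706, 642, 578, 66, 4098, 8834, 8322, 130, 128, 260, 1024, 64, 2, 8706,
   8194, 9218, 514, 1538, 9730, 9728, 1536, 5634, 4610, 5632, 1544, 8704, 9216, 9280, 9224,
   9288, 8264, 9736, 11264, 11328, 10304, 11266, 10242, 8712, 8256, 12352, 10370, 2178, 10368,
   2050, 2176, 2180, 2432, 2434, 2306, 10240, 2436, 10372, 10244, 2308, 5640, 4616, 10308, 2116,
   8260, 8196, 2052, 8744, 8232, 552, 12360, 68, 70, 4164, 4166, 4102, 6, 518, 582, 580, 2628,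
   12356, 12292, 2564, 40, 42, 2088, 2090, 10, 2058, 266, 298, 296, 8488, 8456, 8200, 8192,
   12296, 12288, 12544, 4104, 12552, 4360, 12548, 4356, 4100, 4352, 4614, 4096, 4608, 4612, 4,
   516, 4868, 772, 4864, 2600, 2056, 2568, 520, 2314, 8, 4872, 264, 776, 2312, 768, 256, 512,
   2560, 2824, 2048, 2304, 2816, 2820]

/-- Codes of vertex decompositions of the links met in the subdivision of `sphereS_13_56`. -/
def sphereLinkOrders : List ℕ :=
  [33566720, 8864846590085, 528576, 524480, 524544, 528576, 8865954672770, 524416, 524352,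
   266240, 528384, 2164535619, 8194, 8193, 524288, 528512, 262144, 262144, 139637031043, 8193,
   532672, 139637030979, 8193, 64, 266368, 34091205, 17047684, 128, 128, 128, 528640, 532737,
   532736, 128, 8324, 8196, 532736, 528577, 524480, 524289, 532672, 528449, 528449, 524416,
   524480, 524288, 0, 2165047431, 8324, 8195, 524288, 138546262274, 8194, 524352, 262144,
   138546520450, 8258, 524544, 528449, 532672, 2164789382, 8193, 8196, 524288, 524288, 262144,
   2165047493, 8323, 4098, 262144, 2181312837, 4162, 8323, 138546262276, 8259, 524352, 0,
   524288, 266368, 2164789380, 8193, 8195, 2165051653, 4098, 8323, 524288, 2165047493, 8323,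
   8195, 524288, 138546524419, 8194, 524352, 0, 0, 0, 139637031108, 8258, 528512, 262144, 0,
   2181054789, 8195, 4162, 262144, 524288, 1091043524, 1, 1, 532736, 69826777347, 4097, 64,
   262208, 0, 0, 8869192925184, 138563043650, 8323, 262272, 262208, 1091043524, 4162, 1, 128, 0,
   138529472578, 1, 64, 2181824512, 0, 604688973655854883012608, 2496455872058776171726241792,
   1427247692727378348354234292126135694261023695, 8192, 1, 0, 16777217, 0, 8321, 8256, 4096,
   64, 1, 1, 128, 128, 16781379, 0, 128, 129, 128, 8258, 128, 129, 128, 129, 129, 8258, 4161,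
   64, 528386, 0, 128, 0, 4162, 128, 64, 1, 1, 128, 4162, 8259, 8259, 1, 528449, 262144,
   34082949, 129, 129, 64, 64, 33816772, 128, 128, 528384, 16789765, 0, 128, 129, 128, 1, 64, 1,
   1, 4161, 8257, 8192, 0, 16789765, 0, 128, 128, 64, 2, 64, 1, 1, 4162, 4097, 0, 128, 128, 1,
   128, 64, 4162, 1, 8260, 4099, 0, 0, 4096, 65, 0, 0, 1, 0, 128, 1, 2, 266368, 0, 1, 0, 4096,
   64, 128, 0, 1, 0, 64, 0, 1, 0, 0]

/-- The facets of `ballB_12_38`. -/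
def ballB12Facets : List (Finset ℕ) :=
  [{2, 3, 4, 7}, {2, 3, 4, 10}, {2, 3, 7, 10}, {2, 4, 5, 7}, {2, 4, 5, 10}, {2, 5, 7, 13},
   {2, 5, 8, 10}, {2, 5, 8, 13}, {2, 6, 9, 11}, {2, 6, 11, 13}, {2, 6, 12, 13}, {2, 7, 8, 10},
   {2, 7, 8, 11}, {2, 7, 11, 13}, {2, 8, 9, 11}, {2, 8, 9, 12}, {2, 8, 12, 13}, {3, 4, 6, 7},
   {3, 4, 6, 10}, {3, 5, 8, 13}, {3, 5, 9, 11}, {3, 5, 9, 13}, {3, 6, 7, 12}, {3, 6, 10, 13},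
   {3, 6, 12, 13}, {3, 7, 10, 12}, {3, 8, 9, 11}, {3, 8, 9, 12}, {3, 8, 12, 13}, {3, 9, 10, 12},
   {3, 9, 10, 13}, {4, 5, 6, 7}, {4, 5, 6, 10}, {5, 6, 7, 9}, {5, 6, 9, 11}, {5, 6, 10, 11},
   {5, 7, 9, 13}, {6, 10, 11, 13}]

/-- The boundary triangles of `ballB_12_38`. -/
def ballB12Triangles : List (Finset ℕ) :=
  [{2, 6, 9}, {2, 6, 12}, {2, 9, 12}, {3, 5, 8}, {3, 5, 11}, {3, 8, 11}, {5, 8, 10},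
   {5, 10, 11}, {6, 7, 9}, {6, 7, 12}, {7, 8, 10}, {7, 8, 11}, {7, 9, 13}, {7, 10, 12},
   {7, 11, 13}, {9, 10, 12}, {9, 10, 13}, {10, 11, 13}]

/-- The faces of `ballB_12_38` in an order that shows nonevasiveness of the subdivision. -/
def ballB12Faces : List ℕ :=
  [2088, 5632, 5120, 5128, 1032, 256, 8448, 2432, 704, 1096, 10240, 3104, 2308, 10308, 4224,
   1408, 192, 1036, 1056, 9736, 264, 2436, 2304, 10304, 4872, 10372, 8256, 1048, 2056, 24,
   12552, 152, 208, 12544, 1040, 8264, 12296, 10244, 1112, 736, 12288, 11264, 1312, 1104, 2816,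
   4164, 40, 1164, 2048, 544, 4360, 8864, 5640, 1024, 2820, 8736, 12292, 388, 8232, 576, 292,
   1136, 8260, 772, 2560, 3168, 3136, 4160, 2112, 8456, 240, 4868, 288, 1044, 776, 140, 8352,
   2080, 2568, 1156, 8484, 1544, 2176, 1412, 608, 9224, 1120, 8228, 200, 1072, 5248, 88, 2180,
   4288, 9216, 8324, 1152, 3072, 1536, 36, 2824, 4356, 10368, 2052, 384, 28, 2116, 1088, 52,
   4296, 4864, 12548, 176, 1052, 296, 1316, 8712, 1060, 2144, 580, 164, 5256, 672, 11328, 2564,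
   9280, 1076, 4232, 20, 1160, 1280, 9288, 4168, 224, 12, 4352, 640, 260, 1284, 768, 2312, 9728,
   8488, 148, 8480, 156, 1028, 136, 8452, 8832, 8320, 8704, 216, 64, 112, 96, 72, 2656, 68, 80,
   16, 4, 2628, 32, 132, 4100, 8744, 8224, 160, 8192, 12360, 516, 4612, 144, 48, 552, 8200,
   4608, 4104, 8, 2624, 180, 12352, 2600, 128, 520, 2592, 8356, 8196, 512, 4616, 12356, 4096]

/-- The faces of the boundary of `ballB_12_38`. -/
def ballB12BoundaryFaces : List ℕ :=
  [4, 8, 32, 64, 128, 256, 512, 1024, 2048, 4096, 8192, 68, 516, 4100, 40, 264, 2056, 288, 1056,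
   2080, 192, 576, 4160, 384, 640, 1152, 2176, 4224, 8320, 1280, 2304, 1536, 4608, 8704, 3072,
   5120, 9216, 10240, 580, 4164, 4612, 296, 2088, 2312, 1312, 3104, 704, 4288, 1408, 2432, 8832,
   5248, 10368, 5632, 9728, 11264]

/-- The interior faces of `ballB_12_38` in the order in which a collapse removes them. -/
def ballB12InteriorFaces : List ℕ :=
  [8456, 8488, 8448, 12544, 8232, 4352, 4864, 4356, 768, 2816, 2560, 12288, 2564, 2592, 544,
   2624, 12292, 8480, 4868, 608, 12296, 8452, 8736, 776, 2112, 2656, 2820, 12552, 10304, 12548,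
   772, 3168, 2116, 4872, 4360, 2824, 672, 10308, 12356, 2144, 12352, 2628, 3136, 2568, 10244,
   736, 224, 96, 8484, 552, 1120, 4616, 8200, 112, 292, 9736, 1544, 2052, 11328, 8864, 1088,
   2600, 8264, 12360, 8712, 9280, 1316, 2308, 1096, 1060, 1284, 1136, 4104, 8228, 80, 2436, 240,
   4296, 10372, 1104, 2180, 8356, 4232, 1072, 5128, 36, 260, 48, 164, 208, 88, 4168, 200, 176,
   1412, 9224, 5256, 1160, 1156, 1112, 388, 1044, 1048, 1028, 152, 20, 148, 136, 8324, 8196,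
   8260, 8256, 9288, 72, 216, 5640, 520, 8744, 8224, 8352, 160, 180, 52, 16, 144, 24, 1040, 28,
   156, 1052, 1032, 1076, 1164, 1036, 12, 140, 132]

/-- The moves of a collapse of the subdivision of `ballB_12_38`. -/
def ballB12Moves : List (ℕ × ℕ) :=
  [(8488, 256), (0, 0), (0, 0), (0, 0), (0, 0), (0, 0), (0, 0), (0, 0), (0, 0), (0, 0), (0, 0),
   (0, 0), (0, 0), (0, 0), (0, 0), (0, 0), (0, 0), (0, 0), (0, 0), (0, 0), (0, 0), (0, 0),
   (0, 0), (0, 0), (0, 0), (0, 0), (0, 0), (0, 0), (0, 0), (0, 0), (0, 0), (0, 0), (0, 0),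
   (0, 0), (0, 0), (0, 0), (0, 0), (0, 0), (0, 0), (0, 0), (0, 0), (0, 0), (0, 0), (0, 0),
   (0, 0), (0, 0), (0, 0), (0, 0), (0, 0), (0, 0), (0, 0), (0, 0), (0, 0), (0, 0), (0, 0),
   (0, 0), (0, 0), (0, 0), (0, 0), (0, 0), (0, 0), (0, 0), (0, 0), (0, 0), (0, 0), (0, 0),
   (0, 0), (0, 0), (0, 0), (0, 0), (0, 0), (0, 0), (0, 0), (0, 0), (0, 0), (0, 0), (0, 0),
   (0, 0), (0, 0), (0, 0), (0, 0), (0, 0), (0, 0), (0, 0), (0, 0), (0, 0), (0, 0), (0, 0),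
   (0, 0), (0, 0), (0, 0), (0, 0), (0, 0), (0, 0), (0, 0), (0, 0), (0, 0), (0, 0), (0, 0),
   (0, 0), (0, 0), (0, 0), (5640, 4096), (1076, 1028), (0, 0), (0, 0), (0, 0), (136, 128),
   (0, 0), (20, 4), (0, 0), (0, 0), (0, 0), (1036, 1024), (140, 128), (1052, 8), (28, 16),
   (1052, 4), (156, 4), (156, 8), (1036, 8), (5640, 4608), (28, 4), (12, 4), (140, 8),
   (5640, 5120), (1076, 4), (140, 4), (1036, 4), (1164, 4), (5640, 1536), (52, 4), (180, 4),
   (180, 132), (132, 4), (0, 0), (0, 0), (0, 0), (0, 0), (0, 0), (0, 0), (0, 0), (24, 8),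
   (28, 8), (12, 8), (1164, 8), (1032, 8), (0, 0), (0, 0), (0, 0), (0, 0), (0, 0), (0, 0),
   (0, 0), (0, 0), (0, 0), (0, 0), (0, 0), (0, 0), (0, 0), (0, 0), (0, 0), (0, 0), (0, 0),
   (0, 0), (0, 0), (0, 0), (0, 0), (0, 0)]

/-- The facets of `sphereS_13_56`. -/
def sphereFacets : List (Finset ℕ) :=
  ballB12Facets ++ ballB12Triangles.map (insert 1)

/-- The codes of the facets of `ballB_9_18`. -/
def ballB9FacetCodes : List ℕ :=
  [15, 23, 51, 163, 323, 387, 29, 449, 78, 54, 294, 326, 418, 156, 204, 212, 340, 464]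

/-- The codes of the facets of `ballB_12_38`. -/
def ballB12FacetCodes : List ℕ :=
  [156, 1052, 1164, 180, 1076, 8356, 1316, 8484, 2628, 10308, 12356, 1412, 2436, 10372, 2820,
   4868, 12548, 216, 1112, 8488, 2600, 8744, 4296, 9288, 12360, 5256, 2824, 4872, 12552, 5640,
   9736, 240, 1136, 736, 2656, 3168, 8864, 11328]

/-- The codes of the boundary triangles of `ballB_12_38`. -/
def ballB12TriangleCodes : List ℕ :=
  [580, 4164, 4612, 296, 2088, 2312, 1312, 3104, 704, 4288, 1408, 2432, 8832, 5248, 10368, 5632,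
   9728, 11264]

/-- The codes of the facets of `sphereS_13_56`. -/
def sphereFacetCodes : List ℕ :=
  [156, 1052, 1164, 180, 1076, 8356, 1316, 8484, 2628, 10308, 12356, 1412, 2436, 10372, 2820,
   4868, 12548, 216, 1112, 8488, 2600, 8744, 4296, 9288, 12360, 5256, 2824, 4872, 12552, 5640,
   9736, 240, 1136, 736, 2656, 3168, 8864, 11328, 582, 4166, 4614, 298, 2090, 2314, 1314, 3106,
   706, 4290, 1410, 2434, 8834, 5250, 10370, 5634, 9730, 11266]

end Data

/-! ### Verified face lists, and the subdivision of the ball with 38 facets. -/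

section Subdivisions

set_option maxRecDepth 100000

theorem mem_ballB9 (s : Finset ℕ) : s ∈ ballB_9_18.faces ↔ code s ∈ ballB9Faces :=
  mem_ofFacets_iff_code 14 (M := ballB9FacetCodes)
    (by decide +kernel) (by decide +kernel) s

theorem ballB12_eq : ballB_12_38 = ofFacets ballB12Facets := rfl

theorem mem_ballB12 (s : Finset ℕ) : s ∈ ballB_12_38.faces ↔ code s ∈ ballB12Faces :=
  mem_ofFacets_iff_code 14 (M := ballB12FacetCodes)
    (by decide +kernel) (by decide +kernel) s

theorem mem_ballB12' (s : Finset ℕ) :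
    s ∈ ballB_12_38.faces ↔ code s ∈ ballB12InteriorFaces ++ ballB12BoundaryFaces :=
  mem_ofFacets_iff_code 14 (M := ballB12FacetCodes)
    (by decide +kernel) (by decide +kernel) s

theorem mem_ballB12Boundary (s : Finset ℕ) :
    s ∈ (ofFacets ballB12Triangles).faces ↔ code s ∈ ballB12BoundaryFaces :=
  mem_ofFacets_iff_code 14 (M := ballB12TriangleCodes)
    (by decide +kernel) (by decide +kernel) s

/-- The boundary of the cone consists of the tetrahedra of the ball and the cones over its boundary
triangles. The computation checks all 3-dimensional faces of the cone. -/
theorem sphere_eq : sphereS_13_56 = ofFacets sphereFacets := by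
  rw [sphereS_13_56, ballB12_eq, cone_ofFacets (by decide) 1]
  exact boundary_ofFacets (by norm_num) (by decide +kernel) (by decide +kernel)
    (by decide +kernel)

theorem mem_sphere (s : Finset ℕ) : s ∈ sphereS_13_56.faces ↔ code s ∈ sphereFaces := by
  rw [sphere_eq]
  exact mem_ofFacets_iff_code 14 (M := sphereFacetCodes)
    (by decide +kernel) (by decide +kernel) s

theorem ballB9_isPure : ballB_9_18.IsPure 3 :=
  isPure_ofFacets (by decide) (by decide +kernel)

theorem sphere_isPure : sphereS_13_56.IsPure 3 := by
  rw [sphere_eq]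
  exact isPure_ofFacets (by decide) (by decide +kernel)

theorem ballB12_sd_isNonevasive : ballB_12_38.sd.IsNonevasive := by
  rw [sd_eq_cliq mem_ballB12]
  exact isNonevasive_of_orderCheck cmpB_comm cmpB_self 200 _ (by decide +kernel)

theorem ballB12_sd_isLCBall : ballB_12_38.sd.IsLCBall := by
  have hb : (cliq code cmpB ballB12BoundaryFaces).IsPure 2 := by
    rw [← sd_eq_cliq mem_ballB12Boundary]
    exact (isPure_ofFacets (by decide) (by decide +kernel)).sd
  rw [sd_eq_cliq mem_ballB12', IsLCBall, boundary_cliq (by decide +kernel)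
    (fun q => List.mem_append_right _) hb
    (by decide +kernel)]
  -- The opened triangle is the flag of the sets 3, 38, 358 in the boundary triangle 358; the fourth
  -- vertex is the tetrahedron with vertices 3, 5, 8, 13.
  obtain ⟨K, hK, hKf⟩ := exists_collapse_free_triangle (e := code) (r := cmpB) (x := 8)
    (y := 264) (z := 296) (w := 8488) (l := ballB12InteriorFaces ++ ballB12BoundaryFaces)
    cmpB_comm cmpB_self
    (by decide +kernel) (by decide +kernel) (by decide +kernel)
    (isNonevasive_of_check (dropPairs_comm cmpB_comm _) (dropPairs_self cmpB_self _) 200 _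
      (by decide +kernel))
  obtain ⟨D, hD, hDf⟩ := exists_collapse_of_movesCheck (b := ballB12BoundaryFaces) cmpB_comm
    cmpB_self (by decide +kernel) 200 ballB12Moves _ _ (by decide +kernel)
    (by decide +kernel) K hKf
  exact ⟨_, ⟨Finset.insert_nonempty _ _, by decide +kernel, by decide +kernel⟩,
    by decide +kernel, D, hDf, hK.trans hD⟩

end Subdivisions

/-! ### Vertex decompositions of the two subdivisions. -/

section Decompositions

set_option maxRecDepth 100000

theorem ballB9_sd_isVertexDecomposable : ballB_9_18.sd.IsVertexDecomposable := by
  have h := ballB9_isPure.sd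
  rw [sd_eq_cliq mem_ballB9] at h ⊢
  exact isVertexDecomposable_of_solidCheck 200 ballB9LinkOrders _ (by decide +kernel) h

theorem sphere_sd_isVertexDecomposable : sphereS_13_56.sd.IsVertexDecomposable := by
  have h := sphere_isPure.sd
  rw [sd_eq_cliq mem_sphere] at h ⊢
  exact isVertexDecomposable_of_solidCheck 200 sphereLinkOrders _ (by decide +kernel) h

end Decompositions

/-! ### Euler characteristics of links. -/

section Euler

variable {α : Type*} [DecidableEq α]

open Classical in
/-- The sum of `(-1) ^ |t|` over the faces `t` of `K`, including the empty face, that contain `s`;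
the faces are taken from the finite family `U`. -/
noncomputable def eulerAt (U : Finset (Finset α)) (K : PreAbstractSimplicialComplex α)
    (s : Finset α) : ℤ :=
  ∑ t ∈ U with s ⊆ t ∧ (t = ∅ ∨ t ∈ K.faces), (-1) ^ t.card

theorem IsPure.unique {K : PreAbstractSimplicialComplex α} {d d' : ℕ} (h : K.IsPure d)
    (h' : K.IsPure d') : d = d' := by
  have key : ∀ {d d' : ℕ}, K.IsPure d → K.IsPure d' → d ≤ d' := by
    intro d d' h h'
    obtain ⟨s, hs⟩ := h.1
    obtain ⟨F, hF, -, hFc⟩ := h.2 s hs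
    obtain ⟨G, hG, hFG, hGc⟩ := h'.2 F hF
    have := Finset.card_le_card hFG
    omega
  exact le_antisymm (key h h') (key h' h)

/-- Inclusion and exclusion, term by term; the empty face is counted in all four complexes. -/
theorem eulerAt_sup_add_inf (U : Finset (Finset α)) (K L : PreAbstractSimplicialComplex α)
    (s : Finset α) :
    eulerAt U (K ⊔ L) s + eulerAt U (K ⊓ L) s = eulerAt U K s + eulerAt U L s := by
  classical
  simp only [eulerAt, Finset.sum_filter, ← Finset.sum_add_distrib]
  refine Finset.sum_congr rfl fun t _ => ?_
  have hsup : t ∈ (K ⊔ L).faces ↔ t ∈ K.faces ∨ t ∈ L.faces := Iff.rfl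
  have hinf : t ∈ (K ⊓ L).faces ↔ t ∈ K.faces ∧ t ∈ L.faces := Iff.rfl
  rw [hsup, hinf]
  by_cases h1 : s ⊆ t <;> by_cases h2 : t = ∅ <;> by_cases h3 : t ∈ K.faces <;>
    by_cases h4 : t ∈ L.faces <;> simp [h1, h2, h3, h4]

/-- The sum runs over the Boolean interval from `s` to `F`, where alternating sums vanish unless the
interval is a single point. -/
theorem eulerAt_simplex {U : Finset (Finset α)} {K : PreAbstractSimplicialComplex α}
    {F : Finset α} (h0 : ∅ ∈ U) (hU : ∀ t ∈ K.faces, t ∈ U)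
    (hK : K.faces = {s | s.Nonempty ∧ s ⊆ F}) (s : Finset α) :
    eulerAt U K s = if s = F then (-1) ^ F.card else 0 := by
  classical
  have hmem : ∀ t, (t = ∅ ∨ t ∈ K.faces) ↔ t ⊆ F := by
    intro t
    rw [hK]
    rcases t.eq_empty_or_nonempty with rfl | ht
    · simp
    · simp [ht, ht.ne_empty]
  have hfil : U.filter (fun t => s ⊆ t ∧ (t = ∅ ∨ t ∈ K.faces)) =
      F.powerset.filter (s ⊆ ·) := by
    ext t
    rw [Finset.mem_filter, Finset.mem_filter, Finset.mem_powerset, hmem]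
    refine ⟨fun h => ⟨h.2.2, h.2.1⟩, fun h => ⟨?_, h.2, h.1⟩⟩
    rcases (hmem t).2 h.1 with rfl | ht
    exacts [h0, hU t ht]
  rw [eulerAt, hfil]
  by_cases hsF : s ⊆ F
  · have : ∑ t ∈ F.powerset with s ⊆ t, (-1 : ℤ) ^ t.card =
        ∑ u ∈ (F \ s).powerset, (-1) ^ s.card * (-1) ^ u.card := by
      refine Finset.sum_nbij' (· \ s) (s ∪ ·) ?_ ?_ ?_ ?_ ?_
      · intro t ht
        rw [Finset.mem_filter, Finset.mem_powerset] at ht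
        exact Finset.mem_powerset.2 (Finset.sdiff_subset_sdiff ht.1 (le_refl s))
      · intro u hu
        rw [Finset.mem_powerset] at hu
        rw [Finset.mem_filter, Finset.mem_powerset]
        exact ⟨Finset.union_subset hsF (hu.trans Finset.sdiff_subset), Finset.subset_union_left⟩
      · intro t ht
        exact Finset.union_sdiff_of_subset (Finset.mem_filter.1 ht).2
      · intro u hu
        rw [Finset.mem_powerset] at hu
        rw [Finset.union_sdiff_left, Finset.sdiff_eq_self_of_disjoint]
        exact Finset.disjoint_of_subset_left hu Finset.sdiff_disjoint
      · intro t ht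
        rw [← pow_add, add_comm, Finset.card_sdiff_add_card_eq_card (Finset.mem_filter.1 ht).2]
    rw [this, ← Finset.mul_sum, Finset.sum_powerset_neg_one_pow_card]
    by_cases hsF' : s = F
    · simp [hsF']
    · rw [if_neg fun h => hsF' (hsF.antisymm (Finset.sdiff_eq_empty_iff_subset.1 h)),
        if_neg hsF', mul_zero]
  · rw [if_neg fun h => hsF h.subset]
    refine Finset.sum_eq_zero fun t ht => ?_
    rw [Finset.mem_filter, Finset.mem_powerset] at ht
    exact absurd (ht.2.trans ht.1) hsF

/-- Each point contributes `-1`, and for `s = ∅` there is at least one point to compensate the empty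
face. -/
theorem eulerAt_points {U : Finset (Finset α)} {K : PreAbstractSimplicialComplex α}
    (hU : ∀ t ∈ K.faces, t ∈ U) (hK : K.IsPure 0) (s : Finset α) :
    eulerAt U K s ≤ 0 := by
  classical
  have hcard : ∀ t ∈ K.faces, t.card = 1 := by
    intro t ht
    obtain ⟨F, -, htF, hF⟩ := hK.2 t ht
    have h1 := Finset.card_le_card htF
    have h2 := (nonempty_of_mem ht).card_pos
    omega
  by_cases hs : s = ∅
  · obtain ⟨v, hv⟩ := hK.1
    have hv0 : v ≠ ∅ := (nonempty_of_mem hv).ne_empty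
    have hle : ∑ t ∈ U with s ⊆ t ∧ (t = ∅ ∨ t ∈ K.faces), (-1 : ℤ) ^ t.card ≤
        ∑ t ∈ {∅, v}, (-1 : ℤ) ^ t.card := by
      rw [← Finset.sum_filter_add_sum_filter_not _ (fun t => t ∈ ({∅, v} : Finset (Finset α)))]
      have h1 : ∑ t ∈ (U.filter fun t => s ⊆ t ∧ (t = ∅ ∨ t ∈ K.faces)) with
          ¬ t ∈ ({∅, v} : Finset (Finset α)), (-1 : ℤ) ^ t.card ≤ 0 := by
        refine Finset.sum_nonpos fun t ht => ?_
        simp only [Finset.mem_filter, Finset.mem_insert, not_or] at ht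
        rw [hcard t (ht.1.2.2.resolve_left ht.2.1)]
        norm_num
      have h2 : ∑ t ∈ (U.filter fun t => s ⊆ t ∧ (t = ∅ ∨ t ∈ K.faces)) with
          t ∈ ({∅, v} : Finset (Finset α)), (-1 : ℤ) ^ t.card ≤
          ∑ t ∈ {∅, v}, (-1 : ℤ) ^ t.card := by
        rw [Finset.sum_pair hv0.symm, hcard v hv, Finset.card_empty]
        have hvmem : v ∈ (U.filter fun t => s ⊆ t ∧ (t = ∅ ∨ t ∈ K.faces)).filter
            (· ∈ ({∅, v} : Finset (Finset α))) := by
          simp [hU v hv, hs, hv]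
        rw [← Finset.add_sum_erase _ _ hvmem, hcard v hv]
        have h3 : ∑ t ∈ ((U.filter fun t => s ⊆ t ∧ (t = ∅ ∨ t ∈ K.faces)).filter
            (· ∈ ({∅, v} : Finset (Finset α)))).erase v, (-1 : ℤ) ^ t.card ≤
            ∑ t ∈ ({∅} : Finset (Finset α)), (-1 : ℤ) ^ t.card := by
          refine Finset.sum_le_sum_of_subset_of_nonneg (fun t ht => ?_) fun t ht _ => ?_
          · simp only [Finset.mem_erase, Finset.mem_filter, Finset.mem_insert,
              Finset.mem_singleton] at ht ⊢
            tauto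
          · rw [Finset.mem_singleton] at ht
            simp [ht]
        rw [Finset.sum_singleton, Finset.card_empty] at h3
        linarith
      linarith
    rw [Finset.sum_pair hv0.symm, hcard v hv, Finset.card_empty] at hle
    rw [eulerAt]
    linarith
  · refine Finset.sum_nonpos fun t ht => ?_
    rw [Finset.mem_filter] at ht
    rw [hcard t (ht.2.2.resolve_left fun h => hs (Finset.subset_empty.1 (h ▸ ht.2.1)))]
    norm_num

theorem IsSimplex.eulerAt_nonneg {U : Finset (Finset α)} {K : PreAbstractSimplicialComplex α}
    (h0 : ∅ ∈ U) (hU : ∀ t ∈ K.faces, t ∈ U) (hK : K.IsSimplex) {d : ℕ} (hd : K.IsPure d)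
    (s : Finset α) : 0 ≤ (-1) ^ (d + 1) * eulerAt U K s := by
  obtain ⟨F, hF, hKF⟩ := hK
  have hFK : F ∈ K.faces := by
    rw [hKF]
    exact ⟨hF, subset_rfl⟩
  have hcard : F.card = d + 1 := by
    obtain ⟨G, hG, hFG, hGc⟩ := hd.2 F hFK
    rw [hKF] at hG
    rw [← hGc, hFG.antisymm hG.2]
  rw [eulerAt_simplex h0 hU hKF]
  split_ifs
  · rw [hcard, ← mul_pow]
    norm_num
  · simp

/-- The links of shellable complexes have Euler characteristics with the expected sign. -/
theorem IsShellable.eulerAt_nonneg {U : Finset (Finset α)} {K : PreAbstractSimplicialComplex α}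
    (h0 : ∅ ∈ U) (hK : K.IsShellable) : ∀ d, K.IsPure d → (∀ t ∈ K.faces, t ∈ U) → ∀ s,
      0 ≤ (-1) ^ (d + 1) * eulerAt U K s := by
  induction hK with
  | simplex hK => exact fun d hd hU => hK.eulerAt_nonneg h0 hU hd
  | points hK =>
    intro d hd hU s
    rw [hd.unique hK]
    have := eulerAt_points hU hK s
    rw [zero_add, pow_one]
    linarith
  | @union d' C₁ C₂ hp₁ hp₂ hp _ h₂ _ ih₁ ih =>
    intro d hd hU s
    have hd' : d = d' + 1 := hd.unique ⟨hp₁.1.mono Set.subset_union_left, fun t ht => by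
      rcases ht with ht | ht
      · obtain ⟨F, hF, h⟩ := hp₁.2 t ht
        exact ⟨F, Or.inl hF, h⟩
      · obtain ⟨F, hF, h⟩ := hp₂.2 t ht
        exact ⟨F, Or.inr hF, h⟩⟩
    subst hd'
    have h1 := ih₁ _ hp₁ (fun t ht => hU t (Or.inl ht)) s
    have h2 := h₂.eulerAt_nonneg h0 (fun t ht => hU t (Or.inr ht)) hp₂ s
    have h3 := ih _ hp (fun t ht => hU t (Or.inl ht.1)) s
    have h4 := eulerAt_sup_add_inf U C₁ C₂ s
    have h5 : eulerAt U (C₁ ⊔ C₂) s = eulerAt U C₁ s + eulerAt U C₂ s - eulerAt U (C₁ ⊓ C₂) s := by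
      linarith
    -- The intersection has dimension one less, so its sign is opposite and cancels the minus sign
    -- in front of its term.
    rw [h5, mul_sub, mul_add, pow_succ _ (d' + 1)]
    rw [pow_succ _ (d' + 1)] at h1 h2
    linarith

/-- Erasing `v` matches the faces containing `v` with the faces of the link, the empty one included,
and changes the parity. -/
theorem eulerAt_singleton {U : Finset (Finset α)} {K : PreAbstractSimplicialComplex α}
    (h0 : ∅ ∈ U) (hU : ∀ t ∈ K.faces, t ∈ U) {v : α} (hv : {v} ∈ K.faces) :
    eulerAt U K {v} = - eulerAt U (K.link v) ∅ := by
  classical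
  rw [eulerAt, eulerAt, ← Finset.sum_neg_distrib]
  refine Finset.sum_nbij' (·.erase v) (insert v ·) ?_ ?_ ?_ ?_ ?_
  · intro t ht
    rw [Finset.mem_filter, Finset.singleton_subset_iff] at ht
    have htK : t ∈ K.faces := ht.2.2.resolve_left fun h => by simp [h] at ht
    rw [Finset.mem_filter]
    rcases (t.erase v).eq_empty_or_nonempty with h | h
    · exact ⟨h ▸ h0, Finset.empty_subset _, Or.inl h⟩
    · exact ⟨hU _ (mem_of_subset htK (Finset.erase_subset v t) h), Finset.empty_subset _,
        Or.inr ⟨h, Finset.notMem_erase v t, by rwa [Finset.insert_erase ht.2.1]⟩⟩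
  · intro u hu
    rw [Finset.mem_filter] at hu
    have hK : insert v u ∈ K.faces := by
      rcases hu.2.2 with rfl | hu
      exacts [hv, hu.2.2]
    rw [Finset.mem_filter, Finset.singleton_subset_iff]
    exact ⟨hU _ hK, Finset.mem_insert_self v u, Or.inr hK⟩
  · intro t ht
    rw [Finset.mem_filter, Finset.singleton_subset_iff] at ht
    exact Finset.insert_erase ht.2.1
  · intro u hu
    rw [Finset.mem_filter] at hu
    refine Finset.erase_insert ?_
    rcases hu.2.2 with rfl | hu
    exacts [Finset.notMem_empty v, hu.2.1]
  · intro t ht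
    rw [Finset.mem_filter, Finset.singleton_subset_iff] at ht
    rw [← Finset.card_erase_add_one ht.2.1, pow_succ]
    ring

theorem eulerAt_deletion {U : Finset (Finset α)} {K : PreAbstractSimplicialComplex α} (v : α) :
    eulerAt U K ∅ = eulerAt U (K.deletion v) ∅ + eulerAt U K {v} := by
  classical
  simp only [eulerAt, Finset.sum_filter, ← Finset.sum_add_distrib]
  refine Finset.sum_congr rfl fun t _ => ?_
  simp only [deletion, Set.mem_ofPred_eq, Finset.singleton_subset_iff, Finset.empty_subset,
    true_and]
  by_cases h1 : v ∈ t <;> by_cases h2 : t = ∅ <;> by_cases h3 : t ∈ K.faces <;>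
    simp_all

/-- The sum for the complex is the sum for the deletion minus that for the link, and both vanish by
induction; a simplex is the base case. -/
theorem IsNonevasive.eulerAt_eq_zero {U : Finset (Finset α)} {K : PreAbstractSimplicialComplex α}
    (h0 : ∅ ∈ U) (hK : K.IsNonevasive) : (∀ t ∈ K.faces, t ∈ U) → eulerAt U K ∅ = 0 := by
  induction hK with
  | simplex hK =>
    intro hU
    obtain ⟨F, hF, hK⟩ := hK
    rw [eulerAt_simplex h0 hU hK, if_neg hF.ne_empty.symm]
  | step _ hv _ _ ih1 ih2 =>
    intro hU
    rw [eulerAt_deletion, ih1 fun t ht => hU t ht.1, eulerAt_singleton h0 hU hv, ih2]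
    · simp
    · exact fun t ht => hU t (mem_of_subset ht.2.2 (Finset.subset_insert _ _) ht.1)

end Euler

/-! ### Computing alternating sums by counting codes. -/

section EulerCount

/-- The number of elements of a coded set is even. -/
def evenB (n m : ℕ) : Bool := Nat.beq (Nat.mod ((List.range n).countP (Nat.testBit m)) 2) 0

theorem card_code_symm {n m : ℕ} (hm : m < 2 ^ n) :
    (code.symm m).card = (List.range n).countP (Nat.testBit m) := by
  rw [List.countP_eq_length_filter, ← List.toFinset_card_of_nodup
    ((List.nodup_range).filter _)]
  congr 1
  ext i
  rw [mem_iff_testBit_code, code.apply_symm_apply, List.mem_toFinset, List.mem_filter,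
    List.mem_range]
  refine ⟨fun h => ⟨?_, h⟩, fun h => h.2⟩
  by_contra hi
  rw [Nat.testBit_lt_two_pow (hm.trans_le (Nat.pow_le_pow_right (by norm_num) (not_lt.1 hi)))]
    at h
  exact absurd h (by simp)

theorem evenB_eq_true {n m : ℕ} (hm : m < 2 ^ n) :
    evenB n m = true ↔ Even (code.symm m).card := by
  rw [evenB, Nat.beq_eq, card_code_symm hm, Nat.even_iff]
  rfl

/-- The coded family of the sets in `l` and the empty set. -/
def family (l : List ℕ) : Finset (Finset ℕ) := ((0 :: l).map code.symm).toFinset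

/-- The Boolean test `P` selects the nonempty faces above `s`. The empty face, which contributes
only for `s = ∅`, is accounted for separately. -/
theorem eulerAt_family {n : ℕ} {l : List ℕ} (hl : (0 :: l).Nodup) (hn : ∀ m ∈ l, m < 2 ^ n)
    {K : PreAbstractSimplicialComplex ℕ} {s : Finset ℕ} {P : ℕ → Bool}
    (hP : ∀ m ∈ l, P m = true ↔ s ⊆ code.symm m ∧ code.symm m ∈ K.faces) :
    eulerAt (family l) K s = (if s = ∅ then 1 else 0) +
      ((l.filter (evenB n)).filter P).length -
      ((l.filter fun m => !evenB n m).filter P).length := by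
  classical
  have h0 : code.symm 0 = ∅ := by
    rw [Equiv.symm_apply_eq]
    simp [code_apply]
  rw [eulerAt, Finset.sum_filter, family, List.sum_toFinset _ (hl.map code.symm.injective),
    List.map_map, List.map_cons, List.sum_cons, add_sub_assoc]
  congr 1
  · simp only [Function.comp, h0, Finset.subset_empty, true_or, and_true, Finset.card_empty,
      pow_zero]
  · have hl0 : 0 ∉ l := (List.nodup_cons.1 hl).1
    clear hl
    induction l with
    | nil => simp
    | cons m l ih =>
      rw [List.map_cons, List.sum_cons, ih (fun q hq => hn q (List.mem_cons_of_mem _ hq))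
        (fun q hq => hP q (List.mem_cons_of_mem _ hq)) fun h => hl0 (List.mem_cons_of_mem _ h)]
      have h1 := hP m List.mem_cons_self
      have h2 := evenB_eq_true (hn m List.mem_cons_self)
      have h3 : (s ⊆ code.symm m ∧ (code.symm m = ∅ ∨ code.symm m ∈ K.faces)) ↔ P m = true := by
        have hm : code.symm m ≠ ∅ := by
          rw [← h0, code.symm.injective.ne_iff]
          rintro rfl
          exact hl0 List.mem_cons_self
        rw [h1, or_iff_right hm]
      simp only [Function.comp, h3, List.filter_cons]
      cases he : evenB n m <;> cases hp : P m
      · simp [hp]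
      · have : Odd (code.symm m).card := by
          rw [← Nat.not_even_iff_odd, ← h2, he]
          simp
        simp [hp, this.neg_one_pow]
        ring
      · simp [hp]
      · simp [hp, (h2.1 he).neg_one_pow]
        ring

end EulerCount

/-! ### The ball with 18 facets: no facet can be last in a shelling. -/

section NotShellable

theorem mem_family {l : List ℕ} {s : Finset ℕ} : s ∈ family l ↔ code s = 0 ∨ code s ∈ l := by
  rw [family, List.mem_toFinset, List.mem_map]
  constructor
  · rintro ⟨m, hm, rfl⟩
    rwa [code.apply_symm_apply, ← List.mem_cons]
  · intro h
    exact ⟨code s, List.mem_cons.2 h, code.symm_apply_apply s⟩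

theorem code_empty : code ∅ = 0 := by simp [code_apply]

theorem code_singleton (v : ℕ) : code {v} = 2 ^ v := by simp [code_apply]

theorem mem_ofFacets_of_mem {α : Type*} {L : List (Finset α)} {d : ℕ}
    (hL : ∀ F ∈ L, F.card = d + 1) {F : Finset α} (hF : F ∈ L) : F ∈ (ofFacets L).faces :=
  ⟨Finset.card_pos.1 (by rw [hL F hF]; omega), F, hF, subset_rfl⟩

theorem mem_of_mem_ofFacets {α : Type*} {L : List (Finset α)} {d : ℕ}
    (hL : ∀ F ∈ L, F.card = d + 1) {F : Finset α} (hF : F ∈ (ofFacets L).faces)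
    (hc : F.card = d + 1) : F ∈ L := by
  obtain ⟨-, G, hG, hFG⟩ := hF
  rwa [Finset.eq_of_subset_of_card_le hFG (by rw [hL G hG, hc])]

theorem not_isSimplex_ofFacets {α : Type*} {L : List (Finset α)} {d : ℕ}
    (hL : ∀ F ∈ L, F.card = d + 1) {F G : Finset α} (hF : F ∈ L) (hG : G ∈ L) (hFG : F ≠ G) :
    ¬ (ofFacets L).IsSimplex := by
  rintro ⟨H, hH, hK⟩
  have hmem : H ∈ (ofFacets L).faces := by
    rw [hK]
    exact ⟨hH, subset_rfl⟩
  obtain ⟨-, I, hI, hHI⟩ := hmem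
  have key : ∀ F ∈ L, F = I := by
    intro F hF
    have h := mem_ofFacets_of_mem hL hF
    rw [hK] at h
    exact Finset.eq_of_subset_of_card_le (h.2.trans hHI) (by rw [hL F hF, hL I hI])
  exact hFG ((key F hF).trans (key G hG).symm)

/-- The intersection has smaller dimension, so `G` is not a face of `C₁`. Purity then forces `C₁` to
be generated by all the other facets, so the last facet of a shelling determines the rest. -/
theorem eq_ofFacets_of_sup_eq {α : Type*} [DecidableEq α] {L : List (Finset α)} {d : ℕ}
    (hL : ∀ F ∈ L, F.card = d + 1 + 1) {C₁ C₂ : PreAbstractSimplicialComplex α} {G : Finset α}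
    (hC : C₁ ⊔ C₂ = ofFacets L) (h1 : C₁.IsPure (d + 1)) (h : (C₁ ⊓ C₂).IsPure d)
    (hG : C₂.faces = {s | s.Nonempty ∧ s ⊆ G}) (hGL : G ∈ L) :
    C₁ = ofFacets (L.filter (· ≠ G)) := by
  have hGc := hL G hGL
  have hG0 : G.Nonempty := Finset.card_pos.1 (by omega)
  have hG2 : G ∈ C₂.faces := by
    rw [hG]
    exact ⟨hG0, subset_rfl⟩
  have hG1 : G ∉ C₁.faces := by
    intro hG1
    obtain ⟨H, -, hGH, hH⟩ := h.2 G ⟨hG1, hG2⟩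
    have := Finset.card_le_card hGH
    omega
  apply PreAbstractSimplicialComplex.ext
  ext s
  constructor
  · intro hs
    obtain ⟨F, hF, hsF, hFc⟩ := h1.2 s hs
    have hFL : F ∈ L := mem_of_mem_ofFacets hL (hC ▸ Or.inl hF) hFc
    refine ⟨nonempty_of_mem hs, F, List.mem_filter.2 ⟨hFL, ?_⟩, hsF⟩
    rw [decide_eq_true_eq]
    rintro rfl
    exact hG1 hF
  · rintro ⟨hs, F, hF, hsF⟩
    rw [List.mem_filter, decide_eq_true_eq] at hF
    have hFK : F ∈ (C₁ ⊔ C₂).faces := hC ▸ mem_ofFacets_of_mem hL hF.1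
    rcases hFK with h | h
    · exact mem_of_subset h hsF hs
    · rw [hG] at h
      exact absurd (Finset.eq_of_subset_of_card_le h.2 (by rw [hGc, hL F hF.1])) hF.2

/-- Tests that each complex obtained by removing one of the facets `M` has a link whose Euler
characteristic has the wrong sign; `l` lists all faces. -/
def facetRemovalCheck (n : ℕ) (M l : List ℕ) : Bool :=
  filterK (evenB n) l fun le => filterK (fun m => !evenB n m) l fun lo => M.all fun g =>
    filterK (fun F => !Nat.beq F g) M fun M' => (0 :: (List.range n).map (2 ^ ·)).any fun s =>
      filterK (fun m => subB s m && M'.any (subB m)) le fun pe =>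
        filterK (fun m => subB s m && M'.any (subB m)) lo fun po =>
          Nat.blt ((if s = 0 then 1 else 0) + pe.length) po.length

/-- In the last step of a shelling some facet `G` is added to a shellable 3-complex, whose
alternating sums are all nonnegative. For each candidate `G` the test exhibits a negative sum. -/
theorem not_isShellable_of_facetRemovalCheck {L : List (Finset ℕ)} {M l : List ℕ} {n : ℕ}
    (hL : ∀ F ∈ L, F.card = 4) (hM : L.map code = M)
    (hl : ∀ s, s ∈ (ofFacets L).faces ↔ code s ∈ l) (hnd : (0 :: l).Nodup)
    (hn : ∀ m ∈ l, m < 2 ^ n) {F F' : Finset ℕ} (hF : F ∈ L) (hF' : F' ∈ L) (hFF : F ≠ F')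
    (h : facetRemovalCheck n M l = true) : ¬ (ofFacets L).IsShellable := by
  intro hs
  have hpure : (ofFacets L).IsPure 3 := isPure_ofFacets (by rintro rfl; simp at hF) hL
  generalize hK : ofFacets L = K at hs
  cases hs with
  | simplex hs => exact not_isSimplex_ofFacets hL hF hF' hFF (hK ▸ hs)
  | points hs => exact absurd (hpure.unique (hK ▸ hs)) (by norm_num)
  | @union d C₁ C₂ hp₁ hp₂ hp h₁ h₂ _ =>
    have hd : d = 2 := by
      obtain ⟨s, hs⟩ := hp₁.1
      obtain ⟨H, hH, -, hHc⟩ := hp₁.2 s hs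
      obtain ⟨I, hI, hHI, hIc⟩ := hpure.2 H (hK ▸ Or.inl hH)
      have := Finset.card_le_card hHI
      have hI' : I ∈ (C₁ ⊔ C₂).faces := hK ▸ hI
      rcases hI' with hI' | hI'
      · obtain ⟨J, -, hIJ, hJ⟩ := hp₁.2 I hI'
        have := Finset.card_le_card hIJ
        omega
      · obtain ⟨J, -, hIJ, hJ⟩ := hp₂.2 I hI'
        have := Finset.card_le_card hIJ
        omega
    subst hd
    obtain ⟨G, hG0, hG⟩ := h₂
    have hG2 : G ∈ C₂.faces := by
      rw [hG]
      exact ⟨hG0, subset_rfl⟩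
    have hGL : G ∈ L := by
      obtain ⟨H, hH, hGH, hHc⟩ := hp₂.2 G hG2
      rw [hG] at hH
      obtain rfl := hGH.antisymm hH.2
      exact mem_of_mem_ofFacets (d := 3) hL (hK ▸ Or.inr hG2) hHc
    have hC := eq_ofFacets_of_sup_eq (d := 2) hL hK.symm hp₁ hp hG hGL
    simp only [facetRemovalCheck, filterK_eq, List.all_eq_true, List.any_eq_true] at h
    obtain ⟨a, -, ha⟩ := h (code G) (hM ▸ List.mem_map_of_mem hGL)
    have h0 : (∅ : Finset ℕ) ∈ family l := mem_family.2 (Or.inl code_empty)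
    have hpos := h₁.eulerAt_nonneg h0 3 hp₁ (fun t ht => mem_family.2 (Or.inr
      ((hl t).1 (hK ▸ Or.inl ht)))) (code.symm a)
    have hl0 : ∀ m ∈ l, (code.symm m).Nonempty := fun m hm =>
      nonempty_of_mem ((hl (code.symm m)).2 (by rwa [code.apply_symm_apply]))
    rw [eulerAt_family (P := fun m => subB a m &&
      (M.filter fun F => !Nat.beq F (code G)).any (subB m)) hnd hn] at hpos
    -- The strict comparison unfolds to a non-strict one with a successor on the left.
    · have hb : Nat.ble _ _ = true := ha
      rw [Nat.ble_eq] at hb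
      have ha0 : code.symm a = ∅ ↔ a = 0 := by
        rw [Equiv.symm_apply_eq, code_empty]
      simp only [ha0] at hpos
      split_ifs at hpos hb <;> omega
    · intro m hm
      simp only [Bool.and_eq_true, subB_eq_true, List.any_eq_true, List.mem_filter,
        Bool.not_eq_true', beq_false_iff, ← hM, List.mem_map, hC, ofFacets, Set.mem_ofPred_eq]
      refine and_congr_right fun _ => ⟨?_, ?_⟩
      · rintro ⟨_, ⟨⟨F, hF, rfl⟩, hFG⟩, hmF⟩
        rw [code.symm_apply_apply] at hmF
        exact ⟨hl0 m hm, F, ⟨hF, by simpa using fun h => hFG (congrArg code h)⟩, hmF⟩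
      · rintro ⟨-, F, ⟨hF, hFG⟩, hmF⟩
        rw [decide_eq_true_eq] at hFG
        exact ⟨code F, ⟨⟨F, hF, rfl⟩, fun h => hFG (code.injective h)⟩,
          by rwa [code.symm_apply_apply]⟩

end NotShellable

/-! ### Evasiveness by closed families of induced subcomplexes. -/

section Evasive

/-- The induced subcomplex on the vertex set coded by `W` of the complex with the coded faces
`l`. -/
def inducedFaces (l : List ℕ) (W : ℕ) : Set (Finset ℕ) := {s | code s ∈ l ∧ subB (code s) W}

/-- Tests that removing vertices with acyclic links from the induced subcomplexes on members of
`R` leads to members of `R`, and that these are not simplices. -/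
def evasiveCheck (n : ℕ) (R l : List ℕ) : Bool :=
  filterK (evenB n) l fun le => filterK (fun m => !evenB n m) l fun lo => R.all fun W =>
    l.all (fun m => !subB W m) && (List.range n).all fun i =>
      (!Nat.testBit W i || l.any (Nat.beq (2 ^ i))) &&
      (!Nat.testBit W i || R.any (Nat.beq (W - 2 ^ i)) ||
        filterK (fun m => subB (2 ^ i) m && subB m W) le fun pe =>
          filterK (fun m => subB (2 ^ i) m && subB m W) lo fun po =>
            !Nat.beq pe.length po.length)

/-- Induction on a presumed proof of nonevasiveness. It cannot start, as no set in `R` spans a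
simplex. It cannot proceed either: the link of the removed vertex has vanishing alternating sum, so
the test says that the deletion is again induced on a member of `R`. -/
theorem not_faces_eq_inducedFaces {K : PreAbstractSimplicialComplex ℕ} {n : ℕ} {R l : List ℕ}
    (hnd : (0 :: l).Nodup) (hn : ∀ m ∈ l, m < 2 ^ n) (hRn : ∀ W ∈ R, W < 2 ^ n)
    (h : evasiveCheck n R l = true) (hK : K.IsNonevasive) :
    ∀ W ∈ R, K.faces ≠ inducedFaces l W := by
  simp only [evasiveCheck, filterK_eq, List.all_eq_true, Bool.and_eq_true, Bool.or_eq_true,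
    Bool.not_eq_true', List.any_eq_true, Nat.beq_eq, List.mem_range, exists_eq_right'] at h
  have hbit : ∀ W ∈ R, ∀ i ∈ code.symm W, i < n ∧ W.testBit i = true := by
    intro W hW i hi
    rw [mem_iff_testBit_code, code.apply_symm_apply] at hi
    refine ⟨?_, hi⟩
    by_contra hin
    rw [Nat.testBit_lt_two_pow ((hRn W hW).trans_le
      (Nat.pow_le_pow_right (by norm_num) (not_lt.1 hin)))] at hi
    exact absurd hi (by simp)
  induction hK with
  | @simplex K hK =>
    rintro W hW hKW
    obtain ⟨F, hF, hKF⟩ := hK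
    have hFK : F ∈ K.faces := by
      rw [hKF]
      exact ⟨hF, subset_rfl⟩
    have hWF : code.symm W ⊆ F := by
      intro i hi
      obtain ⟨hin, hWi⟩ := hbit W hW i hi
      have h1 := ((h W hW).2 i hin).1.resolve_left (by simp [hWi])
      have h2 : ({i} : Finset ℕ) ∈ K.faces := by
        rw [hKW]
        refine ⟨by rwa [code_singleton], ?_⟩
        rw [subB_eq_true, code.symm_apply_apply]
        exact Finset.singleton_subset_iff.2 hi
      rw [hKF] at h2
      exact Finset.singleton_subset_iff.1 h2.2
    rw [hKW] at hFK
    have := (h W hW).1 _ hFK.1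
    rw [← Bool.not_eq_true, subB_eq_true, code.symm_apply_apply] at this
    exact this hWF
  | @step K v _ hv _ hlink ih1 _ =>
    intro W hW hKW
    have h0 : (∅ : Finset ℕ) ∈ family l := mem_family.2 (Or.inl code_empty)
    have hU : ∀ t ∈ K.faces, t ∈ family l := by
      intro t ht
      rw [hKW] at ht
      exact mem_family.2 (Or.inr ht.1)
    have hvW : v ∈ code.symm W := by
      rw [hKW] at hv
      have := hv.2
      rwa [subB_eq_true, code.symm_apply_apply, Finset.singleton_subset_iff] at this
    obtain ⟨hvn, hWv⟩ := hbit W hW v hvW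
    rcases ((h W hW).2 v hvn).2 with (h1 | h1) | h1
    · simp [hWv] at h1
    · refine ih1 _ h1 ?_
      have hWe : code.symm (W - 2 ^ v) = (code.symm W).erase v := by
        rw [Equiv.symm_apply_eq]
        have : code (code.symm W) = 2 ^ v + code ((code.symm W).erase v) := by
          rw [code_apply, code_apply, Finset.add_sum_erase _ _ hvW]
        rw [code.apply_symm_apply] at this
        omega
      ext s
      simp only [deletion, hKW, inducedFaces, Set.mem_ofPred_eq, subB_eq_true,
        code.symm_apply_apply, hWe, Finset.subset_erase, and_assoc]
    -- In this last alternative the counts of even and odd faces at `v` differ, although the link of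
    -- `v` is nonevasive.
    · have h2 : eulerAt (family l) K {v} = 0 := by
        rw [eulerAt_singleton h0 hU hv, hlink.eulerAt_eq_zero h0, neg_zero]
        exact fun t ht => hU t (mem_of_subset ht.2.2 (Finset.subset_insert _ _) ht.1)
      rw [eulerAt_family (P := fun m => subB (2 ^ v) m && subB m W) hnd hn,
        if_neg (Finset.singleton_ne_empty v)] at h2
      · rw [beq_false_iff] at h1
        omega
      · intro m hm
        rw [hKW, Bool.and_eq_true, inducedFaces, Set.mem_ofPred_eq, code.apply_symm_apply,
          ← code_singleton, subB_eq_true, code.symm_apply_apply]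
        tauto

/-- A family of coded vertex sets that contains all those of the induced subcomplexes that can arise
from `ballB_12_38` by deleting vertices with acyclic links. -/
def ballB12Residues : List ℕ :=
  [16380, 16376, 16372, 16360, 16356, 16348, 16340, 16332, 16316, 16312, 16300, 16252, 16236,
   16188, 16172, 16124, 16116, 16100, 16092, 16084, 16076, 16060, 16044, 15996, 15980, 15932,
   15916, 15868, 15864, 15848, 15804, 15800, 15788, 15740, 15724, 15676, 15660, 15356, 15340,
   15324, 15308, 15228, 15100, 15084, 15068, 15052, 14972, 14844, 14828, 14716, 14332, 14324,
   14308, 14300, 14292, 14284, 14204, 14188, 14076, 14068, 14052, 14044, 14036, 14028, 13948,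
   13932, 13308, 13292, 13276, 13260, 13180, 13052, 13036, 13020, 13004, 12924, 12284, 12280,
   12264, 12252, 12236, 12220, 12216, 12204, 12156, 12140, 12092, 12076, 11772, 11768, 11752,
   11708, 11704, 11692, 11644, 11628, 11580, 11564, 11260, 11244, 11228, 11212, 11132, 10748,
   10732, 10620, 10236, 10204, 10188, 10108, 10092, 9212, 9196, 9180, 9164, 9084, 8188, 8060,
   8044, 7676, 7548, 7532, 7164, 7148, 7036, 6652, 6636, 6524, 6140, 6012, 5996, 5116, 5100,
   4988]

end Evasive

/-! ### The two Euler characteristic obstructions evaluated. -/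

section

set_option maxRecDepth 100000

theorem ballB9_not_isShellable : ¬ ballB_9_18.IsShellable :=
  not_isShellable_of_facetRemovalCheck (n := 9) (M := ballB9FacetCodes) (by decide)
    (by decide +kernel) mem_ballB9 (by decide +kernel) (by decide +kernel)
    (F := {0, 1, 2, 3}) (F' := {0, 1, 2, 4}) (by decide) (by decide) (by decide)
    (by decide +kernel)

/-- The code `16380 = 2 ^ 14 - 4` is that of the full vertex set, from 2 to 13. -/
theorem ballB12_isEvasive : ballB_12_38.IsEvasive := fun h =>
  not_faces_eq_inducedFaces (n := 14) (R := ballB12Residues) (l := ballB12Faces)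
    (by decide +kernel) (by decide +kernel) (by decide +kernel) (by decide +kernel) h 16380
    (by decide +kernel) <| by
      ext s
      rw [mem_ballB12, inducedFaces, Set.mem_ofPred_eq, iff_self_and]
      exact (show ∀ m ∈ ballB12Faces, subB m 16380 = true by decide +kernel) _

end

/-! ### Sections of branched coverings over constructible complexes. -/

section Constructible

variable {α : Type*} [DecidableEq α]

/-- Two facets of a pure `d`-complex that contain `s` and have `d` vertices in common. -/
def StarStep (K : PreAbstractSimplicialComplex α) (d : ℕ) (s A B : Finset α) : Prop :=
  (A ∈ K.faces ∧ A.card = d + 1 ∧ s ⊆ A) ∧ (B ∈ K.faces ∧ B.card = d + 1 ∧ s ⊆ B) ∧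
    (A ∩ B).card = d

theorem StarStep.mono {K L : PreAbstractSimplicialComplex α} {d : ℕ} {s A B : Finset α}
    (h : StarStep K d s A B) (hKL : K ≤ L) : StarStep L d s A B :=
  ⟨⟨hKL h.1.1, h.1.2⟩, ⟨hKL h.2.1.1, h.2.1.2⟩, h.2.2⟩

theorem card_inter_eq {d : ℕ} {t A B : Finset α} (hA : A.card = d + 1) (hB : B.card = d + 1)
    (ht : t.card = d) (htA : t ⊆ A) (htB : t ⊆ B) (hAB : A ≠ B) : (A ∩ B).card = d := by
  have h1 := Finset.card_le_card (Finset.subset_inter htA htB)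
  have h2 : (A ∩ B).card < d + 1 := by
    rw [← hA]
    refine Finset.card_lt_card (Finset.inter_subset_left.ssubset_of_ne fun h => hAB ?_)
    exact Finset.eq_of_subset_of_card_le (Finset.inter_eq_left.1 h) (by rw [hA, hB])
  omega

theorem IsPure.card_le {K : PreAbstractSimplicialComplex α} {d : ℕ} (hK : K.IsPure d)
    {s : Finset α} (hs : s ∈ K.faces) : s.card ≤ d + 1 := by
  obtain ⟨F, -, hsF, hF⟩ := hK.2 s hs
  exact hF ▸ Finset.card_le_card hsF

theorem IsPure.sup {K L : PreAbstractSimplicialComplex α} {d : ℕ} (hK : K.IsPure d)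
    (hL : L.IsPure d) : (K ⊔ L).IsPure d := by
  refine ⟨hK.1.mono Set.subset_union_left, fun t ht => ?_⟩
  rcases ht with ht | ht
  · obtain ⟨F, hF, h⟩ := hK.2 t ht
    exact ⟨F, Or.inl hF, h⟩
  · obtain ⟨F, hF, h⟩ := hL.2 t ht
    exact ⟨F, Or.inr hF, h⟩

theorem IsSimplex.eq_of_card {K : PreAbstractSimplicialComplex α} {d : ℕ} (hK : K.IsSimplex)
    (hd : K.IsPure d) {A B : Finset α} (hA : A ∈ K.faces) (hAc : A.card = d + 1)
    (hB : B ∈ K.faces) (hBc : B.card = d + 1) : A = B := by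
  obtain ⟨F, hF, hKF⟩ := hK
  have hFc : F.card ≤ d + 1 := hd.card_le (by
    rw [hKF]
    exact ⟨hF, subset_rfl⟩)
  rw [hKF] at hA hB
  rw [Finset.eq_of_subset_of_card_le hA.2 (by omega),
    Finset.eq_of_subset_of_card_le hB.2 (by omega)]

/-- Stars in constructible complexes are strongly connected. If `s` has facets above it in both
parts, then purity of the intersection gives a common ridge through `s`, where one passes from one
part to the other. -/
theorem IsConstructible.starConnected {K : PreAbstractSimplicialComplex α}
    (hK : K.IsConstructible) : ∀ d, K.IsPure d → ∀ s A B, A ∈ K.faces → A.card = d + 1 → s ⊆ A →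
      B ∈ K.faces → B.card = d + 1 → s ⊆ B → Relation.ReflTransGen (StarStep K d s) A B := by
  induction hK with
  | simplex hK =>
    intro d hd s A B hA hAc _ hB hBc _
    rw [hK.eq_of_card hd hA hAc hB hBc]
  | points hK =>
    intro d hd s A B hA hAc hsA hB hBc hsB
    obtain rfl := hd.unique hK
    by_cases hAB : A = B
    · rw [hAB]
    · exact Relation.ReflTransGen.single ⟨⟨hA, hAc, hsA⟩, ⟨hB, hBc, hsB⟩,
        card_inter_eq (t := ∅) hAc hBc rfl (Finset.empty_subset _) (Finset.empty_subset _) hAB⟩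
  | @union d' C₁ C₂ hp₁ hp₂ hp _ _ _ ih₁ ih₂ _ =>
    intro d hd s
    obtain rfl : d = d' + 1 := hd.unique (hp₁.sup hp₂)
    have mono₁ : ∀ A B, Relation.ReflTransGen (StarStep C₁ (d' + 1) s) A B →
        Relation.ReflTransGen (StarStep (C₁ ⊔ C₂) (d' + 1) s) A B := fun A B =>
      Relation.ReflTransGen.mono (fun _ _ h => h.mono le_sup_left) A B
    have mono₂ : ∀ A B, Relation.ReflTransGen (StarStep C₂ (d' + 1) s) A B →
        Relation.ReflTransGen (StarStep (C₁ ⊔ C₂) (d' + 1) s) A B := fun A B =>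
      Relation.ReflTransGen.mono (fun _ _ h => h.mono le_sup_right) A B
    have mixed : ∀ A ∈ C₁.faces, A.card = d' + 1 + 1 → s ⊆ A → ∀ B ∈ C₂.faces,
        B.card = d' + 1 + 1 → s ⊆ B →
          Relation.ReflTransGen (StarStep (C₁ ⊔ C₂) (d' + 1) s) A B ∧
          Relation.ReflTransGen (StarStep (C₁ ⊔ C₂) (d' + 1) s) B A := by
      intro A hA hAc hsA B hB hBc hsB
      obtain ⟨t, ht, hst, htc⟩ : ∃ t ∈ (C₁ ⊓ C₂).faces, s ⊆ t ∧ t.card = d' + 1 := by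
        -- The empty set is not a face, so for it any ridge in the intersection is taken.
        rcases s.eq_empty_or_nonempty with rfl | hs
        · obtain ⟨u, hu⟩ := hp.1
          obtain ⟨t, ht, -, htc⟩ := hp.2 u hu
          exact ⟨t, ht, Finset.empty_subset t, htc⟩
        · exact hp.2 s ⟨mem_of_subset hA hsA hs, mem_of_subset hB hsB hs⟩
      obtain ⟨A', hA', htA', hAc'⟩ := hp₁.2 t ht.1
      obtain ⟨B', hB', htB', hBc'⟩ := hp₂.2 t ht.2
      have hm : Relation.ReflTransGen (StarStep (C₁ ⊔ C₂) (d' + 1) s) A' B' ∧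
          Relation.ReflTransGen (StarStep (C₁ ⊔ C₂) (d' + 1) s) B' A' := by
        by_cases h : A' = B'
        · rw [h]
          exact ⟨.refl, .refl⟩
        · have hc := card_inter_eq hAc' hBc' htc htA' htB' h
          exact ⟨.single ⟨⟨Or.inl hA', hAc', hst.trans htA'⟩, ⟨Or.inr hB', hBc', hst.trans htB'⟩,
            hc⟩, .single ⟨⟨Or.inr hB', hBc', hst.trans htB'⟩, ⟨Or.inl hA', hAc', hst.trans htA'⟩,
            by rwa [Finset.inter_comm]⟩⟩
      exact ⟨(mono₁ _ _ (ih₁ _ hp₁ s A A' hA hAc hsA hA' hAc' (hst.trans htA'))).trans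
        (hm.1.trans (mono₂ _ _ (ih₂ _ hp₂ s B' B hB' hBc' (hst.trans htB') hB hBc hsB))),
        (mono₂ _ _ (ih₂ _ hp₂ s B B' hB hBc hsB hB' hBc' (hst.trans htB'))).trans
        (hm.2.trans (mono₁ _ _ (ih₁ _ hp₁ s A' A hA' hAc' (hst.trans htA') hA hAc hsA)))⟩
    intro A B hA hAc hsA hB hBc hsB
    rcases hA with hA | hA <;> rcases hB with hB | hB
    · exact mono₁ _ _ (ih₁ _ hp₁ s A B hA hAc hsA hB hBc hsB)
    · exact (mixed A hA hAc hsA B hB hBc hsB).1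
    · exact (mixed B hB hBc hsB A hA hAc hsA).2
    · exact mono₂ _ _ (ih₂ _ hp₂ s A B hA hAc hsA hB hBc hsB)

/-- The tetrahedra of `K` that contain `s`. -/
def tetrahedra (K : PreAbstractSimplicialComplex α) (s : Finset α) : Set (Finset α) :=
  {A | A ∈ K.faces ∧ A.card = 4 ∧ s ⊆ A}

/-- The assignment `x` is carried to itself by the transport `τ` between any two neighbouring
tetrahedra in `S`. -/
def IsParallel {X : Type*} (τ : Finset α → Finset α → X → X) (x : Finset α → X)
    (S : Set (Finset α)) : Prop :=
  ∀ A ∈ S, ∀ B ∈ S, (A ∩ B).card = 3 → τ A B (x A) = x B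

theorem IsParallel.mono {X : Type*} {τ : Finset α → Finset α → X → X} {x : Finset α → X}
    {S S' : Set (Finset α)} (h : IsParallel τ x S) (hS : S' ⊆ S) : IsParallel τ x S' :=
  fun A hA B hB => h A (hS hA) B (hS hB)

/-- A covering of a `3`-dimensional complex with fibre `X`, branched over a set of edges any two of
which meet. It is described by a transport between the fibres over neighbouring tetrahedra, with
trivial holonomy around each edge outside the branching set, and a choice of points in the fibres
that is parallel near the vertices of the branching set. -/
structure BranchedCover (K : PreAbstractSimplicialComplex α) (X : Type*) where
  /-- the branching edges -/
  branch : Set (Finset α)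
  /-- the transport between fibres -/
  transport : Finset α → Finset α → X → X
  /-- the chosen points in the fibres near the branching set -/
  basePoint : Finset α → X
  transport_transport : ∀ A ∈ K.tetrahedra ∅, ∀ B ∈ K.tetrahedra ∅, (A ∩ B).card = 3 →
    ∀ x, transport B A (transport A B x) = x
  exists_isParallel : ∀ e, e.card = 2 → e ∉ branch → ∀ A ∈ K.tetrahedra e, ∀ c, ∃ w,
    w A = c ∧ IsParallel transport w (K.tetrahedra e)
  basePoint_isParallel : ∀ e ∈ branch, ∀ e' ∈ branch, ∃ v, v ∈ e ∧ v ∈ e' ∧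
    IsParallel transport basePoint (K.tetrahedra {v})

namespace BranchedCover

variable {K : PreAbstractSimplicialComplex α} {X : Type*} (M : BranchedCover K X)

/-- A parallel assignment on the tetrahedra of `C` that takes the chosen values at branching
edges. -/
def IsGood (C : PreAbstractSimplicialComplex α) (x : Finset α → X) : Prop :=
  IsParallel M.transport x (C.tetrahedra ∅) ∧
    ∀ e ∈ M.branch, ∀ A ∈ C.tetrahedra e, x A = M.basePoint A

theorem tetrahedra_anti {C : PreAbstractSimplicialComplex α} {s t : Finset α} (h : s ⊆ t) :
    C.tetrahedra t ⊆ C.tetrahedra s := fun _ hA => ⟨hA.1, hA.2.1, h.trans hA.2.2⟩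

theorem tetrahedra_mono {C C' : PreAbstractSimplicialComplex α} (s : Finset α) (h : C ≤ C') :
    C.tetrahedra s ⊆ C'.tetrahedra s := fun _ hA => ⟨h hA.1, hA.2⟩

/-- Unique continuation: the transport determines a parallel assignment along a chain of neighbours.
-/
theorem eq_of_starConnected {C : PreAbstractSimplicialComplex α} {s A B : Finset α}
    {x y : Finset α → X} (hx : IsParallel M.transport x (C.tetrahedra s))
    (hy : IsParallel M.transport y (C.tetrahedra s))
    (h : Relation.ReflTransGen (StarStep C 3 s) A B) (hA : x A = y A) : x B = y B := by
  induction h with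
  | refl => exact hA
  | tail _ h ih => rw [← hx _ h.1 _ h.2.1 h.2.2, ← hy _ h.1 _ h.2.1 h.2.2, ih]

/-- A good assignment has the chosen value at a tetrahedron through `e`. Both assignments are
parallel in the star of the vertex `v` of `e`, which is strongly connected in `C`, so they agree on
all of it. -/
theorem eq_basePoint {C : PreAbstractSimplicialComplex α} (hC : C.IsConstructible)
    (hp : C.IsPure 3) (hCK : C ≤ K) {x : Finset α → X} (hx : M.IsGood C x) {e : Finset α} {v : α}
    (he : e ∈ M.branch) (heC : e ∈ C.faces) (hv : v ∈ e)
    (hz : IsParallel M.transport M.basePoint (K.tetrahedra {v})) {A : Finset α}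
    (hA : A ∈ C.tetrahedra {v}) : x A = M.basePoint A := by
  obtain ⟨E, hE, heE, hEc⟩ := hp.2 e heC
  exact M.eq_of_starConnected (hx.1.mono (tetrahedra_anti (Finset.empty_subset {v})))
    (hz.mono (tetrahedra_mono _ hCK))
    (hC.starConnected 3 hp {v} E A hE hEc
      (Finset.singleton_subset_iff.2 (heE hv)) hA.1 hA.2.1 hA.2.2) (hx.2 e he E ⟨hE, hEc, heE⟩)

section Glue

variable {C₁ C₂ : PreAbstractSimplicialComplex α}

theorem ne_of_isPure_inf (hp : (C₁ ⊓ C₂).IsPure 2) {A B : Finset α}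
    (hA : A ∈ C₁.tetrahedra ∅) (hB : B ∈ C₂.tetrahedra ∅) : A ≠ B := by
  rintro rfl
  have := hp.card_le (s := A) ⟨hA.1, hB.1⟩
  have := hA.2.1
  omega

/-- Agreement across one triangle of the intersection passes to the next triangle over their common
edge `e`. If `e` is branching, all values involved are the chosen ones. Otherwise a parallel
assignment `w` on the full star of `e` coincides with `x₁` and `x₂` on their parts of the star,
hence connects them across both triangles. -/
theorem agree_of_agree (h₁ : C₁.IsConstructible) (h₂ : C₂.IsConstructible) (hp₁ : C₁.IsPure 3)
    (hp₂ : C₂.IsPure 3) (hp : (C₁ ⊓ C₂).IsPure 2) (hK₁ : C₁ ≤ K) (hK₂ : C₂ ≤ K)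
    {x₁ x₂ : Finset α → X} (hx₁ : M.IsGood C₁ x₁) (hx₂ : M.IsGood C₂ x₂) {e t t' : Finset α}
    (he : e.card = 2) (het : e ⊆ t) (het' : e ⊆ t') (ht : t.card = 3) (ht' : t'.card = 3)
    {A B A' B' : Finset α} (hA : A ∈ C₁.tetrahedra t) (hB : B ∈ C₂.tetrahedra t)
    (hA' : A' ∈ C₁.tetrahedra t') (hB' : B' ∈ C₂.tetrahedra t')
    (hAB : M.transport A B (x₁ A) = x₂ B) : M.transport A' B' (x₁ A') = x₂ B' := by
  have hc : ∀ {t A B}, t.card = 3 → A ∈ C₁.tetrahedra t → B ∈ C₂.tetrahedra t →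
      (A ∩ B).card = 3 := fun ht hA hB =>
    card_inter_eq hA.2.1 hB.2.1 ht hA.2.2 hB.2.2
      (ne_of_isPure_inf hp (tetrahedra_anti (Finset.empty_subset _) hA)
        (tetrahedra_anti (Finset.empty_subset _) hB))
  by_cases heb : e ∈ M.branch
  · obtain ⟨v, hv, -, hz⟩ := M.basePoint_isParallel e heb e heb
    have hve := Finset.singleton_subset_iff.2 hv
    rw [hx₁.2 e heb A' (tetrahedra_anti het' hA'), hx₂.2 e heb B' (tetrahedra_anti het' hB')]
    exact hz A' (tetrahedra_mono _ hK₁ (tetrahedra_anti (hve.trans het') hA')) B'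
      (tetrahedra_mono _ hK₂ (tetrahedra_anti (hve.trans het') hB')) (hc ht' hA' hB')
  · have hAe := tetrahedra_anti het hA
    have hBe := tetrahedra_anti het hB
    have hAe' := tetrahedra_anti het' hA'
    have hBe' := tetrahedra_anti het' hB'
    obtain ⟨w, hw, hwp⟩ := M.exists_isParallel e he heb A (tetrahedra_mono _ hK₁ hAe) (x₁ A)
    have hwB : w B = x₂ B := by
      rw [← hAB, ← hw]
      exact (hwp A (tetrahedra_mono _ hK₁ hAe) B (tetrahedra_mono _ hK₂ hBe)
        (hc ht hA hB)).symm
    have hwA' : w A' = x₁ A' := M.eq_of_starConnected (hwp.mono (tetrahedra_mono _ hK₁))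
      (hx₁.1.mono (tetrahedra_anti (Finset.empty_subset e)))
      (h₁.starConnected 3 hp₁ e A A' hAe.1 hAe.2.1 hAe.2.2 hAe'.1 hAe'.2.1 hAe'.2.2) hw
    have hwB' : w B' = x₂ B' := M.eq_of_starConnected (hwp.mono (tetrahedra_mono _ hK₂))
      (hx₂.1.mono (tetrahedra_anti (Finset.empty_subset e)))
      (h₂.starConnected 3 hp₂ e B B' hBe.1 hBe.2.1 hBe.2.2 hBe'.1 hBe'.2.1 hBe'.2.2) hwB
    rw [← hwA', ← hwB']
    exact hwp A' (tetrahedra_mono _ hK₁ hAe') B' (tetrahedra_mono _ hK₂ hBe') (hc ht' hA' hB')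

/-- The intersection is a strongly connected 2-complex, so agreement across a single triangle
spreads to all its triangles. -/
theorem exists_isGood_sup (h₁ : C₁.IsConstructible) (h₂ : C₂.IsConstructible)
    (h : (C₁ ⊓ C₂).IsConstructible) (hp₁ : C₁.IsPure 3) (hp₂ : C₂.IsPure 3)
    (hp : (C₁ ⊓ C₂).IsPure 2) (hK₁ : C₁ ≤ K) (hK₂ : C₂ ≤ K)
    {x₁ x₂ : Finset α → X} (hx₁ : M.IsGood C₁ x₁) (hx₂ : M.IsGood C₂ x₂) {t A B : Finset α}
    (ht : t ∈ (C₁ ⊓ C₂).faces) (htc : t.card = 3) (hA : A ∈ C₁.tetrahedra t)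
    (hB : B ∈ C₂.tetrahedra t) (hAB : M.transport A B (x₁ A) = x₂ B) :
    ∃ x, M.IsGood (C₁ ⊔ C₂) x ∧ (∀ A ∈ C₁.tetrahedra ∅, x A = x₁ A) := by
  classical
  have key : ∀ t' ∈ (C₁ ⊓ C₂).faces, t'.card = 3 → ∃ A' ∈ C₁.tetrahedra t',
      ∃ B' ∈ C₂.tetrahedra t', M.transport A' B' (x₁ A') = x₂ B' := by
    intro t' ht' htc'
    have hconn := h.starConnected 2 hp ∅ t t' ht htc (Finset.empty_subset t) ht' htc'
      (Finset.empty_subset t')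
    clear ht' htc'
    induction hconn with
    | refl => exact ⟨A, hA, B, hB, hAB⟩
    | @tail u v _ huv ih =>
      obtain ⟨A₁, hA₁, B₁, hB₁, hAB₁⟩ := ih
      obtain ⟨A', hA', hvA', hAc'⟩ := hp₁.2 v huv.2.1.1.1
      obtain ⟨B', hB', hvB', hBc'⟩ := hp₂.2 v huv.2.1.1.2
      exact ⟨A', ⟨hA', hAc', hvA'⟩, B', ⟨hB', hBc', hvB'⟩, M.agree_of_agree h₁ h₂ hp₁ hp₂ hp hK₁
        hK₂ hx₁ hx₂ huv.2.2 Finset.inter_subset_left Finset.inter_subset_right huv.1.2.1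
        huv.2.1.2.1 hA₁ hB₁ ⟨hA', hAc', hvA'⟩ ⟨hB', hBc', hvB'⟩ hAB₁⟩
  have cross : ∀ A ∈ C₁.tetrahedra ∅, ∀ B ∈ C₂.tetrahedra ∅, (A ∩ B).card = 3 →
      M.transport A B (x₁ A) = x₂ B := by
    intro A hA B hB hc
    have hne : (A ∩ B).Nonempty := Finset.card_pos.1 (by omega)
    obtain ⟨A', hA', B', hB', hAB'⟩ := key (A ∩ B) ⟨mem_of_subset hA.1 Finset.inter_subset_left hne,
      mem_of_subset hB.1 Finset.inter_subset_right hne⟩ hc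
    obtain ⟨e, he, hec⟩ := Finset.exists_subset_card_eq (n := 2) (s := A ∩ B) (by omega)
    exact M.agree_of_agree h₁ h₂ hp₁ hp₂ hp hK₁ hK₂ hx₁ hx₂ hec he he hc hc hA' hB'
      ⟨hA.1, hA.2.1, Finset.inter_subset_left⟩ ⟨hB.1, hB.2.1, Finset.inter_subset_right⟩ hAB'
  have hx : ∀ A ∈ C₁.tetrahedra ∅, (if A ∈ C₁.faces then x₁ A else x₂ A) = x₁ A :=
    fun A hA => if_pos hA.1
  have hx' : ∀ A ∈ C₂.tetrahedra ∅, (if A ∈ C₁.faces then x₁ A else x₂ A) = x₂ A :=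
    fun A hA => if_neg fun hA' => ne_of_isPure_inf hp (A := A) ⟨hA', hA.2⟩ hA rfl
  refine ⟨fun A => if A ∈ C₁.faces then x₁ A else x₂ A, ⟨?_, ?_⟩, hx⟩
  · rintro A ⟨hA, hAc⟩ B ⟨hB, hBc⟩ hc
    dsimp only
    rcases hA with hA | hA <;> rcases hB with hB | hB
    · rw [hx A ⟨hA, hAc⟩, hx B ⟨hB, hBc⟩]
      exact hx₁.1 A ⟨hA, hAc⟩ B ⟨hB, hBc⟩ hc
    · rw [hx A ⟨hA, hAc⟩, hx' B ⟨hB, hBc⟩]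
      exact cross A ⟨hA, hAc⟩ B ⟨hB, hBc⟩ hc
    · rw [hx' A ⟨hA, hAc⟩, hx B ⟨hB, hBc⟩]
      rw [Finset.inter_comm] at hc
      rw [← cross B ⟨hB, hBc⟩ A ⟨hA, hAc⟩ hc]
      exact M.transport_transport B ⟨hK₁ hB, hBc⟩ A ⟨hK₂ hA, hAc⟩ hc _
    · rw [hx' A ⟨hA, hAc⟩, hx' B ⟨hB, hBc⟩]
      exact hx₂.1 A ⟨hA, hAc⟩ B ⟨hB, hBc⟩ hc
  · rintro e he A ⟨hA, hAc⟩
    have hA0 := hAc.1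
    dsimp only
    rcases hA with hA | hA
    · rw [hx A ⟨hA, hA0, Finset.empty_subset A⟩]
      exact hx₁.2 e he A ⟨hA, hAc⟩
    · rw [hx' A ⟨hA, hA0, Finset.empty_subset A⟩]
      exact hx₂.2 e he A ⟨hA, hAc⟩

theorem exists_isGood_extend (h₁ : C₁.IsConstructible) (h₂ : C₂.IsConstructible)
    (h : (C₁ ⊓ C₂).IsConstructible) (hp₁ : C₁.IsPure 3) (hp₂ : C₂.IsPure 3)
    (hp : (C₁ ⊓ C₂).IsPure 2) (hK₁ : C₁ ≤ K) (hK₂ : C₂ ≤ K)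
    (hfree : ∀ T ∈ C₂.tetrahedra ∅, ∀ c, ∃ x, M.IsGood C₂ x ∧ x T = c)
    {x₁ : Finset α → X} (hx₁ : M.IsGood C₁ x₁) :
    ∃ x, M.IsGood (C₁ ⊔ C₂) x ∧ (∀ A ∈ C₁.tetrahedra ∅, x A = x₁ A) := by
  obtain ⟨s, hs⟩ := hp.1
  obtain ⟨t, ht, -, htc⟩ := hp.2 s hs
  obtain ⟨A, hA, htA, hAc⟩ := hp₁.2 t ht.1
  obtain ⟨B, hB, htB, hBc⟩ := hp₂.2 t ht.2
  obtain ⟨x₂, hx₂, hx₂B⟩ := hfree B ⟨hB, hBc, Finset.empty_subset B⟩ (M.transport A B (x₁ A))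
  exact M.exists_isGood_sup h₁ h₂ h hp₁ hp₂ hp hK₁ hK₂ hx₁ hx₂ ht htc ⟨hA, hAc, htA⟩
    ⟨hB, hBc, htB⟩ hx₂B.symm

end Glue

/-- The second assertion, freedom of the value at one tetrahedron in the absence of branching edges,
is what makes the induction work: it allows the two assignments to be matched across one triangle of
the intersection. -/
theorem exists_isGood {C : PreAbstractSimplicialComplex α}
    (hC : C.IsConstructible) :
    C.IsPure 3 → C ≤ K → (∃ x, M.IsGood C x) ∧
      ((∀ e ∈ M.branch, e.Nonempty → e ∉ C.faces) → ∀ T ∈ C.tetrahedra ∅, ∀ c,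
        ∃ x, M.IsGood C x ∧ x T = c) := by
  induction hC with
  | @simplex C hC =>
    intro hp _
    have hpar : ∀ x, IsParallel M.transport x (C.tetrahedra ∅) := by
      intro x A hA B hB hc
      rw [hC.eq_of_card hp hA.1 hA.2.1 hB.1 hB.2.1, Finset.inter_self, hB.2.1] at hc
      exact absurd hc (by norm_num)
    refine ⟨⟨M.basePoint, hpar _, fun _ _ _ _ => rfl⟩, fun hb T hT c =>
      ⟨fun _ => c, ⟨hpar _, fun e he A hA => ?_⟩, rfl⟩⟩
    obtain ⟨v, hv, -⟩ := M.basePoint_isParallel e he e he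
    exact absurd (mem_of_subset hA.1 hA.2.2 ⟨v, hv⟩) (hb e he ⟨v, hv⟩)
  | points hC =>
    intro hp
    exact absurd (hp.unique hC) (by norm_num)
  | @union d C₁ C₂ hp₁ hp₂ hp h₁ h₂ h ih₁ ih₂ _ =>
    intro hp' hK
    obtain rfl : d = 2 := by
      have := hp'.unique (hp₁.sup hp₂)
      omega
    have hK₁ : C₁ ≤ K := le_sup_left.trans hK
    have hK₂ : C₂ ≤ K := le_sup_right.trans hK
    obtain ⟨⟨y₁, hy₁⟩, ihf₁⟩ := ih₁ hp₁ hK₁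
    obtain ⟨⟨y₂, hy₂⟩, ihf₂⟩ := ih₂ hp₂ hK₂
    constructor
    · by_cases hb₂ : ∀ e ∈ M.branch, e.Nonempty → e ∉ C₂.faces
      · obtain ⟨x, hx, -⟩ := M.exists_isGood_extend h₁ h₂ h hp₁ hp₂ hp hK₁ hK₂ (ihf₂ hb₂) hy₁
        exact ⟨x, hx⟩
      by_cases hb₁ : ∀ e ∈ M.branch, e.Nonempty → e ∉ C₁.faces
      · rw [inf_comm] at h hp
        rw [sup_comm]
        obtain ⟨x, hx, -⟩ := M.exists_isGood_extend h₂ h₁ h hp₂ hp₁ hp hK₂ hK₁ (ihf₁ hb₁) hy₂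
        exact ⟨x, hx⟩
      push Not at hb₁ hb₂
      obtain ⟨e₁, he₁, -, heC₁⟩ := hb₁
      obtain ⟨e₂, he₂, -, heC₂⟩ := hb₂
      -- Both parts contain branching edges. These share a vertex `v`, which lies in the
      -- intersection, and near `v` both assignments take the chosen values. So they agree across
      -- any common triangle at `v`.
      obtain ⟨v, hv₁, hv₂, hz⟩ := M.basePoint_isParallel e₁ he₁ e₂ he₂
      obtain ⟨t, ht, hvt, htc⟩ := hp.2 {v}
        ⟨mem_of_subset heC₁ (Finset.singleton_subset_iff.2 hv₁) (Finset.singleton_nonempty v),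
        mem_of_subset heC₂ (Finset.singleton_subset_iff.2 hv₂) (Finset.singleton_nonempty v)⟩
      obtain ⟨A, hA, htA, hAc⟩ := hp₁.2 t ht.1
      obtain ⟨B, hB, htB, hBc⟩ := hp₂.2 t ht.2
      obtain ⟨x, hx, -⟩ := M.exists_isGood_sup h₁ h₂ h hp₁ hp₂ hp hK₁ hK₂ hy₁ hy₂ ht htc
        ⟨hA, hAc, htA⟩ ⟨hB, hBc, htB⟩ (by
          rw [M.eq_basePoint h₁ hp₁ hK₁ hy₁ he₁ heC₁ hv₁ hz ⟨hA, hAc, hvt.trans htA⟩,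
            M.eq_basePoint h₂ hp₂ hK₂ hy₂ he₂ heC₂ hv₂ hz ⟨hB, hBc, hvt.trans htB⟩]
          exact hz A ⟨hK₁ hA, hAc, hvt.trans htA⟩ B ⟨hK₂ hB, hBc, hvt.trans htB⟩
            (card_inter_eq hAc hBc htc htA htB (ne_of_isPure_inf hp
              ⟨hA, hAc, Finset.empty_subset A⟩ ⟨hB, hBc, Finset.empty_subset B⟩)))
      exact ⟨x, hx⟩
    · intro hb T hT c
      have hf₁ := ihf₁ fun e he he0 heC => hb e he he0 (Or.inl heC)
      have hf₂ := ihf₂ fun e he he0 heC => hb e he he0 (Or.inr heC)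
      rcases hT with ⟨hT | hT, hTc⟩
      · obtain ⟨x₁, hx₁, rfl⟩ := hf₁ T ⟨hT, hTc⟩ c
        obtain ⟨x, hx, hxx⟩ := M.exists_isGood_extend h₁ h₂ h hp₁ hp₂ hp hK₁ hK₂ hf₂ hx₁
        exact ⟨x, hx, hxx T ⟨hT, hTc⟩⟩
      · obtain ⟨x₂, hx₂, rfl⟩ := hf₂ T ⟨hT, hTc⟩ c
        rw [inf_comm] at h hp
        rw [sup_comm]
        obtain ⟨x, hx, hxx⟩ := M.exists_isGood_extend h₂ h₁ h hp₂ hp₁ hp hK₂ hK₁ hf₁ hx₂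
        exact ⟨x, hx, hxx T ⟨hT, hTc⟩⟩

end BranchedCover

end Constructible

/-! ### Sections of branched coverings along a collapse. -/

section Collapsing

variable {α : Type*} [DecidableEq α] {K : PreAbstractSimplicialComplex α}

namespace BranchedCover

variable {X : Type*} (M : BranchedCover K X)

/-- The assignment `x` is parallel across the triangles that are missing in `C`. -/
def IsParallelOff (C : PreAbstractSimplicialComplex α) (x : Finset α → X) : Prop :=
  ∀ A ∈ K.tetrahedra ∅, ∀ B ∈ K.tetrahedra ∅, (A ∩ B).card = 3 → A ∩ B ∉ C.faces →
    M.transport A B (x A) = x B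

/-- There is an assignment that is parallel across the triangles missing in `C`, and it can be
prescribed at a tetrahedron as long as `C` contains a branching edge. -/
def HasPartialSections (C : PreAbstractSimplicialComplex α) : Prop :=
  (∃ x, M.IsParallelOff C x) ∧
    ((∃ e ∈ M.branch, e ∈ C.faces) → ∀ T ∈ K.tetrahedra ∅, ∀ c, ∃ x, M.IsParallelOff C x ∧ x T = c)

variable {M} {C C' : PreAbstractSimplicialComplex α} {σ ρ : Finset α}

theorem IsParallelOff.of_ne {x : Finset α → X} (hx : M.IsParallelOff C x)
    (hC' : C'.faces = C.faces \ {σ, ρ})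
    (h : ∀ A ∈ K.tetrahedra ∅, ∀ B ∈ K.tetrahedra ∅, (A ∩ B).card = 3 → A ∩ B = σ ∨ A ∩ B = ρ →
      M.transport A B (x A) = x B) : M.IsParallelOff C' x := by
  intro A hA B hB hc hAB
  by_cases h' : A ∩ B = σ ∨ A ∩ B = ρ
  · exact h A hA B hB hc h'
  · refine hx A hA B hB hc fun hm => hAB ?_
    rw [hC']
    exact ⟨hm, h'⟩

/-- As long as the tetrahedron `ρ` is present, so are its triangles, and the value at `ρ` is
unconstrained. When `ρ` is removed through `σ`, its value can be transported from the tetrahedron on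
the other side of `σ`. -/
theorem IsParallelOff.exists_update (htwo : ∀ t, t.card = 3 → ∀ A ∈ K.tetrahedra t,
      ∀ B ∈ K.tetrahedra t, ∀ T ∈ K.tetrahedra t, A ≠ B → T = A ∨ T = B)
    (hC' : C'.faces = C.faces \ {σ, ρ}) (hσ : σ.card = 3) (hρ : ρ ∈ K.tetrahedra σ)
    (hρC : ρ ∈ C.faces) {T' : Finset α} (hT' : T' ∈ K.tetrahedra σ) (hT : T' ≠ ρ)
    {x : Finset α → X} (hx : M.IsParallelOff C x) :
    M.IsParallelOff C' (Function.update x ρ (M.transport T' ρ (x T'))) := by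
  have hρ0 := tetrahedra_anti (Finset.empty_subset σ) hρ
  have hT0 := tetrahedra_anti (Finset.empty_subset σ) hT'
  have hcard := card_inter_eq hT'.2.1 hρ.2.1 hσ hT'.2.2 hρ.2.2 hT
  refine IsParallelOff.of_ne (C := C) ?_ hC' ?_
  · intro A hA B hB hc hAB
    have hAρ : ∀ A B, (A ∩ B).card = 3 → A ∩ B ∉ C.faces → A ≠ ρ := by
      rintro A B hc hAB rfl
      exact hAB (mem_of_subset hρC Finset.inter_subset_left (Finset.card_pos.1 (by omega)))
    rw [Function.update_of_ne (hAρ A B hc hAB),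
      Function.update_of_ne (hAρ B A (by rwa [Finset.inter_comm]) (by rwa [Finset.inter_comm]))]
    exact hx A hA B hB hc hAB
  · intro A hA B hB hc hAB
    have hσ' : A ∩ B = σ := hAB.resolve_right fun h => by
      have := hρ.2.1
      rw [← h] at this
      omega
    have hAσ : A ∈ K.tetrahedra σ := ⟨hA.1, hA.2.1, hσ' ▸ Finset.inter_subset_left⟩
    have hBσ : B ∈ K.tetrahedra σ := ⟨hB.1, hB.2.1, hσ' ▸ Finset.inter_subset_right⟩
    have hne : A ≠ B := by
      rintro rfl
      rw [Finset.inter_self, hA.2.1] at hc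
      exact absurd hc (by norm_num)
    rcases htwo σ hσ T' hT' ρ hρ A hAσ hT with rfl | rfl <;>
      rcases htwo σ hσ _ hT' _ hρ B hBσ hT with rfl | rfl
    · exact absurd rfl hne
    · rw [Function.update_self, Function.update_of_ne hne]
    · rw [Function.update_self, Function.update_of_ne hne.symm]
      exact M.transport_transport _ hT0 _ hρ0 hcard _
    · exact absurd rfl hne

theorem HasPartialSections.of_free_triangle (htwo : ∀ t, t.card = 3 → ∀ A ∈ K.tetrahedra t,
      ∀ B ∈ K.tetrahedra t, ∀ T ∈ K.tetrahedra t, A ≠ B → T = A ∨ T = B)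
    (hC' : C'.faces = C.faces \ {σ, ρ}) (hCK : C ≤ K) (hσ : σ.card = 3) (hρ : ρ.card = 4)
    (hρC : ρ ∈ C.faces) (hσρ : σ ⊆ ρ) (h : M.HasPartialSections C) : M.HasPartialSections C' := by
  have hρσ : ρ ∈ K.tetrahedra σ := ⟨hCK hρC, hρ, hσρ⟩
  have hb : (∃ e ∈ M.branch, e ∈ C'.faces) → ∃ e ∈ M.branch, e ∈ C.faces := by
    rintro ⟨e, he, heC⟩
    rw [hC'] at heC
    exact ⟨e, he, heC.1⟩
  by_cases hT : ∃ T' ∈ K.tetrahedra σ, T' ≠ ρ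
  · obtain ⟨T', hT', hne⟩ := hT
    refine ⟨?_, fun he T hT c => ?_⟩
    · obtain ⟨x, hx⟩ := h.1
      exact ⟨_, hx.exists_update htwo hC' hσ hρσ hρC hT' hne⟩
    · by_cases hTρ : T = ρ
      -- A value at `ρ` is prescribed by prescribing its transport back at the neighbour `T'`.
      · obtain ⟨x, hx, hxT⟩ := h.2 (hb he) T' (tetrahedra_anti (Finset.empty_subset σ) hT')
          (M.transport ρ T' c)
        refine ⟨_, hx.exists_update htwo hC' hσ hρσ hρC hT' hne, ?_⟩
        rw [hTρ, Function.update_self, hxT]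
        exact M.transport_transport _ (tetrahedra_anti (Finset.empty_subset σ) hρσ) _
          (tetrahedra_anti (Finset.empty_subset σ) hT')
          (card_inter_eq hρ hT'.2.1 hσ hσρ hT'.2.2 hne.symm) _
      · obtain ⟨x, hx, hxT⟩ := h.2 (hb he) T hT c
        refine ⟨_, hx.exists_update htwo hC' hσ hρσ hρC hT' hne, ?_⟩
        rw [Function.update_of_ne hTρ, hxT]
  -- Only one tetrahedron contains `σ`, so removing this triangle imposes no condition.
  · push Not at hT
    have key : ∀ x, M.IsParallelOff C x → M.IsParallelOff C' x := by
      intro x hx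
      refine hx.of_ne hC' fun A hA B hB hc hAB => ?_
      exfalso
      have hσ' : A ∩ B = σ := hAB.resolve_right fun h => by
        rw [← h] at hρ
        omega
      have hA' := hT A ⟨hA.1, hA.2.1, hσ' ▸ Finset.inter_subset_left⟩
      have hB' := hT B ⟨hB.1, hB.2.1, hσ' ▸ Finset.inter_subset_right⟩
      rw [hA', hB', Finset.inter_self] at hc
      omega
    refine ⟨?_, fun he T hT c => ?_⟩
    · obtain ⟨x, hx⟩ := h.1
      exact ⟨x, key x hx⟩
    · obtain ⟨x, hx, hxT⟩ := h.2 (hb he) T hT c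
      exact ⟨x, key x hx, hxT⟩

/-- Two tetrahedra around the edge `e` that meet in a triangle different from `t`. -/
def AroundStep (K : PreAbstractSimplicialComplex α) (e t A B : Finset α) : Prop :=
  A ∈ K.tetrahedra e ∧ B ∈ K.tetrahedra e ∧ (A ∩ B).card = 3 ∧ A ∩ B ≠ t

theorem IsParallelOff.eq_of_aroundStep (hσ : σ.card = 2)
    (hfree : ∀ t ∈ C.faces, σ ⊂ t → t = ρ) {x w : Finset α → X} (hx : M.IsParallelOff C x)
    (hw : IsParallel M.transport w (K.tetrahedra σ)) {A B : Finset α}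
    (h : Relation.ReflTransGen (AroundStep K σ ρ) A B) (hA : x A = w A) : x B = w B := by
  induction h with
  | refl => exact hA
  | @tail A B _ h ih =>
    obtain ⟨hA, hB, hc, hne⟩ := h
    rw [← hw A hA B hB hc, ← ih]
    refine (hx A (tetrahedra_anti (Finset.empty_subset σ) hA) B
      (tetrahedra_anti (Finset.empty_subset σ) hB) hc fun hm => hne (hfree _ hm ?_)).symm
    refine (Finset.subset_inter hA.2.2 hB.2.2).ssubset_of_ne fun h => ?_
    rw [h] at hσ
    omega

/-- All triangles around `σ` other than `ρ` are already missing, so the assignment is parallel all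
the way round except across `ρ`. Trivial holonomy closes the gap if `σ` is not branching. If it is,
the freedom to prescribe a value is used to take the chosen points around `σ`; afterwards no
branching edge is left, so the freedom is no longer required. -/
theorem HasPartialSections.of_free_edge
    (hsub : ∀ e ∈ M.branch, e ∈ K.faces → ∀ e' ∈ M.branch, e' ∈ K.faces → e = e')
    (haround : ∀ A ∈ K.tetrahedra ρ, ∀ B ∈ K.tetrahedra ρ,
      Relation.ReflTransGen (AroundStep K σ ρ) A B)
    (hfree : ∀ t ∈ C.faces, σ ⊂ t → t = ρ)
    (hC' : C'.faces = C.faces \ {σ, ρ}) (hCK : C ≤ K) (hσC : σ ∈ C.faces) (hσ : σ.card = 2)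
    (hσρ : σ ⊆ ρ) (h : M.HasPartialSections C) : M.HasPartialSections C' := by
  have hρ' : ∀ {A B : Finset α}, (A ∩ B).card = 3 → A ∩ B = σ ∨ A ∩ B = ρ → A ∩ B = ρ :=
    fun hc h => h.resolve_left fun h => by
      rw [← h] at hσ
      omega
  by_cases hb : σ ∈ M.branch
  · obtain ⟨v, hv, -, hz⟩ := M.basePoint_isParallel σ hb σ hb
    have hzσ := hz.mono (tetrahedra_anti (Finset.singleton_subset_iff.2 hv))
    refine ⟨?_, ?_⟩
    · obtain ⟨x, hx, hxz⟩ : ∃ x, M.IsParallelOff C x ∧ ∀ A ∈ K.tetrahedra ρ,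
          x A = M.basePoint A := by
        rcases (K.tetrahedra ρ).eq_empty_or_nonempty with he | ⟨T, hT⟩
        · obtain ⟨x, hx⟩ := h.1
          exact ⟨x, hx, by simp [he]⟩
        · obtain ⟨x, hx, hxT⟩ := h.2 ⟨σ, hb, hσC⟩ T (tetrahedra_anti (Finset.empty_subset ρ) hT)
            (M.basePoint T)
          exact ⟨x, hx, fun A hA => hx.eq_of_aroundStep hσ hfree hzσ (haround T hT A hA) hxT⟩
      refine ⟨x, hx.of_ne hC' fun A hA B hB hc hAB => ?_⟩
      have hAρ : A ∈ K.tetrahedra ρ := ⟨hA.1, hA.2.1, hρ' hc hAB ▸ Finset.inter_subset_left⟩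
      have hBρ : B ∈ K.tetrahedra ρ := ⟨hB.1, hB.2.1, hρ' hc hAB ▸ Finset.inter_subset_right⟩
      rw [hxz A hAρ, hxz B hBρ]
      exact hzσ A (tetrahedra_anti hσρ hAρ) B (tetrahedra_anti hσρ hBρ) hc
    · rintro ⟨e, he, heC⟩
      rw [hC'] at heC
      exact absurd (Or.inl (hsub e he (hCK heC.1) σ hb (hCK hσC))) heC.2
  · have key : ∀ x, M.IsParallelOff C x → M.IsParallelOff C' x := by
      intro x hx
      refine hx.of_ne hC' fun A hA B hB hc hAB => ?_
      have hAρ : A ∈ K.tetrahedra ρ := ⟨hA.1, hA.2.1, hρ' hc hAB ▸ Finset.inter_subset_left⟩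
      have hBρ : B ∈ K.tetrahedra ρ := ⟨hB.1, hB.2.1, hρ' hc hAB ▸ Finset.inter_subset_right⟩
      obtain ⟨w, hwA, hw⟩ := M.exists_isParallel σ hσ hb A (tetrahedra_anti hσρ hAρ) (x A)
      rw [hx.eq_of_aroundStep hσ hfree hw (haround A hAρ B hBρ) hwA.symm, ← hwA]
      exact hw A (tetrahedra_anti hσρ hAρ) B (tetrahedra_anti hσρ hBρ) hc
    refine ⟨?_, fun he T hT c => ?_⟩
    · obtain ⟨x, hx⟩ := h.1
      exact ⟨x, key x hx⟩
    · obtain ⟨e, he, heC⟩ := he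
      rw [hC'] at heC
      obtain ⟨x, hx, hxT⟩ := h.2 ⟨e, he, heC.1⟩ T hT c
      exact ⟨x, key x hx, hxT⟩

theorem HasPartialSections.of_collapse (htwo : ∀ t, t.card = 3 → ∀ A ∈ K.tetrahedra t,
      ∀ B ∈ K.tetrahedra t, ∀ T ∈ K.tetrahedra t, A ≠ B → T = A ∨ T = B)
    (hsub : ∀ e ∈ M.branch, e ∈ K.faces → ∀ e' ∈ M.branch, e' ∈ K.faces → e = e')
    (haround : ∀ e ∈ K.faces, e.card = 2 → e ∉ C'.faces → ∀ t, t.card = 3 → e ⊆ t →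
      ∀ A ∈ K.tetrahedra t, ∀ B ∈ K.tetrahedra t, Relation.ReflTransGen (AroundStep K e t) A B)
    (hCK : C ≤ K) (hCC : C.ElementaryCollapse C') (h : M.HasPartialSections C) :
    M.HasPartialSections C' := by
  obtain ⟨σ, hσ, ρ, hρ, hσρ, hfree, hC'⟩ := hCC
  have hcard : ρ.card = σ.card + 1 := by
    obtain ⟨a, ha, haσ⟩ := Finset.exists_of_ssubset hσρ
    rw [← hfree _ (mem_of_subset hρ (Finset.insert_subset ha hσρ.subset)
      (Finset.insert_nonempty a σ)) (Finset.ssubset_insert haσ), Finset.card_insert_of_notMem haσ]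
  by_cases h3 : σ.card = 3
  · exact h.of_free_triangle htwo hC' hCK h3 (by omega) hρ hσρ.subset
  by_cases h2 : σ.card = 2
  · refine h.of_free_edge hsub (haround σ (hCK hσ) h2 ?_ ρ (by omega) hσρ.subset) hfree hC' hCK hσ
      h2 hσρ.subset
    rw [hC']
    exact fun h => h.2 (Or.inl rfl)
  -- In the remaining cases neither `σ` nor `ρ` is a triangle.
  have key : ∀ x, M.IsParallelOff C x → M.IsParallelOff C' x := fun x hx =>
    hx.of_ne hC' fun A _ B _ hc hAB => by
      rcases hAB with hAB | hAB <;> rw [hAB] at hc <;> omega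
  refine ⟨?_, fun he T hT c => ?_⟩
  · obtain ⟨x, hx⟩ := h.1
    exact ⟨x, key x hx⟩
  · obtain ⟨e, he, heC⟩ := he
    rw [hC'] at heC
    obtain ⟨x, hx, hxT⟩ := h.2 ⟨e, he, heC.1⟩ T hT c
    exact ⟨x, key x hx, hxT⟩

variable (M)

/-- At the start no triangle is missing and there is no condition. At the end every triangle between
two tetrahedra is missing, so the assignment is parallel everywhere. The collapse never removes
boundary edges, so connectedness around edges is required only in the interior. -/
theorem not_isLCBall (htwo : ∀ t, t.card = 3 → ∀ A ∈ K.tetrahedra t,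
      ∀ B ∈ K.tetrahedra t, ∀ T ∈ K.tetrahedra t, A ≠ B → T = A ∨ T = B)
    (hsub : ∀ e ∈ M.branch, e ∈ K.faces → ∀ e' ∈ M.branch, e' ∈ K.faces → e = e')
    (haround : ∀ e ∈ K.faces, e.card = 2 → e ∉ (K.boundary 3).faces → ∀ t, t.card = 3 → e ⊆ t →
      ∀ A ∈ K.tetrahedra t, ∀ B ∈ K.tetrahedra t, Relation.ReflTransGen (AroundStep K e t) A B)
    (hmono : ∀ x, ¬ IsParallel M.transport x (K.tetrahedra ∅)) : ¬ K.IsLCBall := by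
  rintro ⟨t, ht, htc, D, hD, hKD⟩
  have hstart : M.HasPartialSections K := by
    have hvac : ∀ x, M.IsParallelOff K x := fun x A hA B hB hc hAB =>
      absurd (mem_of_subset hA.1 Finset.inter_subset_left (Finset.card_pos.1 (by omega))) hAB
    exact ⟨⟨M.basePoint, hvac _⟩, fun _ T _ c => ⟨fun _ => c, hvac _, rfl⟩⟩
  have key : ∀ C, CollapsesOnto K C → C.CollapsesOnto D → M.HasPartialSections C := by
    intro C hKC
    induction hKC with
    | refl => exact fun _ => hstart
    | @tail C C' hKC hCC' ih =>
      intro hC'D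
      refine (ih (Relation.ReflTransGen.head hCC' hC'D)).of_collapse htwo hsub ?_
        (CollapsesOnto.le hKC) hCC'
      intro e he hec heC' t' ht'c
      refine haround e he hec (fun heb => heC' (CollapsesOnto.le hC'D ?_)) t' ht'c
      rw [hD]
      refine ⟨heb, ?_⟩
      rintro rfl
      omega
  obtain ⟨x, hx⟩ := (key D hKD .refl).1
  refine hmono x fun A hA B hB hc => hx A hA B hB hc fun hm => ?_
  rw [hD] at hm
  -- A triangle that is left over is a boundary triangle and cannot separate two tetrahedra.
  obtain ⟨⟨-, u, -, hsu, huc, F, -, hF⟩, -⟩ := hm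
  obtain rfl : A ∩ B = u := Finset.eq_of_subset_of_card_le hsu (by omega)
  have hAF := hF A ⟨hA.1, hA.2.1, Finset.inter_subset_left⟩
  have hBF := hF B ⟨hB.1, hB.2.1, Finset.inter_subset_right⟩
  rw [hAF, hBF, Finset.inter_self, ← hAF, hA.2.1] at hc
  exact absurd hc (by norm_num)

end BranchedCover

end Collapsing

/-! ### Coverings with fibre of three points on coded tetrahedra. -/

section CodedCover

/-- The nontrivial transports of the covering of the sphere: the entry `(A, B, m, c)` stands for the
map `x ↦ m * x + c` modulo `3` from the fibre over `A` to the fibre over `B`. -/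
def transportData : List (ℕ × ℕ × ℕ × ℕ) :=
  [(582, 4614, 2, 0), (4614, 582, 2, 0), (298, 2314, 2, 1), (2314, 298, 2, 1),
   (1314, 1410, 2, 2), (1410, 1314, 2, 2), (2434, 2314, 1, 2), (2314, 2434, 1, 1),
   (5634, 9730, 2, 0), (9730, 5634, 2, 0), (3106, 11266, 1, 1), (11266, 3106, 1, 2),
   (1052, 1164, 2, 2), (1164, 1052, 2, 2), (2820, 4868, 2, 0), (4868, 2820, 2, 0),
   (1316, 1412, 2, 2), (1412, 1316, 2, 2), (2436, 2820, 1, 2), (2820, 2436, 1, 1),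
   (8484, 12548, 1, 2), (12548, 8484, 1, 1), (10308, 10372, 1, 1), (10372, 10308, 1, 2),
   (2824, 4872, 2, 0), (4872, 2824, 2, 0), (8488, 12552, 1, 2), (12552, 8488, 1, 1),
   (5640, 9736, 2, 0), (9736, 5640, 2, 0), (9288, 9736, 1, 1), (9736, 9288, 1, 2),
   (11328, 11266, 1, 1), (11266, 11328, 1, 2)]

/-- The nonzero values of the parallel assignment near the triangle `{1, 2, 3}`. -/
def basePointData : List (ℕ × ℕ) :=
  [(156, 1), (1052, 1), (1164, 1), (180, 1), (216, 1), (1112, 1), (4296, 1), (12360, 1),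
   (5256, 1), (5640, 1), (4872, 1), (9736, 2), (8744, 2), (9288, 1), (8488, 2), (2600, 2),
   (2824, 2), (2090, 2), (298, 2), (2314, 2), (3106, 2), (1314, 2), (8484, 1), (8356, 1),
   (1316, 1), (1076, 1), (1412, 1), (2436, 1), (10372, 1), (12552, 1)]

/-- A closed walk through tetrahedra of `ballB_12_38` whose holonomy has no fixed point. -/
def monodromyWalk : List ℕ :=
  [8356, 10372, 10308, 2628, 2656, 736, 8864, 8356]

/-- The value at `A` of a table of residues modulo `3`, and `0` if there is no entry. -/
def lookup3 (tb : List (ℕ × ℕ)) (A : ℕ) : ℕ :=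
  match tb.find? fun p => Nat.beq p.1 A with
  | none => 0
  | some p => Nat.mod p.2 3

/-- The transport from the fibre over `A` to the fibre over `B`. -/
def transport3 (A B x : ℕ) : ℕ :=
  match transportData.find? fun p => Nat.beq p.1 A && Nat.beq p.2.1 B with
  | none => x
  | some p => Nat.mod (p.2.2.1 * x + p.2.2.2) 3

/-- The number of elements of a coded set of numbers less than `14` is `k`. -/
def cardB (m k : ℕ) : Bool := Nat.beq ((List.range 14).countP (Nat.testBit m)) k

/-- The table `tb` is parallel between any two neighbours in `st`. -/
def parallelB (tb : List (ℕ × ℕ)) (st : List ℕ) : Bool :=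
  st.all fun A => st.all fun B => !cardB (Nat.land A B) 3 ||
    Nat.beq (transport3 A B (lookup3 tb A)) (lookup3 tb B)

/-- Continues the value `x` at `A` along a chain of neighbours chosen from a list, and evaluates
`k` at the table of the values. -/
def continueK : ℕ → ℕ → ℕ → List (ℕ × ℕ) → List ℕ → (List (ℕ × ℕ) → Bool) → Bool
  | 0, _, _, tb, _, k => k tb
  | n + 1, A, x, tb, l, k =>
    match l.find? fun B => cardB (Nat.land A B) 3 with
    | none => k ((A, x) :: tb)
    | some B => filterK (fun C => !Nat.beq C B) l fun l' =>
      bif Nat.beq (transport3 A B x) 0 then continueK n B 0 ((A, x) :: tb) l' k else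
      bif Nat.beq (transport3 A B x) 1 then continueK n B 1 ((A, x) :: tb) l' k else
        continueK n B 2 ((A, x) :: tb) l' k

/-- Tests that there are parallel tables on `st` with any value at any member. -/
def trivialB : List ℕ → Bool
  | [] => true
  | A :: l => continueK 14 A 0 [] l fun t₀ => continueK 14 A 1 [] l fun t₁ =>
    continueK 14 A 2 [] l fun t₂ => parallelB t₀ (A :: l) && parallelB t₁ (A :: l) &&
      parallelB t₂ (A :: l) && (A :: l).all fun B => (List.range 3).all fun c =>
        Nat.beq (lookup3 t₀ B) c || Nat.beq (lookup3 t₁ B) c || Nat.beq (lookup3 t₂ B) c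

/-- Nothing about the construction of the table is needed, since the continuation checks that it is
parallel. -/
theorem exists_of_continueK (n : ℕ) : ∀ (A x : ℕ) (tb : List (ℕ × ℕ)) (l : List ℕ)
    (k : List (ℕ × ℕ) → Bool), continueK n A x tb l k = true → ∃ tb', k tb' = true := by
  induction n with
  | zero => exact fun A x tb l k h => ⟨tb, h⟩
  | succ n ih =>
    intro A x tb l k h
    rw [continueK] at h
    split at h
    · exact ⟨_, h⟩
    · rw [filterK_eq] at h
      cases h0 : Nat.beq (transport3 A _ x) 0 <;> rw [h0] at h
      · cases h1 : Nat.beq (transport3 A _ x) 1 <;> rw [h1] at h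
        · exact ih _ _ _ _ _ h
        · exact ih _ _ _ _ _ h
      · exact ih _ _ _ _ _ h

theorem exists_parallelB_of_trivialB {st : List ℕ} (h : trivialB st = true) :
    ∀ A ∈ st, ∀ c < 3, ∃ tb, lookup3 tb A = c ∧ parallelB tb st = true := by
  cases st with
  | nil => simp
  | cons A l =>
    obtain ⟨t₀, h⟩ := exists_of_continueK _ _ _ _ _ _ h
    obtain ⟨t₁, h⟩ := exists_of_continueK _ _ _ _ _ _ h
    obtain ⟨t₂, h⟩ := exists_of_continueK _ _ _ _ _ _ h
    intro B hB c hc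
    rw [Bool.and_eq_true, Bool.and_eq_true, Bool.and_eq_true, List.all_eq_true] at h
    have h' := h.2 B hB
    rw [List.all_eq_true] at h'
    have h'' := h' c (List.mem_range.2 hc)
    rw [Bool.or_eq_true, Bool.or_eq_true, Nat.beq_eq, Nat.beq_eq, Nat.beq_eq] at h''
    rcases h'' with (h'' | h'') | h''
    exacts [⟨t₀, h'', h.1.1.1⟩, ⟨t₁, h'', h.1.1.2⟩, ⟨t₂, h'', h.1.2⟩]

theorem lookup3_lt (tb : List (ℕ × ℕ)) (A : ℕ) : lookup3 tb A < 3 := by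
  rw [lookup3]
  split
  exacts [by norm_num, Nat.mod_lt _ (by norm_num)]

theorem transport3_lt (A B : ℕ) {x : ℕ} (hx : x < 3) : transport3 A B x < 3 := by
  rw [transport3]
  split
  exacts [hx, Nat.mod_lt _ (by norm_num)]

theorem code_inter (s t : Finset ℕ) : code (s ∩ t) = Nat.land (code s) (code t) := by
  apply Nat.eq_of_testBit_eq
  intro i
  change _ = (code s &&& code t).testBit i
  rw [Nat.testBit_land, Bool.eq_iff_iff, Bool.and_eq_true, ← mem_iff_testBit_code,
    ← mem_iff_testBit_code, ← mem_iff_testBit_code, Finset.mem_inter]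

theorem cardB_code {s : Finset ℕ} (hs : code s < 2 ^ 14) {k : ℕ} :
    cardB (code s) k = true ↔ s.card = k := by
  rw [cardB, Nat.beq_eq, ← card_code_symm hs, code.symm_apply_apply]

theorem cardB_land {s t : Finset ℕ} (hs : code s < 2 ^ 14) {k : ℕ} :
    cardB (Nat.land (code s) (code t)) k = true ↔ (s ∩ t).card = k := by
  rw [← code_inter, cardB_code]
  rw [code_inter]
  exact Nat.and_le_left.trans_lt hs

/-- The transport between the fibres over coded tetrahedra. -/
def codedTransport (A B : Finset ℕ) (x : Fin 3) : Fin 3 :=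
  ⟨transport3 (code A) (code B) x, transport3_lt _ _ x.2⟩

/-- The assignment given by a table. -/
def tableAssignment (tb : List (ℕ × ℕ)) (A : Finset ℕ) : Fin 3 :=
  ⟨lookup3 tb (code A), lookup3_lt _ _⟩

theorem isParallel_of_parallelB {tb : List (ℕ × ℕ)} {st : List ℕ} (h : parallelB tb st = true)
    (hlt : ∀ m ∈ st, m < 2 ^ 14) {S : Set (Finset ℕ)} (hS : ∀ A ∈ S, code A ∈ st) :
    IsParallel codedTransport (tableAssignment tb) S := by
  intro A hA B hB hc
  simp only [parallelB, List.all_eq_true, Bool.or_eq_true, Bool.not_eq_true', Nat.beq_eq] at h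
  refine Fin.ext ((h _ (hS A hA) _ (hS B hB)).resolve_left ?_)
  rw [← cardB_land (hlt _ (hS A hA))] at hc
  exact fun h => absurd (hc.symm.trans h) (by decide)

theorem mem_tetrahedra_ofFacets {L : List (Finset ℕ)} {M : List ℕ} (hL : ∀ F ∈ L, F.card = 4)
    (hM : L.map code = M) {A s : Finset ℕ} :
    A ∈ (ofFacets L).tetrahedra s ↔ code A ∈ M ∧ s ⊆ A := by
  rw [← hM, List.mem_map_of_injective code.injective]
  exact ⟨fun h => ⟨mem_of_mem_ofFacets (d := 3) hL h.1 h.2.1, h.2.2⟩,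
    fun h => ⟨mem_ofFacets_of_mem (d := 3) hL h.1, hL A h.1, h.2⟩⟩

/-- Restriction of a branched covering to a subcomplex. -/
def BranchedCover.restrict {α X : Type*} [DecidableEq α] {K C : PreAbstractSimplicialComplex α}
    (M : BranchedCover K X) (h : C ≤ K) : BranchedCover C X where
  branch := M.branch
  transport := M.transport
  basePoint := M.basePoint
  transport_transport A hA B hB := M.transport_transport A (BranchedCover.tetrahedra_mono _ h hA) B
    (BranchedCover.tetrahedra_mono _ h hB)
  exists_isParallel e he heb A hA c := by
    obtain ⟨w, hw, hwp⟩ := M.exists_isParallel e he heb A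
      (BranchedCover.tetrahedra_mono _ h hA) c
    exact ⟨w, hw, hwp.mono (BranchedCover.tetrahedra_mono _ h)⟩
  basePoint_isParallel e he e' he' := by
    obtain ⟨v, hv, hv', hz⟩ := M.basePoint_isParallel e he e' he'
    exact ⟨v, hv, hv', hz.mono (BranchedCover.tetrahedra_mono _ h)⟩

/-- Follows the transport along a walk. -/
def holonomy3 : ℕ → List ℕ → ℕ → ℕ
  | _, [], x => x
  | A, B :: l, x => holonomy3 B l (transport3 A B x)

theorem holonomy3_eq {S : Set (Finset ℕ)} {x : Finset ℕ → Fin 3}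
    (hx : IsParallel codedTransport x S) : ∀ (l : List ℕ) (A : ℕ),
      (∀ m ∈ A :: l, code.symm m ∈ S ∧ m < 2 ^ 14) →
      (A :: l).IsChain (fun A B => cardB (Nat.land A B) 3 = true) →
      holonomy3 A l (x (code.symm A)) = x (code.symm ((A :: l).getLast (List.cons_ne_nil A l)))
  | [], A, _, _ => rfl
  | B :: l, A, hm, hch => by
    rw [List.isChain_cons_cons] at hch
    have hA := hm A List.mem_cons_self
    have hB := hm B (List.mem_cons_of_mem _ List.mem_cons_self)
    have h := hx _ hA.1 _ hB.1
    rw [← cardB_land (by simpa using hA.2), code.apply_symm_apply, code.apply_symm_apply] at h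
    have h' := congrArg Fin.val (h hch.1)
    rw [codedTransport, Fin.val_mk, code.apply_symm_apply, code.apply_symm_apply] at h'
    rw [holonomy3, h', List.getLast_cons (List.cons_ne_nil B l)]
    exact holonomy3_eq hx l B (fun m hm' => hm m (List.mem_cons_of_mem _ hm')) hch.2

/-- Tests that `B` is reached from `A` through neighbours in a list without crossing the triangle
`t`. -/
def reachB : ℕ → ℕ → ℕ → List ℕ → ℕ → Bool
  | 0, _, _, _, _ => false
  | n + 1, t, A, l, B => Nat.beq A B || l.any fun C =>
    cardB (Nat.land A C) 3 && !Nat.beq (Nat.land A C) t &&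
      filterK (fun D => !Nat.beq D C) l fun l' => reachB n t C l' B

theorem reflTransGen_of_reachB {K : PreAbstractSimplicialComplex ℕ} {e t : Finset ℕ} (n : ℕ) :
    ∀ (A B : Finset ℕ) (l : List ℕ), (∀ m ∈ l, code.symm m ∈ K.tetrahedra e ∧ m < 2 ^ 14) →
      A ∈ K.tetrahedra e → code A < 2 ^ 14 → reachB n (code t) (code A) l (code B) = true →
      Relation.ReflTransGen (BranchedCover.AroundStep K e t) A B := by
  induction n with
  | zero => intro A B l _ _ _ h; simp [reachB] at h
  | succ n ih =>
    intro A B l hl hA hA' h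
    simp only [reachB, filterK_eq, Bool.or_eq_true, Nat.beq_eq, List.any_eq_true,
      Bool.and_eq_true, Bool.not_eq_true', beq_false_iff, code.injective.eq_iff] at h
    rcases h with rfl | ⟨C, hC, ⟨hAC, hne⟩, h⟩
    · exact .refl
    · obtain ⟨C, rfl⟩ := code.surjective C
      obtain ⟨hCK, hC'⟩ := hl _ hC
      rw [code.symm_apply_apply] at hCK
      rw [← code_inter, ne_eq, code.injective.eq_iff] at hne
      rw [cardB_land hA'] at hAC
      exact .head ⟨hA, hCK, hAC, hne⟩ (ih C B _ (fun m hm => hl m (List.mem_of_mem_filter hm)) hCK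
        hC' h)

end CodedCover

/-! ### The knotted triangle and its three-sheeted covering. -/

section Knot

set_option maxRecDepth 100000

/-- The codes of the edges of the triangle `{1, 2, 3}`. -/
def knotEdgeCodes : List ℕ := [6, 10, 12]

theorem mem_sphere_tetrahedra {A s : Finset ℕ} :
    A ∈ sphereS_13_56.tetrahedra s ↔ code A ∈ sphereFacetCodes ∧ s ⊆ A := by
  rw [sphere_eq]
  exact mem_tetrahedra_ofFacets (by decide +kernel) (by decide +kernel)

theorem mem_ballB12_tetrahedra {A s : Finset ℕ} :
    A ∈ ballB_12_38.tetrahedra s ↔ code A ∈ ballB12FacetCodes ∧ s ⊆ A :=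
  mem_tetrahedra_ofFacets (by decide +kernel) (by decide +kernel)

theorem sphereFacetCodes_lt : ∀ m ∈ sphereFacetCodes, m < 2 ^ 14 := by decide +kernel

/-- The three-sheeted covering of `sphereS_13_56` branched over the knotted triangle
`{1, 2, 3}`. -/
def sphereCover : BranchedCover sphereS_13_56 (Fin 3) where
  branch := {e | code e ∈ knotEdgeCodes}
  transport := codedTransport
  basePoint := tableAssignment basePointData
  transport_transport A hA B hB hc x := by
    rw [mem_sphere_tetrahedra] at hA hB
    rw [← cardB_land (sphereFacetCodes_lt _ hA.1)] at hc
    have h : (sphereFacetCodes.all fun A => sphereFacetCodes.all fun B =>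
        !cardB (Nat.land A B) 3 || (List.range 3).all fun x =>
          Nat.beq (transport3 B A (transport3 A B x)) x) = true := by decide +kernel
    simp only [List.all_eq_true, Bool.or_eq_true, Bool.not_eq_true', Nat.beq_eq] at h
    exact Fin.ext (((h _ hA.1 _ hB.1).resolve_left fun h =>
      absurd (hc.symm.trans h) (by decide)) x (List.mem_range.2 x.2))
  exists_isParallel e he heb A hA c := by
    have heK : e ∈ sphereS_13_56.faces :=
      mem_of_subset hA.1 hA.2.2 (Finset.card_pos.1 (by omega))
    rw [mem_sphere] at heK
    rw [mem_sphere_tetrahedra] at hA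
    have hlt : code e < 2 ^ 14 :=
      (show ∀ m ∈ sphereFaces, m < 2 ^ 14 by decide +kernel) _ heK
    have h : (sphereFaces.all fun e => !cardB e 2 || knotEdgeCodes.any (Nat.beq e) ||
        filterK (subB e) sphereFacetCodes trivialB) = true := by decide +kernel
    simp only [List.all_eq_true, Bool.or_eq_true, Bool.not_eq_true', List.any_eq_true, Nat.beq_eq,
      filterK_eq, exists_eq_right'] at h
    have hmem : ∀ A : Finset ℕ, code A ∈ sphereFacetCodes.filter (subB (code e)) ↔
        code A ∈ sphereFacetCodes ∧ e ⊆ A := fun A => by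
      rw [List.mem_filter, subB_code]
    obtain ⟨tb, htb, hp⟩ := exists_parallelB_of_trivialB ((h _ heK).resolve_left fun h => by
      rcases h with h | h
      · simp [(cardB_code hlt).2 he] at h
      · exact heb h) (code A) ((hmem A).2 hA) c c.2
    exact ⟨tableAssignment tb, Fin.ext htb, isParallel_of_parallelB hp
      (fun m hm => sphereFacetCodes_lt m (List.mem_of_mem_filter hm))
      fun A hA => (hmem A).2 (mem_sphere_tetrahedra.1 hA)⟩
  basePoint_isParallel e he e' he' := by
    -- Any two edges of a triangle have a common vertex.
    obtain ⟨v, hv, h1, h2⟩ := (show ∀ a ∈ knotEdgeCodes, ∀ b ∈ knotEdgeCodes, ∃ v ∈ [1, 2, 3],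
      a.testBit v = true ∧ b.testBit v = true by decide +kernel) _ he _ he'
    refine ⟨v, mem_iff_testBit_code.2 h1, mem_iff_testBit_code.2 h2, ?_⟩
    have h := (show ∀ v ∈ [1, 2, 3],
      parallelB basePointData (sphereFacetCodes.filter (subB (2 ^ v))) = true by
        decide +kernel) v hv
    refine isParallel_of_parallelB h
      (fun m hm => sphereFacetCodes_lt m (List.mem_of_mem_filter hm)) fun A hA => ?_
    rw [List.mem_filter, ← code_singleton, subB_code]
    exact mem_sphere_tetrahedra.1 hA

theorem ballB12_le_sphere : ballB_12_38 ≤ sphereS_13_56 := by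
  rw [sphere_eq]
  rintro s ⟨hs, F, hF, hsF⟩
  exact ⟨hs, F, List.mem_append_left _ hF, hsF⟩

/-- The only nontrivial transport along the walk is `x ↦ x + 2`, from `10372` to `10308`, so the
holonomy is a translation modulo 3. -/
theorem ballB12_not_isParallel (x : Finset ℕ → Fin 3) :
    ¬ IsParallel sphereCover.transport x (ballB_12_38.tetrahedra ∅) := by
  intro hx
  have h := holonomy3_eq hx monodromyWalk.tail 8356 (fun m hm => by
    have hm' := (show ∀ m ∈ 8356 :: monodromyWalk.tail, m ∈ ballB12FacetCodes ∧ m < 2 ^ 14 by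
      decide +kernel) m hm
    exact ⟨mem_ballB12_tetrahedra.2 ⟨by simpa using hm'.1, Finset.empty_subset _⟩, hm'.2⟩)
    (by decide +kernel)
  exact (show ∀ c : Fin 3, holonomy3 8356 monodromyWalk.tail c ≠ c by decide +kernel) _ h

theorem sphere_not_isConstructible : ¬ sphereS_13_56.IsConstructible := by
  intro h
  obtain ⟨x, hx⟩ := (sphereCover.exists_isGood h sphere_isPure le_rfl).1
  exact ballB12_not_isParallel x
    (hx.1.mono (BranchedCover.tetrahedra_mono _ ballB12_le_sphere))

theorem ballB12_boundary : ballB_12_38.boundary 3 = ofFacets ballB12Triangles :=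
  boundary_ofFacets (by norm_num) (by decide +kernel) (by decide +kernel) (by decide +kernel)

theorem ballB12_not_isLCBall : ¬ ballB_12_38.IsLCBall := by
  have hlt : ∀ {A s}, A ∈ ballB_12_38.tetrahedra s → code A < 2 ^ 14 := fun hA =>
    (show ∀ m ∈ ballB12FacetCodes, m < 2 ^ 14 by decide +kernel) _ (mem_ballB12_tetrahedra.1 hA).1
  refine (sphereCover.restrict ballB12_le_sphere).not_isLCBall ?_ ?_ ?_ ballB12_not_isParallel
  · intro t ht A hA B hB T hT hAB
    have hc := card_inter_eq hA.2.1 hB.2.1 ht hA.2.2 hB.2.2 hAB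
    have hABT : A ∩ B ⊆ T := by
      rw [← Finset.eq_of_subset_of_card_le (Finset.subset_inter hA.2.2 hB.2.2) (by omega)]
      exact hT.2.2
    rw [← cardB_land (hlt hA)] at hc
    rw [← subB_code, code_inter] at hABT
    have h : (ballB12FacetCodes.all fun A => ballB12FacetCodes.all fun B =>
        !cardB (Nat.land A B) 3 || ballB12FacetCodes.all fun T =>
          !subB (Nat.land A B) T || Nat.beq T A || Nat.beq T B) = true := by decide +kernel
    simp only [List.all_eq_true, Bool.or_eq_true, Bool.not_eq_true', Nat.beq_eq] at h
    have h' := ((h _ (mem_ballB12_tetrahedra.1 hA).1 _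
      (mem_ballB12_tetrahedra.1 hB).1).resolve_left fun h =>
      absurd (hc.symm.trans h) (by decide)) _ (mem_ballB12_tetrahedra.1 hT).1
    rw [hABT] at h'
    simpa [code.injective.eq_iff] using h'
  · intro e he heK e' he' heK'
    -- The other two edges of the triangle contain the apex 1; the code `12` is that of the edge 2,
    -- 3.
    have h : ∀ a ∈ knotEdgeCodes, a ∈ ballB12Faces → a = 12 := by decide +kernel
    exact code.injective ((h _ he ((mem_ballB12 e).1 heK)).trans
      (h _ he' ((mem_ballB12 e').1 heK')).symm)
  · intro e he hec heb t ht het A hA B hB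
    rw [ballB12_boundary, mem_ballB12Boundary] at heb
    rw [mem_ballB12] at he
    have hlte : code e < 2 ^ 14 :=
      (show ∀ m ∈ ballB12Faces, m < 2 ^ 14 by decide +kernel) _ he
    by_cases hAB : A = B
    · rw [hAB]
    have hc := card_inter_eq hA.2.1 hB.2.1 ht hA.2.2 hB.2.2 hAB
    have hABt : t = A ∩ B :=
      Finset.eq_of_subset_of_card_le (Finset.subset_inter hA.2.2 hB.2.2) (by omega)
    rw [← cardB_land (hlt hA)] at hc
    have h : (ballB12Faces.all fun e => !cardB e 2 || ballB12BoundaryFaces.any (Nat.beq e) ||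
        filterK (subB e) ballB12FacetCodes fun st => st.all fun A => st.all fun B =>
          !cardB (Nat.land A B) 3 || reachB 14 (Nat.land A B) A st B) = true := by decide +kernel
    simp only [List.all_eq_true, Bool.or_eq_true, Bool.not_eq_true', List.any_eq_true, Nat.beq_eq,
      filterK_eq, exists_eq_right'] at h
    have hmem : ∀ A : Finset ℕ, code A ∈ ballB12FacetCodes.filter (subB (code e)) ↔
        A ∈ ballB_12_38.tetrahedra e := fun A => by
      rw [List.mem_filter, subB_code, mem_ballB12_tetrahedra]
    have hAe := BranchedCover.tetrahedra_anti het hA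
    have hBe := BranchedCover.tetrahedra_anti het hB
    have h' := (((h _ he).resolve_left fun h => by
      rcases h with h | h
      · simp [(cardB_code hlte).2 hec] at h
      · exact heb h) _ ((hmem A).2 hAe) _ ((hmem B).2 hBe)).resolve_left fun h =>
      absurd (hc.symm.trans h) (by decide)
    rw [← code_inter, ← hABt] at h'
    refine reflTransGen_of_reachB 14 A B _ (fun m hm => ?_) hAe (hlt hA) h'
    obtain ⟨C, rfl⟩ := code.surjective m
    rw [code.symm_apply_apply]
    exact ⟨(hmem C).1 hm, hlt ((hmem C).1 hm)⟩

end Knot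

end PreAbstractSimplicialComplex

theorem mainTheorem7 :
    (¬ ballB_9_18.IsShellable ∧ ballB_9_18.sd.IsVertexDecomposable) ∧
    (¬ sphereS_13_56.IsConstructible ∧ sphereS_13_56.sd.IsVertexDecomposable) ∧
    ((ballB_12_38.IsEvasive ∧ ¬ ballB_12_38.IsLCBall) ∧
      (ballB_12_38.sd.IsLCBall ∧ ballB_12_38.sd.IsNonevasive)) := by
  exact ⟨⟨PreAbstractSimplicialComplex.ballB9_not_isShellable,
      PreAbstractSimplicialComplex.ballB9_sd_isVertexDecomposable⟩,
    ⟨PreAbstractSimplicialComplex.sphere_not_isConstructible,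
      PreAbstractSimplicialComplex.sphere_sd_isVertexDecomposable⟩,
    ⟨PreAbstractSimplicialComplex.ballB12_isEvasive,
      PreAbstractSimplicialComplex.ballB12_not_isLCBall⟩,
    PreAbstractSimplicialComplex.ballB12_sd_isLCBall,
    PreAbstractSimplicialComplex.ballB12_sd_isNonevasive⟩
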